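/- Let $n\ge 2$, $Q=\mathbb R^n_+\times\mathbb S^{n-1}$ with $\mathbb R^n_+=\{x\in\mathbb R^n: x^n>0\}$, and let $\nu=-e_n$ be the outer unit normal on $\partial\mathbb R^n_+$ and $\Gamma_\pm=\{(x,\theta)\in\partial\mathbb R^n_+\times\mathbb S^{n-1}:\pm\,\theta\cdot\nu>0\}$. Let $\epsilon>0$ and let $\sigma,\lambda\in L^\infty(\mathbb R^n_+)$ satisfy $\sigma\ge\sigma_0$ and $\lambda\ge\lambda_0$ a.e. for some constants $\sigma_0,\lambda_0>0$. Let $\mathcal H=\{u\in L^2(Q):\nabla_\theta u\in L^2(Q)\}$ with $\|u\|_{\mathcal H}^2=\|u\|_{L^2}^2+\epsilon^2\|\nabla_\theta u\|_{L^2}^2$, where $\nabla_\theta$ is the weak gradient on the sphere, and $\mathcal Y=\{u\in\mathcal H:\theta\cdot\nabla_x u\in\mathcal H'\}$. For $f\in L^2(Q)$ and $g\in L^2(\Gamma_-;|\theta\cdot\nu|\,dS\,d\theta)$, a weak solution of $$-\epsilon^2\sigma\Delta_\theta u+\theta\cdot\nabla_x u+\lambda u=f\ \text{ in } Q,\qquad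 u=g\ \text{ on }\Gamma_-,$$ is a function $u\in\mathcal Y$ such that $$\int_Q\big(\epsilon^2\sigma\nabla_\theta u\cdot\nabla_\theta\varphi-u\,(\theta\cdot\nabla_x\varphi)+\lambda u\varphi\big)\,dx\,d\theta=\int_Q f\varphi\,dx\,d\theta+\int_{\Gamma_-}g\varphi\,|\theta\cdot\nu|\,dS(x)\,d\theta$$ for all $\varphi\in C^\infty_c(\overline Q)$ that vanish on $\Gamma_+$. **Lemma 2.3.** If $f\in L^\infty(Q)$ is compactly supported (that is, $f=0$ a.e. outside a compact subset of $\overline Q$) and $g=0$, then every weak solution $u$ satisfies $\|u\|_{L^\infty(Q)}\le\lambda_0^{-1}\|f\|_{L^\infty(Q)}$. -/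

import Mathlib

open MeasureTheory
open scoped ContDiff RealInnerProductSpace

noncomputable section

namespace FokkerPlanck

/-- The ambient Euclidean space `ℝⁿ`, where `n = d + 1`. -/
abbrev E (d : ℕ) : Type := EuclideanSpace ℝ (Fin (d + 1))

/-- The unit sphere `𝕊ⁿ⁻¹` of `ℝⁿ`, where `n = d + 1`. -/
abbrev Sph (d : ℕ) : Type := Metric.sphere (0 : E d) 1

/-- The open half space `ℝⁿ₊ = {x : xⁿ > 0}`. Its outer unit normal is `ν = -eₙ`, so that
`θ · ν = -θₙ` on its boundary. -/
def halfSpace (d : ℕ) : Set (E d) := {x | 0 < x (Fin.last d)}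

/-- The surface measure `dθ` of the unit sphere. -/
def sphereMeasure (d : ℕ) : Measure (Sph d) := (volume : Measure (E d)).toSphere

/-- The measure `dx dθ` on `Q = ℝⁿ₊ × 𝕊ⁿ⁻¹`, as a measure on `ℝⁿ × 𝕊ⁿ⁻¹`. -/
def measureQ (d : ℕ) : Measure (E d × Sph d) :=
  (volume.restrict (halfSpace d)).prod (sphereMeasure d)

/-- The boundary point `(x', 0)` of the half space. -/
def bdryPoint {d : ℕ} (x' : EuclideanSpace ℝ (Fin d)) : E d :=
  WithLp.toLp 2 (Fin.snoc (α := fun _ => ℝ) (fun i => x' i) 0)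

/-- The point `(x, θ)` of `ℝⁿ × 𝕊ⁿ⁻¹`, seen in `ℝⁿ × ℝⁿ`. -/
def emb {d : ℕ} (p : E d × Sph d) : E d × E d := (p.1, (p.2 : E d))

/-! Smooth compactly supported functions on `ℝⁿ × 𝕊ⁿ⁻¹`, or on the closure of `Q`, are exactly the
restrictions of smooth compactly supported functions on `ℝⁿ × ℝⁿ`; test functions are
given by such extensions, and the operators below depend only on the restriction. -/

/-- `θ · ∇ₓ φ` at the point `(x, θ)`. -/
def transport {d : ℕ} (φ : E d × E d → ℝ) (p : E d × Sph d) : ℝ :=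
  fderiv ℝ (fun x : E d => φ (x, (p.2 : E d))) p.1 (p.2 : E d)

/-- The spherical gradient `∇_θ φ` at `(x, θ)`: the component tangent to the sphere of the
Euclidean gradient in the second variable. -/
def angularGrad {d : ℕ} (φ : E d × E d → ℝ) (p : E d × Sph d) : E d :=
  gradient (fun θ : E d => φ (p.1, θ)) (p.2 : E d)
    - ⟪gradient (fun θ : E d => φ (p.1, θ)) (p.2 : E d), (p.2 : E d)⟫ • (p.2 : E d)

/-- The divergence on the sphere, at `(x, θ)`, of a vector field `X` that is tangent to the sphere
in its second variable: `∑ ⟨D_θ X τ, τ⟩` over an orthonormal basis `τ` of the tangent space,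
that is, the full trace of `D_θ X` minus its normal part. -/
def angularDiv {d : ℕ} (X : E d × E d → E d) (p : E d × Sph d) : ℝ :=
  LinearMap.trace ℝ (E d) (fderiv ℝ (fun θ : E d => X (p.1, θ)) (p.2 : E d)).toLinearMap
    - ⟪fderiv ℝ (fun θ : E d => X (p.1, θ)) (p.2 : E d) (p.2 : E d), (p.2 : E d)⟫

/-- `φ` represents an element of `C_c^∞(Q)`. -/
structure IsInteriorTest {d : ℕ} {F : Type} [NormedAddCommGroup F] [NormedSpace ℝ F]
    (φ : E d × E d → F) : Prop where
  smooth : ContDiff ℝ ∞ φ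
  compact : HasCompactSupport φ
  interior : tsupport φ ⊆ {q | q.1 ∈ halfSpace d}

/-- `φ` represents a smooth function on the closure of `Q`, with compact support in that
closure, that vanishes on the outgoing boundary `Γ₊ = {xⁿ = 0, θ · ν > 0}`. -/
structure IsTest {d : ℕ} (φ : E d × E d → ℝ) : Prop where
  smooth : ContDiff ℝ ∞ φ
  compact : HasCompactSupport φ
  vanish : ∀ (x' : EuclideanSpace ℝ (Fin d)) (θ : Sph d), (θ : E d) (Fin.last d) < 0 →
    φ (bdryPoint x', (θ : E d)) = 0

/-- `G ∈ L²(Q)` is the weak spherical gradient `∇_θ u` of `u` on `Q`. -/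
structure HasAngularGradient {d : ℕ} (u : E d × Sph d → ℝ) (G : E d × Sph d → E d) : Prop where
  memLp : MemLp G 2 (measureQ d)
  tangent : ∀ᵐ p ∂(measureQ d), ⟪G p, (p.2 : E d)⟫ = 0
  weak : ∀ X : E d × E d → E d, IsInteriorTest X →
    (∀ (x : E d) (θ : Sph d), ⟪X (x, (θ : E d)), (θ : E d)⟫ = 0) →
    ∫ p, ⟪G p, X (emb p)⟫ ∂(measureQ d) = - ∫ p, u p * angularDiv X p ∂(measureQ d)

/-- The norm `(‖φ‖² + ε² ‖∇_θ φ‖²)^(1/2)` (with `L²(Q)` norms) of a test function in `ℋ`. -/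
def normH {d : ℕ} (ε : ℝ) (φ : E d × E d → ℝ) : ℝ :=
  Real.sqrt (∫ p, φ (emb p) ^ 2 ∂(measureQ d) +
    ε ^ 2 * ∫ p, ‖angularGrad φ p‖ ^ 2 ∂(measureQ d))

/-- `u ∈ 𝒴`: `u` and `∇_θ u` are in `L²(Q)`, and the distribution
`T u = θ · ∇ₓ u`, `φ ↦ -∫ u θ · ∇ₓ φ` on `C_c^∞(Q)`, is bounded for the norm of `ℋ`
(in which `C_c^∞(Q)` is dense), that is, `T u ∈ ℋ'`. -/
structure MemY {d : ℕ} (ε : ℝ) (u : E d × Sph d → ℝ) : Prop where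
  memLp : MemLp u 2 (measureQ d)
  grad : ∃ G : E d × Sph d → E d, HasAngularGradient u G
  transport_dual : ∃ C : ℝ, ∀ φ : E d × E d → ℝ, IsInteriorTest φ →
    |∫ p, u p * transport φ p ∂(measureQ d)| ≤ C * normH ε φ

/-- `u` is a weak solution of `-ε² σ Δ_θ u + θ · ∇ₓ u + λ u = f` in `Q`, `u = g` on
`Γ₋ = {xⁿ = 0, θ · ν < 0}`. The boundary of the half space is parametrized by `x' ∈ ℝⁿ⁻¹`, with
surface measure `dx'`. -/
def IsWeakSolution {d : ℕ} (ε : ℝ) (σ lam : E d → ℝ) (f : E d × Sph d → ℝ)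
    (g : EuclideanSpace ℝ (Fin d) × Sph d → ℝ) (u : E d × Sph d → ℝ) : Prop :=
  MemY ε u ∧ ∃ G : E d × Sph d → E d, HasAngularGradient u G ∧
    ∀ φ : E d × E d → ℝ, IsTest φ →
      ∫ p, (ε ^ 2 * σ p.1 * ⟪G p, angularGrad φ p⟫ - u p * transport φ p
          + lam p.1 * u p * φ (emb p)) ∂(measureQ d)
        = ∫ p, f p * φ (emb p) ∂(measureQ d)
          + ∫ b in {b : EuclideanSpace ℝ (Fin d) × Sph d | 0 < (b.2 : E d) (Fin.last d)},
              g b * φ (bdryPoint b.1, (b.2 : E d)) * |(b.2 : E d) (Fin.last d)|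
                ∂((volume : Measure (EuclideanSpace ℝ (Fin d))).prod (sphereMeasure d))

end FokkerPlanck

end

open Filter Topology Set
open scoped Convolution ENNReal

set_option linter.unusedSectionVars false

namespace FokkerPlanck

/-! ### Mollification in `L²` -/

section Mollification

open ContinuousLinearMap (lsmul)

variable {W : Type*} [NormedAddCommGroup W] [NormedSpace ℝ W] [FiniteDimensional ℝ W]
  [MeasurableSpace W] [BorelSpace W] {μ : Measure W} [μ.IsAddHaarMeasure]

/-! The sphere is first flattened. Extend `u` to velocities `v` in a shell around the sphere by
`u(x, v/|v|)`, and by zero to `xₙ ≤ 0`. With `G = ∇ᵥu` and `H = |v|² ε²σ ∇_θ u` (taken at `v/|v|`),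
the extension satisfies `-∇ᵥ·H + v·∇ₓu + |v|(λu - f) = 0` in the sense of distributions wherever `xₙ
> 0` or `vₙ > 0`. The equation crosses the incoming boundary because `g = 0` and the test functions
of the weak formulation have to vanish on `Γ₊` only. Moreover `H·v = 0` and `H·G ≥ 0`.

Put `M = λ₀⁻¹‖f‖_∞`, so that the source `h = |v|(λu - f)` is positive where `u > M`. Let `b ≥ 0` be
nondecreasing, positive exactly above `M`, with primitive `β ≥ 0`. Multiplying the equation by
`b(u)ζ`, for a cutoff `ζ ≥ 0`, gives `∫ h ζ b(u) ≤ ∫ β(u) v·∇ₓζ - ∫ b(u) H·∇ᵥζ`, the term `∫ H·G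
b'(u)ζ` having been dropped. If the right side tends to a nonpositive limit, then `b(u) = 0`, that
is `u ≤ M`. The same argument for `-u` bounds `|u|`.

Two points need care. First, `b(u)ζ` is not an admissible test function. The equation is mollified
and the chain rule applied to the mollified solution; the commutator of `v·∇ₓ` with the mollifier
tends to zero in `L²` because the kernel is taken much narrower in `v` than in `x` (`exists_kernel`,
`IsKineticSystem.renormalized`). Second, no trace of `u` on the boundary is available. The cutoff
contains the factor `η(xₙ/s¹⁰ + vₙ/s⁴ - 1)` with `η` nondecreasing. Where `vₙ ≤ 0` its transport
derivative has the favourable sign. Elsewhere, and for the diffusion flux, the derivatives of the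
cutoff are large only on layers so thin that Young's inequality makes the errors `O(s)`
(`transport_fullCut_le`, `sum_flux_fullCut_le`). Then `s → 0`, and afterwards the spatial radius `R
→ ∞` (`IsKineticSystem.le_of_level`). -/

theorem enorm_convolution_le (k u : W → ℝ) (x : W) :
    ‖(k ⋆[lsmul ℝ ℝ, μ] u) x‖ₑ ≤ ∫⁻ t, ‖k t‖ₑ * ‖u (x - t)‖ₑ ∂μ := by
  refine (enorm_integral_le_lintegral_enorm _).trans (le_of_eq ?_)
  simp [enorm_mul]

/-- Young's inequality: Cauchy–Schwarz for the splitting `|k||u| = |k|^(1/2) (|k||u|²)^(1/2)`, then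
Tonelli and translation invariance. -/
theorem lintegral_convolution_sq_le {k u : W → ℝ} (hk : AEStronglyMeasurable k μ)
    (hu : AEStronglyMeasurable u μ) :
    ∫⁻ x, ‖(k ⋆[lsmul ℝ ℝ, μ] u) x‖ₑ ^ 2 ∂μ
      ≤ (∫⁻ t, ‖k t‖ₑ ∂μ) ^ 2 * ∫⁻ x, ‖u x‖ₑ ^ 2 ∂μ := by
  have hm : AEMeasurable (fun p : W × W => ‖k p.2‖ₑ * ‖u (p.1 - p.2)‖ₑ ^ 2) (μ.prod μ) := by
    have := (hk.convolution_integrand (lsmul ℝ ℝ) (hu.pow 2)).enorm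
    simpa [enorm_mul, enorm_pow] using! this
  have key : ∀ x, ‖(k ⋆[lsmul ℝ ℝ, μ] u) x‖ₑ ^ 2
      ≤ (∫⁻ t, ‖k t‖ₑ ∂μ) * ∫⁻ t, ‖k t‖ₑ * ‖u (x - t)‖ₑ ^ 2 ∂μ := by
    intro x
    have hux : AEMeasurable (fun t => ‖u (x - t)‖ₑ) μ :=
      (hu.comp_quasiMeasurePreserving
        (quasiMeasurePreserving_sub_left_of_right_invariant μ x)).enorm
    have h1 := ENNReal.lintegral_mul_norm_pow_le (μ := μ) (f := fun t => ‖k t‖ₑ)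
      (g := fun t => ‖k t‖ₑ * ‖u (x - t)‖ₑ ^ 2) hk.enorm (hk.enorm.mul (hux.pow_const 2))
      (p := 1 / 2) (q := 1 / 2) (by norm_num) (by norm_num) (by norm_num)
    have h2 : ∀ a b : ℝ≥0∞, a ^ (1 / 2 : ℝ) * (a * b ^ 2) ^ (1 / 2 : ℝ) = a * b := by
      intro a b
      rw [ENNReal.mul_rpow_of_nonneg _ _ (by norm_num), ← mul_assoc,
        ← ENNReal.rpow_add_of_nonneg _ _ (by norm_num) (by norm_num), ← ENNReal.rpow_natCast,
        ← ENNReal.rpow_mul]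
      norm_num
    simp only [h2] at h1
    have h3 : ∀ a : ℝ≥0∞, (a ^ (1 / 2 : ℝ)) ^ 2 = a := by
      intro a
      rw [← ENNReal.rpow_natCast, ← ENNReal.rpow_mul]; norm_num
    calc _ ≤ _ := pow_le_pow_left' ((enorm_convolution_le k u x).trans h1) 2
      _ = _ := by rw [mul_pow, h3, h3]
  calc _ ≤ ∫⁻ x, (∫⁻ t, ‖k t‖ₑ ∂μ) * ∫⁻ t, ‖k t‖ₑ * ‖u (x - t)‖ₑ ^ 2 ∂μ ∂μ :=
        lintegral_mono key
    _ = (∫⁻ t, ‖k t‖ₑ ∂μ) * ∫⁻ x, ∫⁻ t, ‖k t‖ₑ * ‖u (x - t)‖ₑ ^ 2 ∂μ ∂μ :=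
        lintegral_const_mul'' _ hm.lintegral_prod_right'
    _ = (∫⁻ t, ‖k t‖ₑ ∂μ) * ∫⁻ t, ∫⁻ x, ‖k t‖ₑ * ‖u (x - t)‖ₑ ^ 2 ∂μ ∂μ := by
        rw [lintegral_lintegral_swap hm]
    _ = (∫⁻ t, ‖k t‖ₑ ∂μ) * ∫⁻ t, ‖k t‖ₑ * ∫⁻ x, ‖u x‖ₑ ^ 2 ∂μ ∂μ := by
        congr 1
        refine lintegral_congr fun t => ?_
        rw [lintegral_const_mul', lintegral_sub_right_eq_self (fun x => ‖u x‖ₑ ^ 2)]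
        exact enorm_ne_top
    _ = _ := by
        rw [lintegral_mul_const'' _ hk.enorm, sq, mul_assoc]

theorem eLpNorm_two_sq (u : W → ℝ) : eLpNorm u 2 μ ^ 2 = ∫⁻ x, ‖u x‖ₑ ^ 2 ∂μ := by
  rw [eLpNorm_eq_lintegral_rpow_enorm_toReal (by norm_num) (by norm_num), ← ENNReal.rpow_natCast,
    ← ENNReal.rpow_mul]
  simp

theorem eLpNorm_convolution_le {k u : W → ℝ} (hk : AEStronglyMeasurable k μ)
    (hu : AEStronglyMeasurable u μ) :
    eLpNorm (k ⋆[lsmul ℝ ℝ, μ] u) 2 μ ≤ (∫⁻ t, ‖k t‖ₑ ∂μ) * eLpNorm u 2 μ := by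
  have h := lintegral_convolution_sq_le hk hu
  rw [← eLpNorm_two_sq, ← eLpNorm_two_sq, ← mul_pow] at h
  exact (ENNReal.pow_le_pow_left_iff two_ne_zero).1 h

theorem MemLp.locallyIntegrable_two {u : W → ℝ} (hu : MemLp u 2 μ) : LocallyIntegrable u μ :=
  hu.locallyIntegrable (by norm_num)

theorem memLp_convolution {k u : W → ℝ} (hk : Continuous k) (hkc : HasCompactSupport k)
    (hu : MemLp u 2 μ) : MemLp (k ⋆[lsmul ℝ ℝ, μ] u) 2 μ := by
  refine ⟨(hkc.continuous_convolution_left _ hk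
    (MemLp.locallyIntegrable_two hu)).aestronglyMeasurable, ?_⟩
  refine (eLpNorm_convolution_le hk.aestronglyMeasurable hu.1).trans_lt ?_
  exact ENNReal.mul_lt_top (hk.integrable_of_hasCompactSupport hkc).2 hu.2

/-- A sequence of smooth approximations of the identity. -/
structure IsMollifier (μ : Measure W) (k : ℕ → W → ℝ) : Prop where
  smooth : ∀ j, ContDiff ℝ ∞ (k j)
  nonneg : ∀ j x, 0 ≤ k j x
  integral : ∀ j, ∫ x, k j x ∂μ = 1
  support : ∀ j : ℕ, Function.support (k j) ⊆ Metric.ball 0 (1 / ((j : ℝ) + 1))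

namespace IsMollifier

variable {k : ℕ → W → ℝ}

theorem hasCompactSupport (hk : IsMollifier μ k) (j : ℕ) : HasCompactSupport (k j) :=
  HasCompactSupport.intro (isCompact_closedBall 0 (1 / ((j : ℝ) + 1))) fun x hx => by
    by_contra h
    exact hx (Metric.ball_subset_closedBall (hk.support j h))

theorem lintegral_enorm (hk : IsMollifier μ k) (j : ℕ) : ∫⁻ t, ‖k j t‖ₑ ∂μ = 1 := by
  have : ∀ t, ‖k j t‖ₑ = ENNReal.ofReal (k j t) := fun t => Real.enorm_of_nonneg (hk.nonneg j t)
  simp only [this]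
  rw [← ofReal_integral_eq_lintegral_ofReal _ (.of_forall (hk.nonneg j)), hk.integral,
    ENNReal.ofReal_one]
  exact (hk.smooth j).continuous.integrable_of_hasCompactSupport (hk.hasCompactSupport j)

/-- Uniform continuity makes the difference uniformly small, and all differences live in the closed
1-neighbourhood of the support of `g`, since every kernel has support of radius at most 1. -/
theorem eLpNorm_convolution_sub_le (hk : IsMollifier μ k) {g : W → ℝ} (hg : Continuous g)
    (hgc : HasCompactSupport g) :
    Tendsto (fun j => eLpNorm (k j ⋆[lsmul ℝ ℝ, μ] g - g) 2 μ) atTop (𝓝 0) := by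
  obtain ⟨K, hKc, hK⟩ : ∃ K : Set W, IsCompact K ∧
      ∀ (j : ℕ) x, x ∉ K → (k j ⋆[lsmul ℝ ℝ, μ] g - g) x = 0 := by
    refine ⟨Metric.cthickening 1 (tsupport g), hgc.isCompact.cthickening, fun j x hx => ?_⟩
    have h1 : ∀ t ∈ Metric.ball x 1, g t = 0 := by
      intro t ht
      by_contra h
      exact hx (Metric.mem_cthickening_of_dist_le x t 1 _ (subset_tsupport _ h)
        (by rw [dist_comm]; exact (Metric.mem_ball.1 ht).le))
    have h2 : g x = 0 := h1 x (Metric.mem_ball_self one_pos)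
    have h3 : (k j ⋆[lsmul ℝ ℝ, μ] g) x = 0 := by
      refine integral_eq_zero_of_ae (.of_forall fun t => ?_)
      by_cases ht : t ∈ Metric.ball (0 : W) (1 / ((j : ℝ) + 1))
      · have : g (x - t) = 0 := by
          apply h1
          have := Metric.mem_ball.1 ht
          rw [Metric.mem_ball, dist_eq_norm]
          rw [dist_zero_right] at this
          rw [sub_sub_cancel_left, norm_neg]
          refine this.trans_le ?_
          rw [div_le_one (by positivity)]
          linarith [(Nat.cast_nonneg j : (0 : ℝ) ≤ j)]
        simp [this]
      · have : k j t = 0 := by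
          by_contra h
          exact ht (hk.support j h)
        simp [this]
    simp [h2, h3]
  have hμK : μ K < ⊤ := hKc.measure_lt_top
  rw [ENNReal.tendsto_nhds_zero]
  intro ε hε
  obtain ⟨η, hη, hηε⟩ : ∃ η : ℝ, 0 < η ∧
      ENNReal.ofReal η * μ K ^ (1 / 2 : ℝ) ≤ ε := by
    rcases eq_or_ne ε ⊤ with rfl | hε'
    · exact ⟨1, one_pos, le_top⟩
    set m := μ K ^ (1 / 2 : ℝ) with hm
    have hm' : m ≠ ⊤ := ENNReal.rpow_ne_top_of_nonneg (by norm_num) hμK.ne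
    refine ⟨ε.toReal / (m.toReal + 1), by
      have := ENNReal.toReal_pos hε.ne' hε'
      positivity, ?_⟩
    rw [← ENNReal.ofReal_toReal hm', ← ENNReal.ofReal_mul (by positivity),
      ← ENNReal.ofReal_toReal hε', ENNReal.toReal_ofReal (by positivity),
      ENNReal.toReal_ofReal (by positivity)]
    apply ENNReal.ofReal_le_ofReal
    have h0 : 0 ≤ m.toReal := ENNReal.toReal_nonneg
    have h1 : 0 ≤ ε.toReal := ENNReal.toReal_nonneg
    rw [div_mul_eq_mul_div, div_le_iff₀ (by positivity)]
    nlinarith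
  obtain ⟨r, hr, hgr⟩ := Metric.uniformContinuous_iff.1
    (hgc.uniformContinuous_of_continuous hg) η hη
  have hev : ∀ᶠ j : ℕ in atTop, 1 / ((j : ℝ) + 1) < r :=
    (tendsto_order.1 tendsto_one_div_add_atTop_nhds_zero_nat).2 r hr
  filter_upwards [hev] with j hj
  have hb : ∀ x, ‖(k j ⋆[lsmul ℝ ℝ, μ] g - g) x‖ ≤ η := by
    intro x
    rw [Pi.sub_apply, ← dist_eq_norm]
    refine dist_convolution_le hη.le (hk.support j) (hk.nonneg j) (hk.integral j)
      hg.aestronglyMeasurable fun t ht => ?_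
    exact (hgr ((Metric.mem_ball.1 ht).trans hj)).le
  have hind : (k j ⋆[lsmul ℝ ℝ, μ] g - g) = K.indicator (k j ⋆[lsmul ℝ ℝ, μ] g - g) := by
    ext x
    by_cases hx : x ∈ K
    · simp [hx]
    · rw [indicator_of_notMem hx, hK j x hx]
  refine le_trans ?_ hηε
  rw [hind, eLpNorm_indicator_eq_eLpNorm_restrict hKc.measurableSet]
  refine (eLpNorm_le_of_ae_bound (.of_forall hb)).trans (le_of_eq ?_)
  rw [mul_comm, Measure.restrict_apply_univ]
  norm_num

/-- Density of continuous compactly supported functions, together with the bound of Young's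
inequality, which is uniform in `j` because each kernel has mass 1. -/
theorem tendsto_eLpNorm (hk : IsMollifier μ k) {u : W → ℝ} (hu : MemLp u 2 μ) :
    Tendsto (fun j => eLpNorm (k j ⋆[lsmul ℝ ℝ, μ] u - u) 2 μ) atTop (𝓝 0) := by
  rw [ENNReal.tendsto_nhds_zero]
  intro ε hε
  have hε3 : ε / 3 ≠ 0 := (ENNReal.div_pos hε.ne' (by norm_num)).ne'
  obtain ⟨g, hgc, hug, hg, hgm⟩ := hu.exists_hasCompactSupport_eLpNorm_sub_le (by norm_num) hε3
  filter_upwards [ENNReal.tendsto_nhds_zero.1 (hk.eLpNorm_convolution_sub_le hg hgc) (ε / 3)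
    hε3.bot_lt] with j hj
  have hkj := (hk.smooth j).continuous
  have hkc := hk.hasCompactSupport j
  have hex : ∀ w : W → ℝ, MemLp w 2 μ → ConvolutionExists (k j) w (lsmul ℝ ℝ) μ := fun w hw =>
    hkc.convolutionExists_left _ hkj (MemLp.locallyIntegrable_two hw)
  have hsplit : k j ⋆[lsmul ℝ ℝ, μ] u - u
      = (k j ⋆[lsmul ℝ ℝ, μ] (u - g)) + ((k j ⋆[lsmul ℝ ℝ, μ] g - g) + (g - u)) := by
    have : u = (u - g) + g := by simp
    conv_lhs => rw [this, (hex _ (hu.sub hgm)).distrib_add (hex _ hgm)]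
    abel
  rw [hsplit]
  have m1 := memLp_convolution hkj hkc (hu.sub hgm)
  have m2 := (memLp_convolution hkj hkc hgm).sub hgm
  have m3 := hgm.sub hu
  calc _ ≤ _ := eLpNorm_add_le m1.1 (m2.add m3).1 (by norm_num)
    _ ≤ _ := add_le_add le_rfl (eLpNorm_add_le m2.1 m3.1 (by norm_num))
    _ ≤ ε / 3 + (ε / 3 + ε / 3) := by
        refine add_le_add ?_ (add_le_add hj ?_)
        · refine (eLpNorm_convolution_le hkj.aestronglyMeasurable (hu.sub hgm).1).trans ?_
          rwa [hk.lintegral_enorm, one_mul]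
        · rwa [← neg_sub, eLpNorm_neg]
    _ = ε := by rw [← add_assoc, ENNReal.add_thirds]

end IsMollifier

end Mollification

/-! ### Limits of integrals of products -/

section ProductLimits

variable {X : Type*} [MeasurableSpace X] {μ : Measure X}

theorem eLpNorm_one_mul_le {p q : X → ℝ} (hp : AEStronglyMeasurable p μ)
    (hq : AEStronglyMeasurable q μ) :
    eLpNorm (p * q) 1 μ ≤ eLpNorm p 2 μ * eLpNorm q 2 μ := by
  have h : ENNReal.HolderTriple 2 2 1 := inferInstance
  have := eLpNorm_smul_le_mul_eLpNorm (p := 2) (q := 2) (r := 1) hq hp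
  rwa [smul_eq_mul] at this

theorem tendsto_eLpNorm_one_mul {p q : ℕ → X → ℝ} {p₀ q₀ : X → ℝ}
    (hp : ∀ j, MemLp (p j) 2 μ) (hp₀ : MemLp p₀ 2 μ) (hq : ∀ j, MemLp (q j) 2 μ)
    (hq₀ : MemLp q₀ 2 μ) (hpt : Tendsto (fun j => eLpNorm (p j - p₀) 2 μ) atTop (𝓝 0))
    (hqt : Tendsto (fun j => eLpNorm (q j - q₀) 2 μ) atTop (𝓝 0)) :
    Tendsto (fun j => eLpNorm (p j * q j - p₀ * q₀) 1 μ) atTop (𝓝 0) := by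
  have hb : ∀ j, eLpNorm (p j * q j - p₀ * q₀) 1 μ ≤
      eLpNorm (p j - p₀) 2 μ * (eLpNorm (q j - q₀) 2 μ + eLpNorm q₀ 2 μ)
        + eLpNorm p₀ 2 μ * eLpNorm (q j - q₀) 2 μ := by
    intro j
    have h1 : p j * q j - p₀ * q₀ = (p j - p₀) * q j + p₀ * (q j - q₀) := by ring
    have h2 : q j = (q j - q₀) + q₀ := by ring
    rw [h1]
    refine (eLpNorm_add_le (((hp j).sub hp₀).1.mul (hq j).1)
      (hp₀.1.mul ((hq j).sub hq₀).1) le_rfl).trans (add_le_add ?_ ?_)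
    · refine (eLpNorm_one_mul_le ((hp j).sub hp₀).1 (hq j).1).trans ?_
      gcongr
      conv_lhs => rw [h2]
      exact eLpNorm_add_le ((hq j).sub hq₀).1 hq₀.1 (by norm_num)
    · exact eLpNorm_one_mul_le hp₀.1 ((hq j).sub hq₀).1
  refine tendsto_of_tendsto_of_tendsto_of_le_of_le tendsto_const_nhds ?_ (fun _ => zero_le) hb
  have e1 : Tendsto (fun j => eLpNorm (p j - p₀) 2 μ *
      (eLpNorm (q j - q₀) 2 μ + eLpNorm q₀ 2 μ)) atTop (𝓝 (0 * (0 + eLpNorm q₀ 2 μ))) :=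
    ENNReal.Tendsto.mul hpt (Or.inr (by simpa using hq₀.2.ne)) (hqt.add tendsto_const_nhds)
      (Or.inr (by simp))
  have e2 : Tendsto (fun j => eLpNorm p₀ 2 μ * eLpNorm (q j - q₀) 2 μ) atTop
      (𝓝 (eLpNorm p₀ 2 μ * 0)) := ENNReal.Tendsto.const_mul hqt (Or.inr hp₀.2.ne)
  simpa using e1.add e2

/-- Split `s j * r j = (s j - s₀) * r j + s₀ * r j`: the first part is small in `L¹`, the second
converges by domination. The nonlinear factors thus need only a uniform bound and convergence almost
everywhere. -/
theorem tendsto_integral_mul_of_bounded {s r : ℕ → X → ℝ} {s₀ r₀ : X → ℝ} {C : ℝ}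
    (hs : ∀ j, Integrable (s j) μ) (hs₀ : Integrable s₀ μ)
    (hst : Tendsto (fun j => eLpNorm (s j - s₀) 1 μ) atTop (𝓝 0))
    (hr : ∀ j, AEStronglyMeasurable (r j) μ)
    (hrC : ∀ j x, |r j x| ≤ C) (hrt : ∀ᵐ x ∂μ, Tendsto (fun j => r j x) atTop (𝓝 (r₀ x))) :
    Tendsto (fun j => ∫ x, s j x * r j x ∂μ) atTop (𝓝 (∫ x, s₀ x * r₀ x ∂μ)) := by
  have hmul : ∀ {w : X → ℝ}, Integrable w μ → ∀ j, Integrable (fun x => w x * r j x) μ :=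
    fun hw j => hw.mul_bdd (hr j) (.of_forall (hrC j))
  have h1 : Tendsto (fun j => ∫ x, s₀ x * r j x ∂μ) atTop (𝓝 (∫ x, s₀ x * r₀ x ∂μ)) := by
    refine tendsto_integral_of_dominated_convergence (fun x => |s₀ x| * C)
      (fun j => (hmul hs₀ j).1) (hs₀.abs.mul_const C) (fun j => .of_forall fun x => ?_) ?_
    · rw [norm_mul]
      exact mul_le_mul_of_nonneg_left (hrC j x) (abs_nonneg _)
    · filter_upwards [hrt] with x hx using hx.const_mul _
  have h2 : Tendsto (fun j => ∫ x, (s j x - s₀ x) * r j x ∂μ) atTop (𝓝 0) := by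
    have hb : ∀ j, ‖∫ x, (s j x - s₀ x) * r j x ∂μ‖ ≤ (eLpNorm (s j - s₀) 1 μ).toReal * C := by
      intro j
      rw [eLpNorm_one_eq_lintegral_enorm, ← integral_norm_eq_lintegral_enorm ((hs j).sub hs₀).1,
        ← integral_mul_const]
      refine norm_integral_le_of_norm_le (((hs j).sub hs₀).norm.mul_const C) (.of_forall fun x => ?_)
      rw [norm_mul]
      exact mul_le_mul_of_nonneg_left (hrC j x) (norm_nonneg _)
    refine squeeze_zero_norm hb ?_
    have := ((ENNReal.tendsto_toReal ENNReal.zero_ne_top).comp hst).mul_const C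
    simpa using this
  have := h2.add h1
  rw [zero_add] at this
  refine this.congr fun j => ?_
  have hi : Integrable (fun x => (s j x - s₀ x) * r j x) μ := hmul ((hs j).sub hs₀) j
  rw [← integral_add hi (hmul hs₀ j)]
  refine integral_congr_ae (.of_forall fun x => ?_)
  simp only; ring

end ProductLimits

end FokkerPlanck

namespace FokkerPlanck

open ContinuousLinearMap (lsmul)

/-! ### Derivatives of convolutions and integration by parts -/

section ConvolutionDerivative

variable {W : Type*} [NormedAddCommGroup W] [NormedSpace ℝ W] [FiniteDimensional ℝ W]
  [MeasurableSpace W] [BorelSpace W] {μ : Measure W} [μ.IsAddHaarMeasure]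

theorem convolution_apply_swap (k u : W → ℝ) (z : W) :
    (k ⋆[lsmul ℝ ℝ, μ] u) z = ∫ t, k (z - t) * u t ∂μ := by
  rw [convolution_eq_swap]; rfl

theorem fderiv_convolution_apply {k u : W → ℝ} (hk : ContDiff ℝ ∞ k) (hkc : HasCompactSupport k)
    (hu : LocallyIntegrable u μ) (z a : W) :
    fderiv ℝ (k ⋆[lsmul ℝ ℝ, μ] u) z a = ∫ t, fderiv ℝ k (z - t) a * u t ∂μ := by
  have hk1 : ContDiff ℝ 1 k := hk.of_le (by exact_mod_cast le_top)
  have h := (hkc.hasFDerivAt_convolution_right (lsmul ℝ ℝ).flip hu hk1 z).fderiv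
  rw [convolution_flip] at h
  rw [h, convolution_precompR_apply _ hu (hkc.fderiv ℝ) (hk1.continuous_fderiv one_ne_zero)]
  rfl

theorem contDiff_convolution {k u : W → ℝ} (hk : ContDiff ℝ ∞ k) (hkc : HasCompactSupport k)
    (hu : LocallyIntegrable u μ) : ContDiff ℝ 1 (k ⋆[lsmul ℝ ℝ, μ] u) :=
  hkc.contDiff_convolution_left (n := 1) _ (hk.of_le (by exact_mod_cast le_top)) hu

theorem integral_fderiv_mul_eq_neg {f g : W → ℝ} (hf : ContDiff ℝ 1 f) (hg : ContDiff ℝ 1 g)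
    (hgc : HasCompactSupport g) (a : W) :
    ∫ z, fderiv ℝ f z a * g z ∂μ = - ∫ z, f z * fderiv ℝ g z a ∂μ := by
  have hf' := (hf.continuous_fderiv one_ne_zero).clm_apply (continuous_const (y := a))
  have hg' := (hg.continuous_fderiv one_ne_zero).clm_apply (continuous_const (y := a))
  have hgc' : HasCompactSupport fun z => fderiv ℝ g z a := hgc.fderiv_apply ℝ a
  rw [integral_mul_fderiv_eq_neg_fderiv_mul_of_integrable, neg_neg]
  · exact (hf'.mul hg.continuous).integrable_of_hasCompactSupport hgc.mul_left
  · exact (hf.continuous.mul hg').integrable_of_hasCompactSupport hgc'.mul_left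
  · exact (hf.continuous.mul hg.continuous).integrable_of_hasCompactSupport hgc.mul_left
  · exact fun x _ => hf.differentiable one_ne_zero x
  · exact fun x _ => hg.differentiable one_ne_zero x

end ConvolutionDerivative

/-! ### An anisotropic mollifier with small transport commutator -/

section Kernel

variable {V : Type*} [NormedAddCommGroup V] [InnerProductSpace ℝ V] [FiniteDimensional ℝ V]
  [MeasurableSpace V] [BorelSpace V] 

theorem fderiv_mul_prod_apply {ρ ρ' : V → ℝ} (hρ : Differentiable ℝ ρ) (hρ' : Differentiable ℝ ρ')
    (z : V × V) (y : V) :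
    fderiv ℝ (fun z : V × V => ρ z.1 * ρ' z.2) z (y, 0) = fderiv ℝ ρ z.1 y * ρ' z.2 := by
  have e1 : HasFDerivAt (fun z : V × V => ρ z.1) _ z := (hρ z.1).hasFDerivAt.comp z hasFDerivAt_fst
  have e2 : HasFDerivAt (fun z : V × V => ρ' z.2) _ z :=
    (hρ' z.2).hasFDerivAt.comp z hasFDerivAt_snd
  rw [HasFDerivAt.fderiv (f := fun z : V × V => ρ z.1 * ρ' z.2) (e1.mul e2)]
  simp [mul_comm]

/-- The commutator of `v·∇ₓ` with convolution by `k` is convolution by `v·∇ₓk`. For `k(x, v) =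
ρ(x)ρ'(v)` the `L¹` norm of that kernel is at most the velocity radius times `‖∇ρ‖_{L¹}`. Choosing
the velocity radius after `ρ` makes it small, so no regularity of `u` is needed for the commutator
to vanish. -/
theorem exists_kernel (δ : ℝ) (hδ : 0 < δ) : ∃ k : V × V → ℝ, ContDiff ℝ ∞ k ∧ (∀ z, 0 ≤ k z) ∧
    ∫ z, k z = 1 ∧ Function.support k ⊆ Metric.ball 0 δ ∧
    ∫⁻ z : V × V, ‖fderiv ℝ k z (z.2, 0)‖ₑ ≤ ENNReal.ofReal δ := by
  let f : ContDiffBump (0 : V) := ⟨δ / 2, δ, by positivity, by linarith⟩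
  let ρ : V → ℝ := f.normed volume
  have hρ : ContDiff ℝ ∞ ρ := f.contDiff_normed
  have hρc : HasCompactSupport ρ := f.hasCompactSupport_normed
  have hρi : Integrable (fun y => ‖fderiv ℝ ρ y‖) :=
    (((hρ.continuous_fderiv (by simp)).integrable_of_hasCompactSupport (hρc.fderiv ℝ))).norm
  set C := ∫ y, ‖fderiv ℝ ρ y‖ with hC
  have hC0 : 0 ≤ C := integral_nonneg fun _ => norm_nonneg _
  let γ := min δ (δ / (C + 1))
  have hγ : 0 < γ := lt_min hδ (by positivity)
  have hγC : γ * C ≤ δ := by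
    have h1 : γ * C ≤ δ / (C + 1) * C := mul_le_mul_of_nonneg_right (min_le_right _ _) hC0
    refine h1.trans ?_
    rw [div_mul_eq_mul_div, div_le_iff₀ (by positivity)]
    nlinarith
  let f' : ContDiffBump (0 : V) := ⟨γ / 2, γ, by positivity, by linarith⟩
  let ρ' : V → ℝ := f'.normed volume
  have hρ' : ContDiff ℝ ∞ ρ' := f'.contDiff_normed
  have hs' : Function.support ρ' = Metric.ball 0 γ := f'.support_normed_eq
  refine ⟨fun z => ρ z.1 * ρ' z.2, (hρ.comp contDiff_fst).mul (hρ'.comp contDiff_snd),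
    fun z => mul_nonneg (f.nonneg_normed _) (f'.nonneg_normed _), ?_, ?_, ?_⟩
  · rw [Measure.volume_eq_prod, integral_prod_mul, f.integral_normed, f'.integral_normed, one_mul]
  · intro z hz
    have h1 : z.1 ∈ Metric.ball (0 : V) δ := by
      have : z.1 ∈ Function.support ρ := left_ne_zero_of_mul hz
      rwa [f.support_normed_eq] at this
    have h2 : z.2 ∈ Metric.ball (0 : V) γ := by
      have : z.2 ∈ Function.support ρ' := right_ne_zero_of_mul hz
      rwa [hs'] at this
    rw [show (0 : V × V) = (0, 0) from rfl, ← ball_prod_same]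
    exact ⟨h1, Metric.ball_subset_ball (min_le_left _ _) h2⟩
  · have hd : ∀ z : V × V, fderiv ℝ (fun z : V × V => ρ z.1 * ρ' z.2) z (z.2, 0)
        = fderiv ℝ ρ z.1 z.2 * ρ' z.2 := fun z =>
      fderiv_mul_prod_apply (hρ.differentiable (by simp)) (hρ'.differentiable (by simp)) z z.2
    have hb : ∀ z : V × V, ‖fderiv ℝ (fun z : V × V => ρ z.1 * ρ' z.2) z (z.2, 0)‖ₑ
        ≤ ENNReal.ofReal (γ * ‖fderiv ℝ ρ z.1‖) * ENNReal.ofReal (ρ' z.2) := by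
      intro z
      rw [hd, ← ENNReal.ofReal_mul (by positivity), ← ofReal_norm]
      apply ENNReal.ofReal_le_ofReal
      rw [norm_mul, Real.norm_of_nonneg (show 0 ≤ ρ' z.2 from f'.nonneg_normed z.2)]
      by_cases hz : ρ' z.2 = 0
      · rw [hz, mul_zero, mul_zero]
      · refine mul_le_mul_of_nonneg_right ?_ (f'.nonneg_normed _)
        have h2 : z.2 ∈ Metric.ball (0 : V) γ := by rw [← hs']; exact hz
        rw [mem_ball_zero_iff] at h2
        refine (ContinuousLinearMap.le_opNorm _ _).trans ?_
        rw [mul_comm]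
        exact mul_le_mul_of_nonneg_right h2.le (norm_nonneg _)
    have i1 : ∫⁻ y, ENNReal.ofReal (γ * ‖fderiv ℝ ρ y‖) = ENNReal.ofReal (γ * C) := by
      rw [← ofReal_integral_eq_lintegral_ofReal (hρi.const_mul γ)
        (.of_forall fun _ => by positivity), integral_const_mul]
    have i2 : ∫⁻ y, ENNReal.ofReal (ρ' y) = 1 := by
      rw [← ofReal_integral_eq_lintegral_ofReal f'.integrable_normed
        (.of_forall fun _ => f'.nonneg_normed _), f'.integral_normed, ENNReal.ofReal_one]
    have i3 := lintegral_prod_mul (μ := (volume : Measure V)) (ν := (volume : Measure V))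
      (hρi.const_mul γ).1.aemeasurable.ennreal_ofReal
      hρ'.continuous.measurable.aemeasurable.ennreal_ofReal
    rw [i1, i2, mul_one] at i3
    exact (lintegral_mono hb).trans (i3.le.trans (ENNReal.ofReal_le_ofReal hγC))

variable (V) in
theorem exists_mollifier : ∃ k : ℕ → V × V → ℝ, IsMollifier volume k ∧
    ∀ j, ∫⁻ z : V × V, ‖fderiv ℝ (k j) z (z.2, 0)‖ₑ ≤ ENNReal.ofReal (1 / ((j : ℝ) + 1)) := by
  choose k h1 h2 h3 h4 h5 using fun j : ℕ =>
    exists_kernel (V := V) (1 / ((j : ℝ) + 1)) (by positivity)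
  exact ⟨k, ⟨h1, h2, h3, h4⟩, h5⟩

end Kernel

instance (d : ℕ) : (volume : Measure (E d × E d)).IsAddHaarMeasure :=
  inferInstanceAs ((volume : Measure (E d)).prod volume).IsAddHaarMeasure

instance (d : ℕ) : (volume : Measure (E d × E d)).IsNegInvariant :=
  Measure.IsAddHaarMeasure.isNegInvariant_of_regular _

/-! ### Integration by parts for the transport field -/

section KineticIntegration

variable {d : ℕ}

/-- The direction of the `i`-th coordinate of the velocity variable. -/
noncomputable def velDir (i : Fin (d + 1)) : E d × E d := (0, EuclideanSpace.single i 1)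

/-- The direction of the `i`-th coordinate of the position variable. -/
noncomputable def posDir (i : Fin (d + 1)) : E d × E d := (EuclideanSpace.single i 1, 0)

theorem sum_posDir (v : E d) : ∑ i, v i • (posDir i : E d × E d) = (v, 0) := by
  have h : ∑ i, v i • (EuclideanSpace.single i 1 : E d) = v := by
    ext j
    simp [Finset.sum_apply, Pi.single_apply]
  refine Prod.ext ?_ ?_
  · simpa [posDir, Prod.fst_sum] using h
  · simp [posDir, Prod.snd_sum]

/-- The field `(v, 0)` is divergence free, since its coefficients `vᵢ` do not depend on `x`; hence
coordinatewise integration by parts leaves no zero order term. -/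
theorem integral_transport_mul_eq_neg {B ζ : E d × E d → ℝ} (hB : ContDiff ℝ 1 B)
    (hζ : ContDiff ℝ 1 ζ) (hζc : HasCompactSupport ζ) :
    ∫ z, fderiv ℝ B z (z.2, 0) * ζ z = - ∫ z, B z * fderiv ℝ ζ z (z.2, 0) := by
  have hB' : ∀ a, Continuous fun z => fderiv ℝ B z a := fun a =>
    (hB.continuous_fderiv one_ne_zero).clm_apply continuous_const
  have hζ' : ∀ a, Continuous fun z => fderiv ℝ ζ z a := fun a =>
    (hζ.continuous_fderiv one_ne_zero).clm_apply continuous_const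
  have hv : ∀ i : Fin (d + 1), ContDiff ℝ 1 fun z : E d × E d => z.2 i := fun i => by fun_prop
  have e1 : ∀ z : E d × E d, fderiv ℝ B z (z.2, 0) * ζ z
      = ∑ i, fderiv ℝ B z (posDir i) * (z.2 i * ζ z) := by
    intro z
    rw [← sum_posDir z.2, map_sum, Finset.sum_mul]
    refine Finset.sum_congr rfl fun i _ => ?_
    rw [map_smul, smul_eq_mul]; ring
  have e2 : ∀ z : E d × E d, B z * fderiv ℝ ζ z (z.2, 0)
      = ∑ i, B z * (z.2 i * fderiv ℝ ζ z (posDir i)) := by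
    intro z
    rw [← sum_posDir z.2, map_sum, Finset.mul_sum]
    refine Finset.sum_congr rfl fun i _ => ?_
    rw [map_smul, smul_eq_mul]
  have e3 : ∀ (i : Fin (d + 1)) (z : E d × E d),
      fderiv ℝ (fun z : E d × E d => z.2 i * ζ z) z (posDir i)
        = z.2 i * fderiv ℝ ζ z (posDir i) := by
    intro i z
    rw [fderiv_fun_mul ((hv i).differentiable one_ne_zero z) (hζ.differentiable one_ne_zero z)]
    have : fderiv ℝ (fun z : E d × E d => z.2 i) z (posDir i) = 0 := by
      have h : HasFDerivAt (fun z : E d × E d => z.2 i)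
          ((EuclideanSpace.proj i : E d →L[ℝ] ℝ).comp (ContinuousLinearMap.snd ℝ (E d) (E d))) z :=
        ((EuclideanSpace.proj i : E d →L[ℝ] ℝ).comp
          (ContinuousLinearMap.snd ℝ (E d) (E d))).hasFDerivAt
      rw [h.fderiv]
      simp [posDir]
    simp [this]
  simp_rw [e1, e2]
  rw [integral_finsetSum, integral_finsetSum, ← Finset.sum_neg_distrib]
  · refine Finset.sum_congr rfl fun i _ => ?_
    rw [integral_fderiv_mul_eq_neg hB ((hv i).mul hζ) hζc.mul_left]
    simp_rw [e3]
  · intro i _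
    exact (hB.continuous.mul ((hv i).continuous.mul (hζ' _))).integrable_of_hasCompactSupport
      ((hζc.fderiv_apply ℝ _).mul_left.mul_left)
  · intro i _
    exact ((hB' _).mul ((hv i).continuous.mul hζ.continuous)).integrable_of_hasCompactSupport
      (hζc.mul_left.mul_left)

end KineticIntegration

end FokkerPlanck

/-! ### Kinetic systems and the renormalized equation for the mollified solution -/

namespace FokkerPlanck

open ContinuousLinearMap (lsmul)

variable {d : ℕ}

/-- Square integrable data `u, G, H, h` on `ℝⁿ × ℝⁿ` such that, in the sense of distributions on the
open set `O`, `G = ∇ᵥ u` and `-∇ᵥ · H + v · ∇ₓ u + h = 0`. -/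
structure IsKineticSystem (O : Set (E d × E d)) (u h : E d × E d → ℝ)
    (G H : Fin (d + 1) → E d × E d → ℝ) : Prop where
  isOpen : IsOpen O
  memLp_u : MemLp u 2
  memLp_h : MemLp h 2
  memLp_G : ∀ i, MemLp (G i) 2
  memLp_H : ∀ i, MemLp (H i) 2
  grad : ∀ φ : E d × E d → ℝ, ContDiff ℝ ∞ φ → HasCompactSupport φ → tsupport φ ⊆ O →
    ∀ i, ∫ z, φ z * G i z = - ∫ z, fderiv ℝ φ z (velDir i) * u z
  eqn : ∀ φ : E d × E d → ℝ, ContDiff ℝ ∞ φ → HasCompactSupport φ → tsupport φ ⊆ O →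
    ∑ i, (∫ z, fderiv ℝ φ z (velDir i) * H i z) - (∫ z, fderiv ℝ φ z (z.2, 0) * u z)
      + (∫ z, φ z * h z) = 0

/-- `β` is a `C²` nonlinearity with bounded first and second derivatives `b` and `b'`. -/
structure IsRenormalizer (β b b' : ℝ → ℝ) (C : ℝ) : Prop where
  deriv₁ : ∀ s, HasDerivAt β (b s) s
  deriv₂ : ∀ s, HasDerivAt b (b' s) s
  cont : Continuous b'
  zero : β 0 = 0
  bound₁ : ∀ s, |b s| ≤ C
  bound₂ : ∀ s, |b' s| ≤ C

namespace IsRenormalizer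

variable {β b b' : ℝ → ℝ} {C : ℝ}

theorem continuous_b (hβ : IsRenormalizer β b b' C) : Continuous b :=
  continuous_iff_continuousAt.2 fun s => (hβ.deriv₂ s).continuousAt

theorem continuous_β (hβ : IsRenormalizer β b b' C) : Continuous β :=
  continuous_iff_continuousAt.2 fun s => (hβ.deriv₁ s).continuousAt

theorem contDiff_b (hβ : IsRenormalizer β b b' C) : ContDiff ℝ 1 b := by
  rw [contDiff_one_iff_deriv]
  refine ⟨fun s => (hβ.deriv₂ s).differentiableAt, ?_⟩
  rw [show deriv b = b' from funext fun s => (hβ.deriv₂ s).deriv]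
  exact hβ.cont

theorem contDiff_β (hβ : IsRenormalizer β b b' C) : ContDiff ℝ 1 β := by
  rw [contDiff_one_iff_deriv]
  refine ⟨fun s => (hβ.deriv₁ s).differentiableAt, ?_⟩
  rw [show deriv β = b from funext fun s => (hβ.deriv₁ s).deriv]
  exact hβ.continuous_b

theorem abs_sub_le (hβ : IsRenormalizer β b b' C) (s t : ℝ) : |β s - β t| ≤ C * |s - t| := by
  have h := Convex.norm_image_sub_le_of_norm_hasDerivWithin_le (f := β) (f' := b) (s := univ)
    (C := C) (fun x _ => (hβ.deriv₁ x).hasDerivWithinAt) (fun x _ => hβ.bound₁ x) convex_univ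
    (mem_univ t) (mem_univ s)
  simpa using h

end IsRenormalizer

section Pointwise

variable {O : Set (E d × E d)} {u h : E d × E d → ℝ} {G H : Fin (d + 1) → E d × E d → ℝ}

theorem tsupport_translate_subset {k : E d × E d → ℝ} {δ : ℝ}
    (hk : Function.support k ⊆ Metric.ball 0 δ) (z : E d × E d) :
    tsupport (fun t => k (z - t)) ⊆ Metric.closedBall z δ := by
  refine closure_minimal (fun t ht => ?_) Metric.isClosed_closedBall
  have := hk (show z - t ∈ Function.support k from ht)
  rw [mem_ball_zero_iff] at this
  rw [Metric.mem_closedBall, dist_comm, dist_eq_norm]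
  exact this.le

theorem fderiv_translate {k : E d × E d → ℝ} (hk : Differentiable ℝ k) (z t a : E d × E d) :
    fderiv ℝ (fun t => k (z - t)) t a = - fderiv ℝ k (z - t) a := by
  have h : HasFDerivAt (fun t => z - t) (-ContinuousLinearMap.id ℝ (E d × E d)) t :=
    (hasFDerivAt_id t).const_sub z
  rw [HasFDerivAt.fderiv (f := fun t => k (z - t)) ((hk (z - t)).hasFDerivAt.comp t h)]
  simp

theorem hasCompactSupport_translate {k : E d × E d → ℝ} {δ : ℝ}
    (hk : Function.support k ⊆ Metric.ball 0 δ) (z : E d × E d) :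
    HasCompactSupport (fun t => k (z - t)) :=
  (isCompact_closedBall z δ).of_isClosed_subset (isClosed_tsupport _)
    (tsupport_translate_subset hk z)

/-- The distributional gradient is tested with the translated kernel `t ↦ k (z - t)`, whose support
lies in `O` when the closed ball about `z` does. -/
theorem IsKineticSystem.fderiv_convolution_velDir (hs : IsKineticSystem O u h G H)
    {k : E d × E d → ℝ} (hk : ContDiff ℝ ∞ k) {δ : ℝ}
    (hkδ : Function.support k ⊆ Metric.ball 0 δ) (hkc : HasCompactSupport k)
    {z : E d × E d} (hz : Metric.closedBall z δ ⊆ O) (i : Fin (d + 1)) :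
    fderiv ℝ (k ⋆[lsmul ℝ ℝ, volume] u) z (velDir i) = (k ⋆[lsmul ℝ ℝ, volume] G i) z := by
  have h1 := hs.grad (fun t => k (z - t)) (hk.comp (contDiff_const.sub contDiff_id))
    (hasCompactSupport_translate hkδ z) ((tsupport_translate_subset hkδ z).trans hz) i
  rw [fderiv_convolution_apply hk hkc (MemLp.locallyIntegrable_two hs.memLp_u),
    convolution_apply_swap, h1, ← integral_neg]
  refine integral_congr_ae (.of_forall fun t => ?_)
  simp only [fderiv_translate (hk.differentiable (by simp))]
  ring

/-- The equation tested with `t ↦ k (z - t)`. Freezing the transport velocity at `z` instead of `t`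
produces the commutator, the third term. -/
theorem IsKineticSystem.convolution_eqn (hs : IsKineticSystem O u h G H)
    {k : E d × E d → ℝ} (hk : ContDiff ℝ ∞ k) {δ : ℝ}
    (hkδ : Function.support k ⊆ Metric.ball 0 δ) (hkc : HasCompactSupport k)
    {z : E d × E d} (hz : Metric.closedBall z δ ⊆ O) :
    - ∑ i, fderiv ℝ (k ⋆[lsmul ℝ ℝ, volume] H i) z (velDir i)
      + fderiv ℝ (k ⋆[lsmul ℝ ℝ, volume] u) z (z.2, 0)
      - ((fun s => fderiv ℝ k s (s.2, 0)) ⋆[lsmul ℝ ℝ, volume] u) z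
      + (k ⋆[lsmul ℝ ℝ, volume] h) z = 0 := by
  have h1 := hs.eqn (fun t => k (z - t)) (hk.comp (contDiff_const.sub contDiff_id))
    (hasCompactSupport_translate hkδ z) ((tsupport_translate_subset hkδ z).trans hz)
  have hkd : Differentiable ℝ k := hk.differentiable (by simp)
  have hdk : Continuous (fderiv ℝ k) := hk.continuous_fderiv (by simp)
  have hu := MemLp.locallyIntegrable_two hs.memLp_u
  simp only [fderiv_translate hkd, neg_mul, integral_neg] at h1
  have hc : ∀ a : E d × E d, Integrable fun t => fderiv ℝ k (z - t) a * u t := by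
    intro a
    have := ((hkc.fderiv_apply ℝ a).convolutionExists_left (lsmul ℝ ℝ)
      (hdk.clm_apply continuous_const) hu z).integrable_swap
    simpa using this
  have hm : HasCompactSupport fun s : E d × E d => fderiv ℝ k s (s.2, 0) := by
    refine (hkc.fderiv ℝ).mono fun s hs' => ?_
    contrapose! hs'
    simp [Function.notMem_support.1 hs']
  have hmc : Integrable fun t => fderiv ℝ k (z - t) ((z - t).2, 0) * u t := by
    have := (hm.convolutionExists_left (lsmul ℝ ℝ)
      (hdk.clm_apply (by fun_prop)) hu z).integrable_swap
    simpa using this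
  have hsplit : ∫ t, fderiv ℝ k (z - t) (t.2, 0) * u t
      = fderiv ℝ (k ⋆[lsmul ℝ ℝ, volume] u) z (z.2, 0)
        - ((fun s => fderiv ℝ k s (s.2, 0)) ⋆[lsmul ℝ ℝ, volume] u) z := by
    rw [fderiv_convolution_apply hk hkc hu, convolution_apply_swap, ← integral_sub (hc _) hmc]
    refine integral_congr_ae (.of_forall fun t => ?_)
    -- The velocity at `t` is the velocity at `z` minus the displacement, which is the argument of
    -- the commutator kernel.
    have : ((t.2, 0) : E d × E d) = (z.2, 0) - ((z - t).2, 0) := by simp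
    simp only
    rw [this, map_sub]
    ring
  rw [hsplit, Finset.sum_neg_distrib] at h1
  have hH : ∀ i, fderiv ℝ (k ⋆[lsmul ℝ ℝ, volume] H i) z (velDir i)
      = ∫ t, fderiv ℝ k (z - t) (velDir i) * H i t := fun i =>
    fderiv_convolution_apply hk hkc (MemLp.locallyIntegrable_two (hs.memLp_H i)) _ _
  simp only [hH]
  rw [convolution_apply_swap k h]
  linarith

end Pointwise

section Renormalization

variable {O : Set (E d × E d)} {u h : E d × E d → ℝ} {G H : Fin (d + 1) → E d × E d → ℝ}
  {β b b' : ℝ → ℝ} {C : ℝ}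

/-- The renormalized equation for the mollified solution, with the commutator as a source. -/
theorem IsKineticSystem.renormalized_convolution (hs : IsKineticSystem O u h G H)
    (hβ : IsRenormalizer β b b' C)
    {k : E d × E d → ℝ} (hk : ContDiff ℝ ∞ k) {δ : ℝ}
    (hkδ : Function.support k ⊆ Metric.ball 0 δ) (hkc : HasCompactSupport k)
    {ζ : E d × E d → ℝ} (hζ : ContDiff ℝ 1 ζ) (hζc : HasCompactSupport ζ)
    (hζO : ∀ z ∈ tsupport ζ, Metric.closedBall z δ ⊆ O) :
    ∑ i, ((∫ z, ((k ⋆[lsmul ℝ ℝ, volume] H i) z * (k ⋆[lsmul ℝ ℝ, volume] G i) z)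
            * (b' ((k ⋆[lsmul ℝ ℝ, volume] u) z) * ζ z))
        + ∫ z, ((k ⋆[lsmul ℝ ℝ, volume] H i) z * fderiv ℝ ζ z (velDir i))
            * b ((k ⋆[lsmul ℝ ℝ, volume] u) z))
      - (∫ z, β ((k ⋆[lsmul ℝ ℝ, volume] u) z) * fderiv ℝ ζ z (z.2, 0))
      - (∫ z, (((fun s => fderiv ℝ k s (s.2, 0)) ⋆[lsmul ℝ ℝ, volume] u) z * ζ z)
            * b ((k ⋆[lsmul ℝ ℝ, volume] u) z))
      + (∫ z, ((k ⋆[lsmul ℝ ℝ, volume] h) z * ζ z) * b ((k ⋆[lsmul ℝ ℝ, volume] u) z)) = 0 := by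
  have hdk : Continuous (fderiv ℝ k) := hk.continuous_fderiv (by simp)
  have hm : HasCompactSupport fun s : E d × E d => fderiv ℝ k s (s.2, 0) := by
    refine (hkc.fderiv ℝ).mono fun s hs' => ?_
    contrapose! hs'
    simp [Function.notMem_support.1 hs']
  have hmcont : Continuous ((fun s => fderiv ℝ k s (s.2, 0)) ⋆[lsmul ℝ ℝ, volume] u) :=
    hm.continuous_convolution_left _ (hdk.clm_apply (by fun_prop))
      (MemLp.locallyIntegrable_two hs.memLp_u)
  have hC : ∀ w : E d × E d → ℝ, MemLp w 2 → ContDiff ℝ 1 (k ⋆[lsmul ℝ ℝ, volume] w) :=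
    fun w hw => contDiff_convolution hk hkc (MemLp.locallyIntegrable_two hw)
  have hgrad : ∀ z ∈ tsupport ζ, ∀ i, fderiv ℝ (k ⋆[lsmul ℝ ℝ, volume] u) z (velDir i)
      = (k ⋆[lsmul ℝ ℝ, volume] G i) z := fun z hz i =>
    hs.fderiv_convolution_velDir hk hkδ hkc (hζO z hz) i
  have heqn := fun z hz => hs.convolution_eqn hk hkδ hkc (hζO z hz)
  have hU := hC u hs.memLp_u
  have hh := (hC h hs.memLp_h).continuous
  have hHc := fun i => hC (H i) (hs.memLp_H i)
  have hGc := fun i => (hC (G i) (hs.memLp_G i)).continuous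
  set m := (fun s => fderiv ℝ k s (s.2, 0)) ⋆[lsmul ℝ ℝ, volume] u
  set U := k ⋆[lsmul ℝ ℝ, volume] u
  set hh' := k ⋆[lsmul ℝ ℝ, volume] h
  set G' := fun i => k ⋆[lsmul ℝ ℝ, volume] G i
  set H' := fun i => k ⋆[lsmul ℝ ℝ, volume] H i
  change ∀ z ∈ tsupport ζ, ∀ i, fderiv ℝ U z (velDir i) = G' i z at hgrad
  change ∀ i, ContDiff ℝ 1 (H' i) at hHc
  change ∀ i, Continuous (G' i) at hGc
  change ∀ z ∈ tsupport ζ, - ∑ i, fderiv ℝ (H' i) z (velDir i) + fderiv ℝ U z (z.2, 0) - m z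
    + hh' z = 0 at heqn
  change ∑ i, ((∫ z, (H' i z * G' i z) * (b' (U z) * ζ z))
        + ∫ z, (H' i z * fderiv ℝ ζ z (velDir i)) * b (U z))
      - (∫ z, β (U z) * fderiv ℝ ζ z (z.2, 0)) - (∫ z, (m z * ζ z) * b (U z))
      + (∫ z, (hh' z * ζ z) * b (U z)) = 0
  have hbU : ContDiff ℝ 1 fun z => b (U z) := hβ.contDiff_b.comp hU
  have hβU : ContDiff ℝ 1 fun z => β (U z) := hβ.contDiff_β.comp hU
  have hb'U : Continuous fun z => b' (U z) := hβ.cont.comp hU.continuous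
  have hdc : ∀ {w : E d × E d → ℝ} {a : E d × E d → E d × E d}, ContDiff ℝ 1 w → Continuous a →
      Continuous fun z => fderiv ℝ w z (a z) := fun hw ha =>
    (hw.continuous_fderiv one_ne_zero).clm_apply ha
  have htest : ContDiff ℝ 1 fun z => b (U z) * ζ z := hbU.mul hζ
  have htestc : HasCompactSupport fun z => b (U z) * ζ z := hζc.mul_left
  have hdζ : ∀ i, HasCompactSupport fun z => fderiv ℝ ζ z (velDir i) := fun i =>
    hζc.fderiv_apply ℝ _
  have hvc : Continuous fun z : E d × E d => ((z.2, 0) : E d × E d) := by fun_prop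
  -- Integration by parts against `b(U)ζ`. The identity `∇ᵥU = G'` is known only on `tsupport ζ`,
  -- but the term containing it carries the factor `ζ`.
  have fluxes : ∀ i, - ∫ z, fderiv ℝ (H' i) z (velDir i) * (b (U z) * ζ z)
      = (∫ z, (H' i z * G' i z) * (b' (U z) * ζ z))
        + ∫ z, (H' i z * fderiv ℝ ζ z (velDir i)) * b (U z) := by
    intro i
    rw [integral_fderiv_mul_eq_neg (hHc i) htest htestc, neg_neg, ← integral_add]
    · refine integral_congr_ae (.of_forall fun z => ?_)
      have e : fderiv ℝ (fun z => b (U z) * ζ z) z (velDir i)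
          = b' (U z) * fderiv ℝ U z (velDir i) * ζ z + b (U z) * fderiv ℝ ζ z (velDir i) := by
        have e1 : HasFDerivAt (fun z => b (U z)) (b' (U z) • fderiv ℝ U z) z :=
          (hβ.deriv₂ (U z)).comp_hasFDerivAt z (hU.differentiable one_ne_zero z).hasFDerivAt
        rw [HasFDerivAt.fderiv (f := fun z => b (U z) * ζ z)
          (e1.mul (hζ.differentiable one_ne_zero z).hasFDerivAt)]
        simp
        ring
      simp only [e]
      by_cases hz : z ∈ tsupport ζ
      · rw [hgrad z hz]; ring
      · rw [image_eq_zero_of_notMem_tsupport hz]; ring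
    · exact (((hHc i).continuous.mul (hGc i)).mul (hb'U.mul
        hζ.continuous)).integrable_of_hasCompactSupport hζc.mul_left.mul_left
    · exact (((hHc i).continuous.mul (hdc hζ continuous_const)).mul
        hbU.continuous).integrable_of_hasCompactSupport (hdζ i).mul_left.mul_right
  have htransport : ∫ z, fderiv ℝ U z (z.2, 0) * (b (U z) * ζ z)
      = - ∫ z, β (U z) * fderiv ℝ ζ z (z.2, 0) := by
    rw [← integral_transport_mul_eq_neg hβU hζ hζc]
    refine integral_congr_ae (.of_forall fun z => ?_)
    have e1 : HasFDerivAt (fun z => β (U z)) (b (U z) • fderiv ℝ U z) z :=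
      (hβ.deriv₁ (U z)).comp_hasFDerivAt z (hU.differentiable one_ne_zero z).hasFDerivAt
    simp only [e1.fderiv, smul_apply, smul_eq_mul]
    ring
  have hzero : ∫ z, (- ∑ i, fderiv ℝ (H' i) z (velDir i) * (b (U z) * ζ z)
      + fderiv ℝ U z (z.2, 0) * (b (U z) * ζ z) - (m z * ζ z) * b (U z)
      + (hh' z * ζ z) * b (U z)) = 0 := by
    refine integral_eq_zero_of_ae (.of_forall fun z => ?_)
    by_cases hz : z ∈ tsupport ζ
    · have := heqn z hz
      simp only [Pi.zero_apply, ← Finset.sum_mul]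
      linear_combination (b (U z) * ζ z) * this
    · simp [image_eq_zero_of_notMem_tsupport hz]
  have i1 : ∀ i, Integrable fun z => fderiv ℝ (H' i) z (velDir i) * (b (U z) * ζ z) := fun i =>
    ((hdc (hHc i) continuous_const).mul htest.continuous).integrable_of_hasCompactSupport
      htestc.mul_left
  have i2 : Integrable fun z => fderiv ℝ U z (z.2, 0) * (b (U z) * ζ z) :=
    ((hdc hU hvc).mul htest.continuous).integrable_of_hasCompactSupport htestc.mul_left
  have i3 : Integrable fun z => (m z * ζ z) * b (U z) :=
    ((hmcont.mul hζ.continuous).mul hbU.continuous).integrable_of_hasCompactSupport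
      hζc.mul_left.mul_right
  have i4 : Integrable fun z => (hh' z * ζ z) * b (U z) :=
    ((hh.mul hζ.continuous).mul hbU.continuous).integrable_of_hasCompactSupport
      hζc.mul_left.mul_right
  have i0 : Integrable fun z => - ∑ i, fderiv ℝ (H' i) z (velDir i) * (b (U z) * ζ z) :=
    (integrable_finsetSum _ fun i _ => i1 i).neg
  have i02 : Integrable fun z => - ∑ i, fderiv ℝ (H' i) z (velDir i) * (b (U z) * ζ z)
      + fderiv ℝ U z (z.2, 0) * (b (U z) * ζ z) := i0.add i2
  have i023 : Integrable fun z => - ∑ i, fderiv ℝ (H' i) z (velDir i) * (b (U z) * ζ z)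
      + fderiv ℝ U z (z.2, 0) * (b (U z) * ζ z) - (m z * ζ z) * b (U z) := i02.sub i3
  rw [integral_add i023 i4, integral_sub i02 i3, integral_add i0 i2,
    integral_neg, integral_finsetSum _ fun i _ => i1 i, htransport] at hzero
  rw [← Finset.sum_congr rfl fun i _ => fluxes i, Finset.sum_neg_distrib]
  linarith

end Renormalization

end FokkerPlanck

/-! ### Removal of the mollification -/

namespace FokkerPlanck

open ContinuousLinearMap (lsmul)

theorem tendsto_integral_mul_mul {X : Type*} [MeasurableSpace X] {μ : Measure X}
    {p q r : ℕ → X → ℝ} {p₀ q₀ r₀ : X → ℝ} {C : ℝ}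
    (hp : ∀ j, MemLp (p j) 2 μ) (hp₀ : MemLp p₀ 2 μ) (hq : ∀ j, MemLp (q j) 2 μ)
    (hq₀ : MemLp q₀ 2 μ) (hpt : Tendsto (fun j => eLpNorm (p j - p₀) 2 μ) atTop (𝓝 0))
    (hqt : Tendsto (fun j => eLpNorm (q j - q₀) 2 μ) atTop (𝓝 0))
    (hr : ∀ j, AEStronglyMeasurable (r j) μ) (hrC : ∀ j x, |r j x| ≤ C)
    (hrt : ∀ᵐ x ∂μ, Tendsto (fun j => r j x) atTop (𝓝 (r₀ x))) :
    Tendsto (fun j => ∫ x, (p j x * q j x) * r j x ∂μ) atTop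
      (𝓝 (∫ x, (p₀ x * q₀ x) * r₀ x ∂μ)) :=
  tendsto_integral_mul_of_bounded (fun j => (hp j).integrable_mul (hq j)) (hp₀.integrable_mul hq₀)
    (tendsto_eLpNorm_one_mul hp hp₀ hq hq₀ hpt hqt) hr hrC hrt

variable {d : ℕ}

section Renormalization

variable {O : Set (E d × E d)} {u h : E d × E d → ℝ} {G H : Fin (d + 1) → E d × E d → ℝ}
  {β b b' : ℝ → ℝ} {C : ℝ}

theorem IsRenormalizer.memLp (hβ : IsRenormalizer β b b' C) {X : Type*} [MeasurableSpace X]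
    {μ : Measure X} {w : X → ℝ} (hw : MemLp w 2 μ) : MemLp (fun x => β (w x)) 2 μ := by
  refine (hw.const_mul C).mono (hβ.continuous_β.comp_aestronglyMeasurable hw.1)
    (.of_forall fun x => ?_)
  have := hβ.abs_sub_le (w x) 0
  rw [hβ.zero, sub_zero, sub_zero] at this
  rw [norm_mul]
  refine this.trans (mul_le_mul_of_nonneg_right (le_abs_self C) (abs_nonneg _))

theorem IsRenormalizer.tendsto_eLpNorm (hβ : IsRenormalizer β b b' C) {X : Type*}
    [MeasurableSpace X] {μ : Measure X} {w : ℕ → X → ℝ} {w₀ : X → ℝ}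
    (hw : Tendsto (fun j => eLpNorm (w j - w₀) 2 μ) atTop (𝓝 0)) :
    Tendsto (fun j => eLpNorm ((fun x => β (w j x)) - fun x => β (w₀ x)) 2 μ) atTop (𝓝 0) := by
  have hC : 0 ≤ C := (abs_nonneg _).trans (hβ.bound₁ 0)
  have hb : ∀ j, eLpNorm ((fun x => β (w j x)) - fun x => β (w₀ x)) 2 μ
      ≤ ENNReal.ofReal C * eLpNorm (w j - w₀) 2 μ := fun j =>
    eLpNorm_le_mul_eLpNorm_of_ae_le_mul (.of_forall fun x => hβ.abs_sub_le _ _) 2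
  refine tendsto_of_tendsto_of_tendsto_of_le_of_le tendsto_const_nhds ?_ (fun _ => zero_le) hb
  have := ENNReal.Tendsto.const_mul (a := ENNReal.ofReal C) hw (Or.inr ENNReal.ofReal_ne_top)
  rwa [mul_zero] at this

theorem tendsto_zero_of_le_ofReal_mul {a : ℕ → ℝ≥0∞} {c : ℝ≥0∞} (hc : c ≠ ⊤)
    (ha : ∀ j : ℕ, a j ≤ ENNReal.ofReal (1 / ((j : ℝ) + 1)) * c) : Tendsto a atTop (𝓝 0) := by
  refine tendsto_of_tendsto_of_tendsto_of_le_of_le tendsto_const_nhds ?_ (fun _ => zero_le) ha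
  have h0 := ENNReal.tendsto_ofReal tendsto_one_div_add_atTop_nhds_zero_nat
  rw [ENNReal.ofReal_zero] at h0
  have := ENNReal.Tendsto.mul_const (b := c) h0 (Or.inr hc)
  rwa [zero_mul] at this

section Commutator

variable {k : ℕ → E d × E d → ℝ}

theorem IsMollifier.continuous_commutator (hk : IsMollifier volume k) (j : ℕ) :
    Continuous fun s : E d × E d => fderiv ℝ (k j) s (s.2, 0) :=
  ((hk.smooth j).continuous_fderiv (by simp)).clm_apply (by fun_prop)

theorem memLp_commutator (hk : IsMollifier volume k) (hu : MemLp u 2) (j : ℕ) :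
    MemLp ((fun s => fderiv ℝ (k j) s (s.2, 0)) ⋆[lsmul ℝ ℝ, volume] u) 2 := by
  refine memLp_convolution (hk.continuous_commutator j) ?_ hu
  refine ((hk.hasCompactSupport j).fderiv ℝ).mono fun s hs' => ?_
  contrapose! hs'
  simp [Function.notMem_support.1 hs']

theorem tendsto_eLpNorm_commutator (hk : IsMollifier volume k)
    (hkT : ∀ j, ∫⁻ z : E d × E d, ‖fderiv ℝ (k j) z (z.2, 0)‖ₑ
      ≤ ENNReal.ofReal (1 / ((j : ℝ) + 1))) (hu : MemLp u 2) :
    Tendsto (fun j => eLpNorm ((fun s => fderiv ℝ (k j) s (s.2, 0)) ⋆[lsmul ℝ ℝ, volume] u) 2)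
      atTop (𝓝 0) := by
  refine tendsto_zero_of_le_ofReal_mul hu.2.ne fun j => ?_
  refine (eLpNorm_convolution_le (hk.continuous_commutator j).aestronglyMeasurable hu.1).trans ?_
  gcongr
  exact hkT j

end Commutator

/-- The renormalized equation satisfied by a solution of a kinetic system. -/
theorem IsKineticSystem.renormalized (hs : IsKineticSystem O u h G H)
    (hβ : IsRenormalizer β b b' C) {ζ : E d × E d → ℝ} (hζ : ContDiff ℝ 1 ζ)
    (hζc : HasCompactSupport ζ) (hζO : tsupport ζ ⊆ O) :
    ∑ i, ((∫ z, (H i z * G i z) * (b' (u z) * ζ z))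
        + ∫ z, (H i z * fderiv ℝ ζ z (velDir i)) * b (u z))
      - (∫ z, β (u z) * fderiv ℝ ζ z (z.2, 0)) + (∫ z, (h z * ζ z) * b (u z)) = 0 := by
  obtain ⟨k, hk, hkT⟩ := exists_mollifier (E d)
  have hR : ∀ {w : E d × E d → ℝ}, MemLp w 2 →
      ∀ j, MemLp (k j ⋆[lsmul ℝ ℝ, volume] w) 2 := fun hw j =>
    memLp_convolution (hk.smooth j).continuous (hk.hasCompactSupport j) hw
  -- The nonlinear factors `b(U)` and `b'(U)` need convergence almost everywhere, which `L²`
  -- convergence yields along a subsequence only.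
  obtain ⟨ns, hns, hae⟩ : ∃ ns : ℕ → ℕ, StrictMono ns ∧ ∀ᵐ z : E d × E d,
      Tendsto (fun j => (k (ns j) ⋆[lsmul ℝ ℝ, volume] u) z) atTop (𝓝 (u z)) :=
    (tendstoInMeasure_of_tendsto_eLpNorm (by norm_num) (fun j => (hR hs.memLp_u j).1)
      hs.memLp_u.1 (hk.tendsto_eLpNorm hs.memLp_u)).exists_seq_tendsto_ae
  have hL : ∀ {w : E d × E d → ℝ}, MemLp w 2 →
      Tendsto (fun j => eLpNorm (k (ns j) ⋆[lsmul ℝ ℝ, volume] w - w) 2) atTop (𝓝 0) := fun hw =>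
    (hk.tendsto_eLpNorm hw).comp hns.tendsto_atTop
  -- Once the kernel radius is below `δ`, the balls around points of `tsupport ζ` stay in `O`, so
  -- the mollified identity applies.
  obtain ⟨δ, hδ, hδO⟩ := hζc.isCompact.exists_cthickening_subset_open hs.isOpen hζO
  obtain ⟨M, hM⟩ := hζc.exists_bound_of_continuous hζ.continuous
  have hζ2 : MemLp ζ 2 := hζ.continuous.memLp_of_hasCompactSupport hζc
  have hdζ : ∀ {a : E d × E d → E d × E d}, Continuous a → MemLp (fun z => fderiv ℝ ζ z (a z)) 2 := by
    intro a ha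
    refine ((hζ.continuous_fderiv one_ne_zero).clm_apply ha).memLp_of_hasCompactSupport ?_
    refine (hζc.fderiv ℝ).mono fun s hs' => ?_
    contrapose! hs'
    simp [Function.notMem_support.1 hs']
  have hconst : ∀ w : E d × E d → ℝ, Tendsto (fun _ : ℕ => eLpNorm (w - w) 2) atTop (𝓝 0) := by
    intro w; simp
  have hbU : ∀ j, AEStronglyMeasurable (fun z => b ((k (ns j) ⋆[lsmul ℝ ℝ, volume] u) z)) :=
    fun j => hβ.continuous_b.comp_aestronglyMeasurable (hR hs.memLp_u _).1
  have hbt : ∀ᵐ z : E d × E d, Tendsto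
      (fun j => b ((k (ns j) ⋆[lsmul ℝ ℝ, volume] u) z)) atTop (𝓝 (b (u z))) := by
    filter_upwards [hae] with z hz using (hβ.continuous_b.tendsto _).comp hz
  -- Both factors converge in `L²`, so their product converges in `L¹`; the remaining factor is
  -- bounded by `C * M`.
  have t1 : ∀ i, Tendsto (fun j => ∫ z, ((k (ns j) ⋆[lsmul ℝ ℝ, volume] H i) z
        * (k (ns j) ⋆[lsmul ℝ ℝ, volume] G i) z)
        * (b' ((k (ns j) ⋆[lsmul ℝ ℝ, volume] u) z) * ζ z)) atTop
      (𝓝 (∫ z, (H i z * G i z) * (b' (u z) * ζ z))) := by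
    intro i
    refine tendsto_integral_mul_mul (C := C * M) (fun j => hR (hs.memLp_H i) _) (hs.memLp_H i)
      (fun j => hR (hs.memLp_G i) _) (hs.memLp_G i) (hL (hs.memLp_H i)) (hL (hs.memLp_G i))
      (fun j => (hβ.cont.comp_aestronglyMeasurable (hR hs.memLp_u _).1).mul hζ2.1)
      (fun j z => ?_) ?_
    · rw [abs_mul]
      exact mul_le_mul (hβ.bound₂ _) (hM z) (abs_nonneg _)
        ((abs_nonneg _).trans (hβ.bound₂ 0))
    · filter_upwards [hae] with z hz
      exact ((hβ.cont.tendsto _).comp hz).mul_const _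
  have t2 : ∀ i, Tendsto (fun j => ∫ z, ((k (ns j) ⋆[lsmul ℝ ℝ, volume] H i) z
        * fderiv ℝ ζ z (velDir i)) * b ((k (ns j) ⋆[lsmul ℝ ℝ, volume] u) z)) atTop
      (𝓝 (∫ z, (H i z * fderiv ℝ ζ z (velDir i)) * b (u z))) := fun i =>
    tendsto_integral_mul_mul (fun j => hR (hs.memLp_H i) _) (hs.memLp_H i)
      (fun j => hdζ continuous_const) (hdζ continuous_const) (hL (hs.memLp_H i)) (hconst _)
      hbU (fun j z => hβ.bound₁ _) hbt
  have t3 : Tendsto (fun j => ∫ z, β ((k (ns j) ⋆[lsmul ℝ ℝ, volume] u) z)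
        * fderiv ℝ ζ z (z.2, 0)) atTop (𝓝 (∫ z, β (u z) * fderiv ℝ ζ z (z.2, 0))) := by
    have hd := hdζ (a := fun z => (z.2, 0)) (by fun_prop)
    have := tendsto_integral_mul_mul (C := 1) (r := fun _ _ => 1) (r₀ := fun _ => 1)
      (fun j => hβ.memLp (hR hs.memLp_u (ns j))) (hβ.memLp hs.memLp_u) (fun j => hd) hd
      (hβ.tendsto_eLpNorm (hL hs.memLp_u)) (hconst _) (fun j => aestronglyMeasurable_const)
      (by simp) (.of_forall fun z => tendsto_const_nhds)
    simpa only [mul_one] using this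
  have t5 : Tendsto (fun j => ∫ z, ((k (ns j) ⋆[lsmul ℝ ℝ, volume] h) z * ζ z)
        * b ((k (ns j) ⋆[lsmul ℝ ℝ, volume] u) z)) atTop (𝓝 (∫ z, (h z * ζ z) * b (u z))) :=
    tendsto_integral_mul_mul (fun j => hR hs.memLp_h _) hs.memLp_h (fun j => hζ2) hζ2
      (hL hs.memLp_h) (hconst _) hbU (fun j z => hβ.bound₁ _) hbt
  have t4 : Tendsto (fun j => ∫ z,
        (((fun s => fderiv ℝ (k (ns j)) s (s.2, 0)) ⋆[lsmul ℝ ℝ, volume] u) z * ζ z)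
        * b ((k (ns j) ⋆[lsmul ℝ ℝ, volume] u) z)) atTop (𝓝 0) := by
    have hmR := memLp_commutator hk hs.memLp_u
    have hlim := (tendsto_eLpNorm_commutator hk hkT hs.memLp_u).comp hns.tendsto_atTop
    have := tendsto_integral_mul_mul (p₀ := 0) (C := C)
      (p := fun j => (fun s => fderiv ℝ (k (ns j)) s (s.2, 0)) ⋆[lsmul ℝ ℝ, volume] u)
      (fun j => hmR (ns j)) MemLp.zero (fun j => hζ2) hζ2
      (by simp only [sub_zero]; exact hlim) (hconst _) hbU (fun j z => hβ.bound₁ _) hbt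
    simpa only [Pi.zero_apply, zero_mul, integral_zero] using this
  have hsum := ((((tendsto_finsetSum Finset.univ fun i _ => (t1 i).add (t2 i)).sub t3).sub
    t4).add t5)
  have hev : ∀ᶠ j in atTop, 1 / (((ns j : ℕ) : ℝ) + 1) < δ :=
    (tendsto_order.1 (tendsto_one_div_add_atTop_nhds_zero_nat.comp hns.tendsto_atTop)).2 δ hδ
  have hzero := hsum.congr' (f₂ := fun _ => (0 : ℝ)) (by
    filter_upwards [hev] with j hj
    refine hs.renormalized_convolution hβ (hk.smooth _) (hk.support _) (hk.hasCompactSupport _)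
      hζ hζc fun z hz => ?_
    refine (Metric.closedBall_subset_closedBall hj.le).trans ?_
    exact (Metric.closedBall_subset_cthickening hz δ).trans hδO)
  have := tendsto_nhds_unique hzero tendsto_const_nhds
  simpa only [sub_zero] using this

end Renormalization

end FokkerPlanck

namespace FokkerPlanck

/-! ### Nonlinearities that detect a level -/

section Transition

theorem exists_deriv_smoothTransition_bound :
    ∃ C : ℝ, 1 ≤ C ∧ ∀ s, |deriv Real.smoothTransition s| ≤ C := by
  have hc : Continuous (deriv Real.smoothTransition) :=
    (Real.smoothTransition.contDiff (n := 1)).continuous_deriv le_rfl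
  obtain ⟨C, hC⟩ := (isCompact_Icc (a := (0 : ℝ)) (b := 1)).exists_bound_of_continuousOn
    hc.continuousOn
  refine ⟨max 1 C, le_max_left _ _, fun s => ?_⟩
  by_cases hs : s ∈ Icc (0 : ℝ) 1
  · exact (hC s hs).trans (le_max_right _ _)
  · have : deriv Real.smoothTransition s = 0 := by
      rw [mem_Icc, not_and_or, not_le, not_le] at hs
      rcases hs with hs | hs
      · have : Real.smoothTransition =ᶠ[𝓝 s] fun _ => 0 := by
          filter_upwards [Iio_mem_nhds hs] with t ht
          exact Real.smoothTransition.zero_of_nonpos (le_of_lt ht)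
        rw [this.deriv_eq, deriv_const]
      · have : Real.smoothTransition =ᶠ[𝓝 s] fun _ => 1 := by
          filter_upwards [Ioi_mem_nhds hs] with t ht
          exact Real.smoothTransition.one_of_one_le (le_of_lt ht)
        rw [this.deriv_eq, deriv_const]
    rw [this, abs_zero]
    exact zero_le_one.trans (le_max_left _ _)

theorem deriv_smoothTransition_nonneg (s : ℝ) : 0 ≤ deriv Real.smoothTransition s :=
  Real.smoothTransition.monotone.deriv_nonneg

theorem deriv_smoothTransition_eq_zero {s : ℝ} (hs : s < 0 ∨ 1 < s) :
    deriv Real.smoothTransition s = 0 := by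
  rcases hs with hs | hs
  · have : Real.smoothTransition =ᶠ[𝓝 s] fun _ => 0 := by
      filter_upwards [Iio_mem_nhds hs] with t ht
      exact Real.smoothTransition.zero_of_nonpos (le_of_lt ht)
    rw [this.deriv_eq, deriv_const]
  · have : Real.smoothTransition =ᶠ[𝓝 s] fun _ => 1 := by
      filter_upwards [Ioi_mem_nhds hs] with t ht
      exact Real.smoothTransition.one_of_one_le (le_of_lt ht)
    rw [this.deriv_eq, deriv_const]

theorem hasDerivAt_smoothTransition (s : ℝ) :
    HasDerivAt Real.smoothTransition (deriv Real.smoothTransition s) s :=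
  ((Real.smoothTransition.contDiff (n := 1)).differentiable one_ne_zero s).hasDerivAt

/-- A renormalizer that detects exactly the values above the level `M`. -/
structure IsLevelRenormalizer (M : ℝ) (β b b' : ℝ → ℝ) (C : ℝ) : Prop
    extends IsRenormalizer β b b' C where
  b_nonneg : ∀ s, 0 ≤ b s
  b'_nonneg : ∀ s, 0 ≤ b' s
  b_eq_zero : ∀ s ≤ M, b s = 0
  b_pos : ∀ s, M < s → 0 < b s
  β_nonneg : ∀ s, 0 ≤ β s
  b_le : ∀ s, |b s| ≤ C * |s|
  β_le : ∀ s, β s ≤ C * |s|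
  β_le_sq : ∀ s, β s ≤ C * s ^ 2

/-- Take `b(s) = η(s - M)` with `η` the smooth transition, and `β` its primitive from 0. Since `M ≥
0`, `b` vanishes at 0 and on the negative axis, so `b` grows at most linearly and `β` is at most
linear and at most quadratic. The bound on `b` puts `b(u)` in `L²`, the quadratic bound on `β`
handles the spatial cutoff, and the linear one the incoming layer. -/
theorem exists_isLevelRenormalizer {M : ℝ} (hM : 0 ≤ M) :
    ∃ (β b b' : ℝ → ℝ) (C : ℝ), IsLevelRenormalizer M β b b' C := by
  obtain ⟨C, hC1, hC⟩ := exists_deriv_smoothTransition_bound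
  let b : ℝ → ℝ := fun s => Real.smoothTransition (s - M)
  have hbc : Continuous b := Real.smoothTransition.continuous.comp (by fun_prop)
  have hb' : ∀ s, HasDerivAt b (deriv Real.smoothTransition (s - M)) s := fun s =>
    (hasDerivAt_smoothTransition (s - M)).comp_sub_const s M
  have hβ' : ∀ s, HasDerivAt (fun s => ∫ t in (0 : ℝ)..s, b t) (b s) s := fun s =>
    intervalIntegral.integral_hasDerivAt_right (hbc.intervalIntegrable _ _)
      (hbc.stronglyMeasurableAtFilter _ _) hbc.continuousAt
  have hb0 : ∀ s ≤ M, b s = 0 := fun s hs =>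
    Real.smoothTransition.zero_of_nonpos (by linarith)
  have hbn : ∀ s, 0 ≤ b s := fun s => Real.smoothTransition.nonneg _
  have hren : IsRenormalizer (fun s => ∫ t in (0 : ℝ)..s, b t) b
      (fun s => deriv Real.smoothTransition (s - M)) C := by
    refine ⟨hβ', hb', ?_, by simp, fun s => ?_, fun s => hC _⟩
    · exact ((Real.smoothTransition.contDiff (n := 1)).continuous_deriv le_rfl).comp (by fun_prop)
    · rw [abs_of_nonneg (hbn s)]
      exact (Real.smoothTransition.le_one _).trans hC1
  have hble : ∀ s, |b s| ≤ C * |s| := by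
    intro s
    have h := Convex.norm_image_sub_le_of_norm_hasDerivWithin_le (f := b) (s := univ)
      (C := C) (fun x _ => (hb' x).hasDerivWithinAt) (fun x _ => hC _) convex_univ
      (mem_univ 0) (mem_univ s)
    simpa [hb0 0 hM] using h
  refine ⟨_, b, _, C, hren, hbn, fun s => deriv_smoothTransition_nonneg _, hb0, fun s hs =>
    Real.smoothTransition.pos_of_pos (by linarith), fun s => ?_, hble, fun s => ?_, fun s => ?_⟩
  · rcases le_total 0 s with hs | hs
    · exact intervalIntegral.integral_nonneg hs fun t _ => hbn t
    · rw [intervalIntegral.integral_congr (g := fun _ => (0 : ℝ))]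
      · simp
      · intro t ht
        rw [uIcc_of_ge hs] at ht
        exact hb0 t (ht.2.trans hM)
  · have := (le_abs_self _).trans (hren.abs_sub_le s 0)
    simpa using this
  · have h := intervalIntegral.norm_integral_le_of_norm_le_const (a := 0) (b := s) (f := b)
      (C := C * |s|) (fun t ht => (hble t).trans ?_)
    · refine (le_abs_self _).trans (h.trans (le_of_eq ?_))
      rw [sub_zero, mul_assoc, abs_mul_abs_self, sq]
    · refine mul_le_mul_of_nonneg_left ?_ (zero_le_one.trans hC1)
      rcases le_total 0 s with hs | hs
      · rw [uIoc_of_le hs] at ht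
        rw [abs_of_nonneg ht.1.le, abs_of_nonneg hs]
        exact ht.2
      · rw [uIoc_of_ge hs] at ht
        rw [abs_of_nonpos ht.2, abs_of_nonpos hs]
        linarith [ht.1]

end Transition

/-! ### Volumes of the boundary layers -/

section Slabs

variable {d : ℕ}

/-- The part of the slab `a ≤ xⁿ ≤ b` in the ball of radius `L`. -/
def slab (d : ℕ) (L a b : ℝ) : Set (E d) :=
  {x | ‖x‖ ≤ L ∧ a ≤ x (Fin.last d) ∧ x (Fin.last d) ≤ b}

theorem isClosed_slab (L a b : ℝ) : IsClosed (slab d L a b) := by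
  have h : Continuous fun x : E d => x (Fin.last d) := by fun_prop
  have e : slab d L a b = {x | ‖x‖ ≤ L} ∩ ({x | a ≤ x (Fin.last d)} ∩ {x | x (Fin.last d) ≤ b}) :=
    rfl
  rw [e]
  exact (isClosed_le continuous_norm continuous_const).inter
    ((isClosed_le continuous_const h).inter (isClosed_le h continuous_const))

theorem volume_slab_le {L a b : ℝ} (hL : 0 ≤ L) :
    volume (slab d L a b) ≤ ENNReal.ofReal ((2 * L) ^ d * (b - a)) := by
  let lo : Fin (d + 1) → ℝ := Fin.snoc (α := fun _ => ℝ) (fun _ => -L) a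
  let hi : Fin (d + 1) → ℝ := Fin.snoc (α := fun _ => ℝ) (fun _ => L) b
  have hsub : slab d L a b ⊆ (WithLp.ofLp : E d → Fin (d + 1) → ℝ) ⁻¹' Icc lo hi := by
    intro x hx
    have hxi : ∀ i, |x i| ≤ L := fun i => (PiLp.norm_apply_le x i).trans hx.1
    refine ⟨fun i => ?_, fun i => ?_⟩ <;>
    · refine Fin.lastCases ?_ (fun j => ?_) i
      · simp only [lo, hi, Fin.snoc_last]
        first | exact hx.2.1 | exact hx.2.2
      · simp only [lo, hi, Fin.snoc_castSucc]
        first | exact (abs_le.1 (hxi _)).1 | exact (abs_le.1 (hxi _)).2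
  refine (measure_mono hsub).trans (le_of_eq ?_)
  rw [(PiLp.volume_preserving_ofLp (Fin (d + 1))).measure_preimage
    measurableSet_Icc.nullMeasurableSet, Real.volume_Icc_pi, Fin.prod_univ_castSucc]
  simp only [lo, hi, Fin.snoc_last, Fin.snoc_castSucc, Finset.prod_const, Finset.card_univ,
    Fintype.card_fin]
  rw [ENNReal.ofReal_mul (by positivity), ENNReal.ofReal_pow (by positivity)]
  congr 3; ring

/-- The argument `xⁿ / s¹⁰ + vⁿ / s⁴` of the cutoff near the grazing set. -/
noncomputable def grazingForm (d : ℕ) (s : ℝ) (z : E d × E d) : ℝ :=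
  z.1 (Fin.last d) / s ^ 10 + z.2 (Fin.last d) / s ^ 4

theorem continuous_grazingForm (s : ℝ) : Continuous (grazingForm d s) := by
  unfold grazingForm; fun_prop

/-- The region where the cutoff near the grazing set varies. -/
def grazingLayer (d : ℕ) (R s : ℝ) : Set (E d × E d) :=
  {z | ‖z.1‖ ≤ 2 * R ∧ ‖z.2‖ ≤ 2 ∧ 1 ≤ grazingForm d s z ∧ grazingForm d s z ≤ 2}

theorem isClosed_grazingLayer (R s : ℝ) : IsClosed (grazingLayer d R s) := by
  have h := continuous_grazingForm (d := d) s
  have e : grazingLayer d R s = {z | ‖z.1‖ ≤ 2 * R} ∩ ({z | ‖z.2‖ ≤ 2} ∩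
    ({z | 1 ≤ grazingForm d s z} ∩ {z | grazingForm d s z ≤ 2})) := rfl
  rw [e]
  exact (isClosed_le continuous_fst.norm continuous_const).inter
    ((isClosed_le continuous_snd.norm continuous_const).inter
      ((isClosed_le continuous_const h).inter (isClosed_le h continuous_const)))

/-- For each fixed `v` the condition `1 ≤ xₙ/s¹⁰ + vₙ/s⁴ ≤ 2` confines `xₙ` to an interval of length
`s¹⁰`; the other variables are bounded. -/
theorem volume_grazingLayer_le {R s : ℝ} (hR : 0 ≤ R) (hs : 0 < s) :
    volume (grazingLayer d R s)
      ≤ ENNReal.ofReal ((4 * R) ^ d * (4 ^ d * 4) * s ^ 10) := by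
  rw [Measure.volume_eq_prod, Measure.prod_apply_symm (isClosed_grazingLayer R s).measurableSet]
  have hb : ∀ v : E d, volume ((fun x => (x, v)) ⁻¹' grazingLayer d R s)
      ≤ (slab d 2 (-2) 2).indicator (fun _ => ENNReal.ofReal ((4 * R) ^ d * s ^ 10)) v := by
    intro v
    by_cases hv : v ∈ slab d 2 (-2) 2
    · rw [indicator_of_mem hv]
      set a := s ^ 10 * (1 - v (Fin.last d) / s ^ 4)
      have hsub : (fun x => (x, v)) ⁻¹' grazingLayer d R s ⊆ slab d (2 * R) a (a + s ^ 10) := by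
        intro x hx
        obtain ⟨h1, -, h3, h4⟩ := hx
        have e : x (Fin.last d) = s ^ 10 * (grazingForm d s (x, v) - v (Fin.last d) / s ^ 4) := by
          unfold grazingForm
          field_simp
          ring
        have hs10 : 0 < s ^ 10 := by positivity
        refine ⟨h1, ?_, ?_⟩
        · rw [e]
          exact mul_le_mul_of_nonneg_left (by linarith) hs10.le
        · rw [e, show a + s ^ 10 = s ^ 10 * (2 - v (Fin.last d) / s ^ 4) by simp only [a]; ring]
          exact mul_le_mul_of_nonneg_left (by linarith) hs10.le
      refine (measure_mono hsub).trans ((volume_slab_le (by linarith)).trans (le_of_eq ?_))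
      congr 1; ring
    · rw [indicator_of_notMem hv, nonpos_iff_eq_zero]
      convert measure_empty (μ := (volume : Measure (E d)))
      refine eq_empty_of_forall_notMem fun x hx => hv ?_
      have h2 : ‖v‖ ≤ 2 := hx.2.1
      have := abs_le.1 ((PiLp.norm_apply_le v (Fin.last d)).trans h2)
      exact ⟨h2, this.1, this.2⟩
  refine (lintegral_mono hb).trans ?_
  rw [lintegral_indicator_const (isClosed_slab _ _ _).measurableSet]
  refine (mul_le_mul_right (volume_slab_le (by norm_num)) _).trans (le_of_eq ?_)
  rw [← ENNReal.ofReal_mul (by positivity)]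
  congr 1; ring

/-- The region near the incoming part of the boundary where the cutoff increases along
trajectories. -/
def incomingLayer (d : ℕ) (R s : ℝ) : Set (E d × E d) :=
  slab d (2 * R) 0 (2 * s ^ 10) ×ˢ slab d 2 0 (2 * s ^ 4)

theorem isClosed_incomingLayer (R s : ℝ) : IsClosed (incomingLayer d R s) :=
  (isClosed_slab _ _ _).prod (isClosed_slab _ _ _)

/-- Smallness in `xₙ` and in `vₙ` multiply: `s¹⁰ · s⁴ = s¹⁴`, one power better than the factor
`s⁻¹³` in `transport_fullCut_le`. -/
theorem volume_incomingLayer_le {R s : ℝ} (hR : 0 ≤ R) (hs : 0 < s) :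
    volume (incomingLayer d R s)
      ≤ ENNReal.ofReal ((4 * R) ^ d * (4 ^ d * 4) * s ^ 14) := by
  rw [incomingLayer, Measure.volume_eq_prod, Measure.prod_prod]
  refine (mul_le_mul' (volume_slab_le (by linarith)) (volume_slab_le (by norm_num))).trans
    (le_of_eq ?_)
  rw [← ENNReal.ofReal_mul (by simp; positivity)]
  congr 1; ring

end Slabs

end FokkerPlanck

/-! ### The incoming region and the cutoffs -/

namespace FokkerPlanck

variable {d : ℕ}

/-- The set of velocities in a spherical shell around the unit sphere. -/
def shell (d : ℕ) : Set (E d) := {v | 1 / 4 < ‖v‖ ^ 2 ∧ ‖v‖ ^ 2 < 4}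

/-- The interior of the half space together with the incoming part of its boundary and the
exterior half space of incoming velocities, for velocities in the shell. -/
def incomingRegion (d : ℕ) : Set (E d × E d) :=
  {z | (0 < z.1 (Fin.last d) ∨ 0 < z.2 (Fin.last d)) ∧ z.2 ∈ shell d}

theorem isOpen_shell : IsOpen (shell d) := by
  have h : Continuous fun v : E d => ‖v‖ ^ 2 := by fun_prop
  exact (isOpen_lt continuous_const h).inter (isOpen_lt h continuous_const)

theorem isOpen_incomingRegion : IsOpen (incomingRegion d) := by
  have h1 : Continuous fun z : E d × E d => z.1 (Fin.last d) := by fun_prop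
  have h2 : Continuous fun z : E d × E d => z.2 (Fin.last d) := by fun_prop
  exact ((isOpen_lt continuous_const h1).union (isOpen_lt continuous_const h2)).inter
    (isOpen_shell.preimage continuous_snd)

section Cutoffs

/-- A smooth radial cutoff in velocity. -/
noncomputable def velCut (v : E d) : ℝ :=
  (⟨1 / 4, 1 / 2, by norm_num, by norm_num⟩ : ContDiffBump (1 : ℝ)) (‖v‖ ^ 2)

/-- A smooth cutoff in position. -/
noncomputable def posCut (R : ℝ) (x : E d) : ℝ :=
  (⟨1, 2, by norm_num, by norm_num⟩ : ContDiffBump (0 : E d)) (R⁻¹ • x)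

/-- A smooth cutoff near the grazing and outgoing parts of the boundary. -/
noncomputable def grazingCut (s : ℝ) (z : E d × E d) : ℝ :=
  Real.smoothTransition (grazingForm d s z - 1)

/-- The product of the three cutoffs. -/
noncomputable def fullCut (R s : ℝ) (z : E d × E d) : ℝ :=
  velCut z.2 * posCut R z.1 * grazingCut s z

theorem contDiff_velCut : ContDiff ℝ ∞ (velCut : E d → ℝ) :=
  (ContDiffBump.contDiff _).comp (contDiff_norm_sq ℝ)

theorem contDiff_posCut (R : ℝ) : ContDiff ℝ ∞ (posCut R : E d → ℝ) :=
  (ContDiffBump.contDiff _).comp (contDiff_const_smul _)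

theorem contDiff_grazingCut (s : ℝ) : ContDiff ℝ ∞ (grazingCut s : E d × E d → ℝ) := by
  refine (Real.smoothTransition.contDiff (n := ⊤)).comp ?_
  unfold grazingForm
  fun_prop

theorem velCut_nonneg (v : E d) : 0 ≤ velCut v := ContDiffBump.nonneg _
theorem velCut_le_one (v : E d) : velCut v ≤ 1 := ContDiffBump.le_one _
theorem posCut_nonneg (R : ℝ) (x : E d) : 0 ≤ posCut R x := ContDiffBump.nonneg _
theorem posCut_le_one (R : ℝ) (x : E d) : posCut R x ≤ 1 := ContDiffBump.le_one _
theorem grazingCut_nonneg (s : ℝ) (z : E d × E d) : 0 ≤ grazingCut s z :=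
  Real.smoothTransition.nonneg _
theorem grazingCut_le_one (s : ℝ) (z : E d × E d) : grazingCut s z ≤ 1 :=
  Real.smoothTransition.le_one _

theorem velCut_eq_zero {v : E d} (hv : ¬ (1 / 2 ≤ ‖v‖ ^ 2 ∧ ‖v‖ ^ 2 ≤ 3 / 2)) : velCut v = 0 := by
  apply ContDiffBump.zero_of_le_dist
  by_contra h
  rw [not_le, Real.dist_eq, abs_lt] at h
  exact hv ⟨by linarith [h.1], by linarith [h.2]⟩

theorem norm_le_two_of_velCut_ne_zero {v : E d} (hv : velCut v ≠ 0) : ‖v‖ ≤ 2 := by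
  have := (not_not.1 (mt velCut_eq_zero hv)).2
  nlinarith [norm_nonneg v]

theorem posCut_eq_zero {R : ℝ} (hR : 0 < R) {x : E d} (hx : 2 * R ≤ ‖x‖) : posCut R x = 0 := by
  apply ContDiffBump.zero_of_le_dist
  rw [dist_zero_right, norm_smul, norm_inv, Real.norm_of_nonneg hR.le, inv_mul_eq_div,
    le_div_iff₀ hR]
  exact hx

theorem posCut_eq_one {R : ℝ} (hR : 0 < R) {x : E d} (hx : ‖x‖ ≤ R) : posCut R x = 1 := by
  apply ContDiffBump.one_of_mem_closedBall
  rw [mem_closedBall_zero_iff, norm_smul, norm_inv, Real.norm_of_nonneg hR.le, inv_mul_eq_div,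
    div_le_one hR]
  exact hx

variable (d) in
theorem exists_fderiv_posCut_bound :
    ∃ C : ℝ, 0 ≤ C ∧ ∀ R : ℝ, 0 < R → ∀ x y : E d, |fderiv ℝ (posCut R) x y| ≤ C / R * ‖y‖ := by
  let χ : ContDiffBump (0 : E d) := ⟨1, 2, by norm_num, by norm_num⟩
  have hχ : ContDiff ℝ 1 χ := χ.contDiff
  obtain ⟨C, hC⟩ := (χ.hasCompactSupport.fderiv ℝ).exists_bound_of_continuous
    (hχ.continuous_fderiv one_ne_zero)
  refine ⟨C, (norm_nonneg _).trans (hC 0), fun R hR x y => ?_⟩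
  have h : HasFDerivAt (fun x : E d => χ (R⁻¹ • x))
      ((fderiv ℝ χ (R⁻¹ • x)).comp (R⁻¹ • ContinuousLinearMap.id ℝ (E d))) x :=
    (hχ.differentiable one_ne_zero _).hasFDerivAt.comp x
      ((hasFDerivAt_id x).const_smul R⁻¹)
  have e : fderiv ℝ (posCut R) x y = R⁻¹ * fderiv ℝ χ (R⁻¹ • x) y := by
    rw [show (posCut R : E d → ℝ) = fun x => χ (R⁻¹ • x) from rfl, h.fderiv]
    simp
  rw [e, abs_mul, abs_of_pos (inv_pos.2 hR), div_eq_mul_inv, mul_comm C, mul_assoc]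
  refine mul_le_mul_of_nonneg_left ?_ (inv_pos.2 hR).le
  exact (ContinuousLinearMap.le_opNorm _ _).trans
    (mul_le_mul_of_nonneg_right (hC _) (norm_nonneg _))

/-- The cutoff is radial, so its derivative is invisible to a flux `H` with `H·v = 0`. -/
theorem exists_fderiv_velCut (v : E d) :
    ∃ c : ℝ, ∀ y : E d, fderiv ℝ velCut v y = c * ⟪v, y⟫ := by
  let α : ContDiffBump (1 : ℝ) := ⟨1 / 4, 1 / 2, by norm_num, by norm_num⟩
  have hα : ContDiff ℝ 1 α := α.contDiff
  refine ⟨deriv α (‖v‖ ^ 2) * 2, fun y => ?_⟩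
  have h : HasFDerivAt (fun v : E d => α (‖v‖ ^ 2)) (deriv α (‖v‖ ^ 2) • (2 • innerSL ℝ v)) v :=
    (hα.differentiable one_ne_zero _).hasDerivAt.comp_hasFDerivAt v
      (hasStrictFDerivAt_norm_sq v).hasFDerivAt
  rw [show (velCut : E d → ℝ) = fun v => α (‖v‖ ^ 2) from rfl, h.fderiv]
  simp
  ring

theorem fderiv_grazingCut (s : ℝ) (z a : E d × E d) :
    fderiv ℝ (grazingCut s) z a
      = deriv Real.smoothTransition (grazingForm d s z - 1) * grazingForm d s a := by
  let p : E d →L[ℝ] ℝ := EuclideanSpace.proj (Fin.last d)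
  let ℓ : E d × E d →L[ℝ] ℝ := (s ^ 10)⁻¹ • p.comp (ContinuousLinearMap.fst ℝ (E d) (E d))
    + (s ^ 4)⁻¹ • p.comp (ContinuousLinearMap.snd ℝ (E d) (E d))
  have hℓ : ∀ z, grazingForm d s z = ℓ z := by
    intro z
    simp [grazingForm, ℓ, p, div_eq_inv_mul]
  have h : HasFDerivAt (fun z => Real.smoothTransition (ℓ z - 1))
      (deriv Real.smoothTransition (ℓ z - 1) • ℓ) z :=
    (hasDerivAt_smoothTransition _).comp_hasFDerivAt z (ℓ.hasFDerivAt.sub_const 1)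
  have e : grazingCut s = fun z => Real.smoothTransition (ℓ z - 1) := by
    funext z; rw [grazingCut, hℓ]
  rw [e, h.fderiv, hℓ, hℓ]
  simp

theorem contDiff_fullCut (R s : ℝ) : ContDiff ℝ ∞ (fullCut R s : E d × E d → ℝ) :=
  ((contDiff_velCut.comp contDiff_snd).mul ((contDiff_posCut R).comp contDiff_fst)).mul
    (contDiff_grazingCut s)

theorem fderiv_fullCut (R s : ℝ) (z a : E d × E d) :
    fderiv ℝ (fullCut R s) z a
      = fderiv ℝ velCut z.2 a.2 * (posCut R z.1 * grazingCut s z)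
        + fderiv ℝ (posCut R) z.1 a.1 * (velCut z.2 * grazingCut s z)
        + velCut z.2 * posCut R z.1 *
          (deriv Real.smoothTransition (grazingForm d s z - 1) * grazingForm d s a) := by
  have e1 : HasFDerivAt (fun z : E d × E d => velCut z.2) _ z :=
    (contDiff_velCut.differentiable (by simp) z.2).hasFDerivAt.comp z hasFDerivAt_snd
  have e2 : HasFDerivAt (fun z : E d × E d => posCut R z.1) _ z :=
    ((contDiff_posCut R).differentiable (by simp) z.1).hasFDerivAt.comp z hasFDerivAt_fst
  have e3 : HasFDerivAt (grazingCut s) _ z :=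
    ((contDiff_grazingCut s).differentiable (by simp) z).hasFDerivAt
  rw [HasFDerivAt.fderiv (f := fullCut R s) ((e1.mul e2).mul e3), ← fderiv_grazingCut]
  simp
  ring

theorem fullCut_eq_zero {R s : ℝ} (hR : 0 < R) {z : E d × E d}
    (hz : ¬ ((1 / 2 ≤ ‖z.2‖ ^ 2 ∧ ‖z.2‖ ^ 2 ≤ 3 / 2) ∧ ‖z.1‖ ≤ 2 * R ∧ 1 ≤ grazingForm d s z)) :
    fullCut R s z = 0 := by
  unfold fullCut
  by_cases h1 : 1 / 2 ≤ ‖z.2‖ ^ 2 ∧ ‖z.2‖ ^ 2 ≤ 3 / 2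
  · by_cases h2 : ‖z.1‖ ≤ 2 * R
    · have h3 : grazingForm d s z < 1 := by
        by_contra h
        exact hz ⟨h1, h2, not_lt.1 h⟩
      rw [grazingCut, Real.smoothTransition.zero_of_nonpos (by linarith), mul_zero]
    · rw [posCut_eq_zero hR (not_le.1 h2).le, mul_zero, zero_mul]
  · rw [velCut_eq_zero h1, zero_mul, zero_mul]

theorem tsupport_fullCut_subset {R s : ℝ} (hR : 0 < R) :
    tsupport (fullCut R s : E d × E d → ℝ) ⊆ {z | (1 / 2 ≤ ‖z.2‖ ^ 2 ∧ ‖z.2‖ ^ 2 ≤ 3 / 2) ∧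
      ‖z.1‖ ≤ 2 * R ∧ 1 ≤ grazingForm d s z} := by
  refine closure_minimal (fun z hz => ?_) ?_
  · by_contra h
    exact hz (fullCut_eq_zero hR h)
  · have h2 : Continuous fun z : E d × E d => ‖z.2‖ ^ 2 := by fun_prop
    have h1 : Continuous fun z : E d × E d => ‖z.1‖ := by fun_prop
    exact ((isClosed_le continuous_const h2).inter (isClosed_le h2 continuous_const)).inter
      ((isClosed_le h1 continuous_const).inter
        (isClosed_le continuous_const (continuous_grazingForm s)))

theorem hasCompactSupport_fullCut {R s : ℝ} (hR : 0 < R) :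
    HasCompactSupport (fullCut R s : E d × E d → ℝ) := by
  refine ((isCompact_closedBall (0 : E d) (2 * R)).prod
    (isCompact_closedBall (0 : E d) 2)).of_isClosed_subset (isClosed_tsupport _)
    fun z hz => ?_
  obtain ⟨⟨-, h1⟩, h2, -⟩ := tsupport_fullCut_subset hR hz
  refine ⟨mem_closedBall_zero_iff.2 h2, mem_closedBall_zero_iff.2 ?_⟩
  nlinarith [norm_nonneg z.2]

/-- If `xₙ ≤ 0` and `vₙ ≤ 0`, then the grazing form is nonpositive, whereas on the support it is at
least 1. -/
theorem tsupport_fullCut_subset_incomingRegion {R s : ℝ} (hR : 0 < R) (hs : 0 < s) :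
    tsupport (fullCut R s : E d × E d → ℝ) ⊆ incomingRegion d := by
  intro z hz
  obtain ⟨⟨h1, h2⟩, -, h3⟩ := tsupport_fullCut_subset hR hz
  refine ⟨?_, by linarith, by linarith⟩
  by_contra h
  rw [not_or, not_lt, not_lt] at h
  have e1 : z.1 (Fin.last d) / s ^ 10 ≤ 0 := div_nonpos_of_nonpos_of_nonneg h.1 (by positivity)
  have e2 : z.2 (Fin.last d) / s ^ 4 ≤ 0 := div_nonpos_of_nonpos_of_nonneg h.2 (by positivity)
  unfold grazingForm at h3
  linarith

theorem fullCut_nonneg (R s : ℝ) (z : E d × E d) : 0 ≤ fullCut R s z :=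
  mul_nonneg (mul_nonneg (velCut_nonneg _) (posCut_nonneg _ _)) (grazingCut_nonneg _ _)

/-- At fixed `xₙ > 0` the cutoff is eventually equal to 1, whatever the sign of `vₙ`: the exponent
10 exceeds 4, so `xₙ/s¹⁰` dominates `vₙ/s⁴`. -/
theorem tendsto_grazingCut {z : E d × E d} (hz : 0 < z.1 (Fin.last d)) :
    Tendsto (fun s => grazingCut s z) (𝓝[>] 0) (𝓝 1) := by
  refine tendsto_const_nhds.congr' ?_
  have h : Tendsto (fun s : ℝ => 2 * s ^ 10 - z.2 (Fin.last d) * s ^ 6) (𝓝[>] 0)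
      (𝓝 (2 * 0 ^ 10 - z.2 (Fin.last d) * 0 ^ 6)) := by
    refine Tendsto.mono_left (Continuous.tendsto ?_ 0) nhdsWithin_le_nhds
    fun_prop
  have hev := (tendsto_order.1 h).2 (z.1 (Fin.last d)) (by simpa using hz)
  filter_upwards [hev, self_mem_nhdsWithin] with s hs hs0
  have hs0' : 0 < s := hs0
  symm
  apply Real.smoothTransition.one_of_one_le
  have : grazingForm d s z = (z.1 (Fin.last d) + z.2 (Fin.last d) * s ^ 6) / s ^ 10 := by
    unfold grazingForm
    field_simp
  rw [this, le_sub_iff_add_le, le_div_iff₀ (by positivity)]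
  linarith

end Cutoffs

end FokkerPlanck

/-! ### Pointwise bounds for the cutoff errors -/

namespace FokkerPlanck

variable {d : ℕ}

/-- Young's inequality with weight `s`: the difference of the two sides is `s (|w| - s^(-(m+1)))²`.
-/
theorem two_mul_abs_div_le (w : ℝ) {s : ℝ} (hs : 0 < s) (m : ℕ) :
    2 * |w| / s ^ m ≤ s * w ^ 2 + (s ^ (2 * m + 1))⁻¹ := by
  have h : s * w ^ 2 + (s ^ (2 * m + 1))⁻¹ - 2 * |w| / s ^ m = s * (|w| - (s ^ (m + 1))⁻¹) ^ 2 := by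
    rw [sub_sq, sq_abs]
    field_simp
    ring
  have : 0 ≤ s * (|w| - (s ^ (m + 1))⁻¹) ^ 2 := by positivity
  linarith

section PointwiseBounds

variable {M C : ℝ} {β b b' : ℝ → ℝ}

theorem layer_of_ne_zero {R s : ℝ} (hR : 0 < R) {z : E d × E d}
    (h : velCut z.2 * posCut R z.1 * deriv Real.smoothTransition (grazingForm d s z - 1) ≠ 0) :
    z ∈ grazingLayer d R s := by
  have h1 := left_ne_zero_of_mul (left_ne_zero_of_mul h)
  have h2 := right_ne_zero_of_mul (left_ne_zero_of_mul h)
  have h3 := right_ne_zero_of_mul h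
  have h4 := mt deriv_smoothTransition_eq_zero h3
  rw [not_or, not_lt, not_lt] at h4
  refine ⟨?_, norm_le_two_of_velCut_ne_zero h1, by linarith [h4.1], by linarith [h4.2]⟩
  by_contra h
  exact h2 (posCut_eq_zero hR (not_le.1 h).le)

theorem abs_layer_le {C₁ : ℝ} (hC₁ : ∀ s, |deriv Real.smoothTransition s| ≤ C₁) (R s : ℝ)
    (z : E d × E d) :
    |velCut z.2 * posCut R z.1 * deriv Real.smoothTransition (grazingForm d s z - 1)| ≤ C₁ := by
  rw [abs_mul, abs_of_nonneg (mul_nonneg (velCut_nonneg _) (posCut_nonneg _ _))]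
  calc _ ≤ 1 * C₁ := mul_le_mul (mul_le_one₀ (velCut_le_one _) (posCut_nonneg _ _)
        (posCut_le_one _ _)) (hC₁ _) (abs_nonneg _) zero_le_one
    _ = C₁ := one_mul _

/-- The spatial cutoff contributes the `1/R` term; the velocity cutoff does not depend on `x`. The
grazing cutoff has transport derivative of the sign of `vₙ`, hence is harmful only for `vₙ > 0`.
There, and in the half space, its variation lies in the incoming layer, where the derivative is
`O(s⁴/s¹⁰)`; Young's inequality with `m = 6` gives the power `s⁻¹³`. -/
theorem transport_fullCut_le (hβ : IsLevelRenormalizer M β b b' C) {C₁ Cχ R s : ℝ}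
    (hC₁ : ∀ s, |deriv Real.smoothTransition s| ≤ C₁)
    (hCχ : ∀ x y : E d, |fderiv ℝ (posCut R) x y| ≤ Cχ / R * ‖y‖) (hCχ0 : 0 ≤ Cχ)
    (hR : 0 < R) (hs : 0 < s) {w : ℝ} {z : E d × E d} (hw : ¬ 0 < z.1 (Fin.last d) → w = 0) :
    β w * fderiv ℝ (fullCut R s) z (z.2, 0) ≤ 2 * C * Cχ / R * w ^ 2
      + C * C₁ * (s * w ^ 2
        + (s ^ 13)⁻¹ * (incomingLayer d R s).indicator (fun _ => (1 : ℝ)) z) := by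
  have hC : 0 ≤ C := (abs_nonneg _).trans (hβ.bound₁ 0)
  have hC₁0 : 0 ≤ C₁ := (abs_nonneg _).trans (hC₁ 0)
  have hind : 0 ≤ (incomingLayer d R s).indicator (fun _ => (1 : ℝ)) z :=
    indicator_nonneg (fun _ _ => zero_le_one) _
  have hform : grazingForm d s ((z.2, 0) : E d × E d) = z.2 (Fin.last d) / s ^ 10 := by
    simp [grazingForm]
  rw [fderiv_fullCut, map_zero, zero_mul, zero_add, mul_add, hform]
  refine add_le_add ?_ ?_
  · have h1 : |fderiv ℝ (posCut R) z.1 z.2 * (velCut z.2 * grazingCut s z)| ≤ Cχ / R * 2 := by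
      by_cases hv : velCut z.2 = 0
      · rw [hv, zero_mul, mul_zero, abs_zero]; positivity
      · rw [abs_mul, abs_of_nonneg (mul_nonneg (velCut_nonneg _) (grazingCut_nonneg _ _))]
        calc _ ≤ Cχ / R * 2 * 1 := by
              refine mul_le_mul ((hCχ _ _).trans ?_) (mul_le_one₀ (velCut_le_one _)
                (grazingCut_nonneg _ _) (grazingCut_le_one _ _))
                (mul_nonneg (velCut_nonneg _) (grazingCut_nonneg _ _)) (by positivity)
              exact mul_le_mul_of_nonneg_left (norm_le_two_of_velCut_ne_zero hv) (by positivity)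
          _ = _ := mul_one _
    calc _ ≤ β w * (Cχ / R * 2) :=
          mul_le_mul_of_nonneg_left ((le_abs_self _).trans h1) (hβ.β_nonneg w)
      _ ≤ C * w ^ 2 * (Cχ / R * 2) :=
          mul_le_mul_of_nonneg_right (hβ.β_le_sq w) (by positivity)
      _ = _ := by ring
  · set L := velCut z.2 * posCut R z.1 * deriv Real.smoothTransition (grazingForm d s z - 1)
      with hL
    have e : β w * (velCut z.2 * posCut R z.1 * (deriv Real.smoothTransition
        (grazingForm d s z - 1) * (z.2 (Fin.last d) / s ^ 10)))
        = β w * L * (z.2 (Fin.last d) / s ^ 10) := by rw [hL]; ring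
    rw [e]
    have hL0 : 0 ≤ L := mul_nonneg (mul_nonneg (velCut_nonneg _) (posCut_nonneg _ _))
      (deriv_smoothTransition_nonneg _)
    have hrhs : 0 ≤ C * C₁ * (s * w ^ 2
        + (s ^ 13)⁻¹ * (incomingLayer d R s).indicator (fun _ => (1 : ℝ)) z) := by positivity
    by_cases hLz : L = 0
    · rw [hLz, mul_zero, zero_mul]; exact hrhs
    -- Outgoing or tangential velocities: the derivative is nonpositive and `β ≥ 0`, so the term may
    -- be dropped without any information on the trace of the solution.
    by_cases hv : z.2 (Fin.last d) ≤ 0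
    · refine le_trans ?_ hrhs
      exact mul_nonpos_of_nonneg_of_nonpos (mul_nonneg (hβ.β_nonneg _) hL0)
        (div_nonpos_of_nonpos_of_nonneg hv (by positivity))
    -- Both summands of the grazing form are then positive with sum at most 2, so each is at most 2.
    by_cases hx : 0 < z.1 (Fin.last d)
    · rw [not_le] at hv
      obtain ⟨g1, g2, -, g4⟩ := layer_of_ne_zero hR hLz
      unfold grazingForm at g4
      have hx10 : 0 < z.1 (Fin.last d) / s ^ 10 := by positivity
      have hv4 : 0 < z.2 (Fin.last d) / s ^ 4 := by positivity
      have hx' : z.1 (Fin.last d) ≤ 2 * s ^ 10 := by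
        rw [← div_le_iff₀ (by positivity)]; linarith
      have hv' : z.2 (Fin.last d) ≤ 2 * s ^ 4 := by
        rw [← div_le_iff₀ (by positivity)]; linarith
      have hmem : z ∈ incomingLayer d R s := ⟨⟨g1, hx.le, hx'⟩, ⟨g2, hv.le, hv'⟩⟩
      rw [indicator_of_mem hmem, mul_one]
      calc β w * L * (z.2 (Fin.last d) / s ^ 10)
          ≤ (C * |w|) * C₁ * (2 * s ^ 4 / s ^ 10) := by
            refine mul_le_mul (mul_le_mul (hβ.β_le w) ((le_abs_self _).trans (abs_layer_le hC₁ R s z))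
              hL0 (by positivity)) ?_ (by positivity) (by positivity)
            exact div_le_div_of_nonneg_right hv' (by positivity)
        _ = C * C₁ * (2 * |w| / s ^ 6) := by field_simp
        _ ≤ _ := mul_le_mul_of_nonneg_left (two_mul_abs_div_le w hs 6) (by positivity)
    · have hw0 := hw hx
      have : β w = 0 := by rw [hw0]; exact hβ.zero
      rw [this, zero_mul, zero_mul]; exact hrhs

/-- By tangency only the grazing cutoff contributes, with velocity derivative `O(s⁻⁴)` in the last
coordinate. Young's inequality with `m = 4` gives `s⁻⁹`, which the layer volume `s¹⁰` compensates.
-/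
theorem sum_flux_fullCut_le (hβ : IsLevelRenormalizer M β b b' C) {C₁ R s : ℝ}
    (hC₁ : ∀ s, |deriv Real.smoothTransition s| ≤ C₁) (hR : 0 < R) (hs : 0 < s) {w : ℝ}
    {z : E d × E d} {H : Fin (d + 1) → ℝ} (hH : ∑ i, H i * z.2 i = 0) :
    -∑ i, (H i * fderiv ℝ (fullCut R s) z (velDir i)) * b w
      ≤ C * C₁ * (s * H (Fin.last d) ^ 2
        + (s ^ 9)⁻¹ * (grazingLayer d R s).indicator (fun _ => (1 : ℝ)) z) := by
  have hC : 0 ≤ C := (abs_nonneg _).trans (hβ.bound₁ 0)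
  have hC₁0 : 0 ≤ C₁ := (abs_nonneg _).trans (hC₁ 0)
  have hind : 0 ≤ (grazingLayer d R s).indicator (fun _ => (1 : ℝ)) z :=
    indicator_nonneg (fun _ _ => zero_le_one) _
  obtain ⟨c, hc⟩ := exists_fderiv_velCut z.2
  set L := velCut z.2 * posCut R z.1 * deriv Real.smoothTransition (grazingForm d s z - 1)
    with hL
  have e : ∑ i, (H i * fderiv ℝ (fullCut R s) z (velDir i)) * b w
      = H (Fin.last d) * L * b w / s ^ 4 := by
    have e1 : ∀ i, (H i * fderiv ℝ (fullCut R s) z (velDir i)) * b w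
        = (c * (posCut R z.1 * grazingCut s z) * b w) * (H i * z.2 i)
          + (if i = Fin.last d then H i * L * b w / s ^ 4 else 0) := by
      intro i
      rw [fderiv_fullCut, hc]
      simp only [velDir, map_zero, grazingForm, EuclideanSpace.inner_single_right]
      split_ifs with hi
      · subst hi; simp [hL, grazingForm]; ring
      · simp [Ne.symm hi]; ring
    rw [Finset.sum_congr rfl fun i _ => e1 i, Finset.sum_add_distrib, ← Finset.mul_sum, hH]
    simp
  rw [e]
  by_cases hLz : L = 0
  · rw [hLz]; simp only [mul_zero, zero_mul, zero_div, neg_zero]; positivity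
  rw [indicator_of_mem (layer_of_ne_zero hR hLz), mul_one]
  calc -(H (Fin.last d) * L * b w / s ^ 4) ≤ |H (Fin.last d) * L * b w / s ^ 4| := neg_le_abs _
    _ = |H (Fin.last d)| * |L| * |b w| / s ^ 4 := by
        rw [abs_div, abs_mul, abs_mul, abs_of_pos (pow_pos hs 4)]
    _ ≤ |H (Fin.last d)| * C₁ * C / s ^ 4 := by
        refine div_le_div_of_nonneg_right ?_ (by positivity)
        exact mul_le_mul (mul_le_mul_of_nonneg_left (abs_layer_le hC₁ R s z) (abs_nonneg _))
          (hβ.bound₁ w) (abs_nonneg _) (by positivity)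
    _ ≤ C * C₁ * (2 * |H (Fin.last d)| / s ^ 4) := by
        have : 0 ≤ |H (Fin.last d)| * C₁ * C / s ^ 4 := by positivity
        calc _ ≤ 2 * (|H (Fin.last d)| * C₁ * C / s ^ 4) := by linarith
          _ = _ := by ring
    _ ≤ _ := mul_le_mul_of_nonneg_left (two_mul_abs_div_le _ hs 4) (by positivity)

end PointwiseBounds

end FokkerPlanck

namespace FokkerPlanck

variable {d : ℕ}

/-! ### The comparison principle for kinetic systems -/

section Comparison

variable {u h : E d × E d → ℝ} {G H : Fin (d + 1) → E d × E d → ℝ}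

theorem integrable_indicator_one {N : Set (E d × E d)} {K : ℝ} (hN : MeasurableSet N)
    (hvol : volume N ≤ ENNReal.ofReal K) :
    Integrable (N.indicator fun _ => (1 : ℝ)) :=
  (integrable_indicator_iff hN).2 (integrableOn_const (hvol.trans_lt ENNReal.ofReal_lt_top).ne)

theorem integral_indicator_one_le {N : Set (E d × E d)} {K : ℝ} (hK : 0 ≤ K) (hN : MeasurableSet N)
    (hvol : volume N ≤ ENNReal.ofReal K) :
    ∫ z, N.indicator (fun _ => (1 : ℝ)) z ≤ K := by
  rw [integral_indicator_const _ hN, smul_eq_mul, mul_one, measureReal_def]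
  exact ENNReal.toReal_le_of_le_ofReal hK hvol

variable (d) in
/-- The renormalized inequality tested with the cutoffs, with all error terms estimated. -/
theorem IsKineticSystem.exists_cutoff_estimate :
    ∃ Cχ : ℝ, ∀ {u h : E d × E d → ℝ} {G H : Fin (d + 1) → E d × E d → ℝ},
      IsKineticSystem (incomingRegion d) u h G H →
      (∀ z, ¬ 0 < z.1 (Fin.last d) → u z = 0) → (∀ᵐ z, ∑ i, H i z * z.2 i = 0) →
      (∀ᵐ z, 0 ≤ ∑ i, H i z * G i z) →
      ∀ {M C : ℝ} {β b b' : ℝ → ℝ}, IsLevelRenormalizer M β b b' C → ∀ R : ℝ, 0 < R →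
      ∃ K : ℝ, ∀ s : ℝ, 0 < s → ∫ z, (h z * fullCut R s z) * b (u z)
        ≤ 2 * C * Cχ / R * (∫ z, u z ^ 2) + s * K := by
  obtain ⟨Cχ, hCχ0, hCχ⟩ := exists_fderiv_posCut_bound d
  obtain ⟨C₁, hC₁1, hC₁⟩ := exists_deriv_smoothTransition_bound
  refine ⟨Cχ, fun {u h G H} hs hsupp htan hell {M C β b b'} hβ R hR => ?_⟩
  have hC : 0 ≤ C := (abs_nonneg _).trans (hβ.bound₁ 0)
  have hC₁0 : 0 ≤ C₁ := zero_le_one.trans hC₁1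
  set V : ℝ := (4 * R) ^ d * (4 ^ d * 4) with hV
  have hV0 : 0 ≤ V := by positivity
  -- This constant depends on `R` through `V` but not on `s`, which allows `s → 0` at fixed `R`.
  refine ⟨C * C₁ * ((∫ z, u z ^ 2) + V) + C * C₁ * ((∫ z, H (Fin.last d) z ^ 2) + V),
    fun s hs0 => ?_⟩
  set ζ : E d × E d → ℝ := fullCut R s with hζdef
  have hζ : ContDiff ℝ 1 ζ := (contDiff_fullCut R s).of_le (by exact_mod_cast le_top)
  have hζc : HasCompactSupport ζ := hasCompactSupport_fullCut hR
  have hren := hs.renormalized hβ.toIsRenormalizer hζ hζc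
    (tsupport_fullCut_subset_incomingRegion hR hs0)
  have hζ2 : ∀ a, MemLp (fun z => fderiv ℝ ζ z a) 2 := fun a =>
    ((hζ.continuous_fderiv one_ne_zero).clm_apply continuous_const).memLp_of_hasCompactSupport
      (hζc.fderiv_apply ℝ a)
  have hζT : MemLp (fun z => fderiv ℝ ζ z (z.2, 0)) 2 := by
    refine ((hζ.continuous_fderiv one_ne_zero).clm_apply
      (by fun_prop)).memLp_of_hasCompactSupport ?_
    refine (hζc.fderiv ℝ).mono fun s hs' => ?_
    contrapose! hs'
    simp [Function.notMem_support.1 hs']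
  have hbu : AEStronglyMeasurable fun z => b (u z) :=
    hβ.continuous_b.comp_aestronglyMeasurable hs.memLp_u.1
  have i1 : ∀ i, Integrable fun z => (H i z * G i z) * (b' (u z) * ζ z) := by
    intro i
    obtain ⟨B, hB⟩ := hζc.exists_bound_of_continuous hζ.continuous
    refine ((hs.memLp_H i).integrable_mul (hs.memLp_G i)).mul_bdd (c := C * B)
      ((hβ.cont.comp_aestronglyMeasurable hs.memLp_u.1).mul hζ.continuous.aestronglyMeasurable)
      (.of_forall fun z => ?_)
    rw [norm_mul]
    exact mul_le_mul (hβ.bound₂ _) (hB z) (norm_nonneg _) hC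
  have i2 : ∀ i, Integrable fun z => (H i z * fderiv ℝ ζ z (velDir i)) * b (u z) := fun i =>
    ((hs.memLp_H i).integrable_mul (hζ2 _)).mul_bdd hbu (.of_forall fun z => hβ.bound₁ _)
  have i3 : Integrable fun z => β (u z) * fderiv ℝ ζ z (z.2, 0) :=
    (hβ.memLp hs.memLp_u).integrable_mul hζT
  -- Ellipticity and convexity of `β`: the dissipation has the good sign and is discarded.
  have hdiss : 0 ≤ ∑ i, ∫ z, (H i z * G i z) * (b' (u z) * ζ z) := by
    rw [← integral_finsetSum _ fun i _ => i1 i]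
    refine integral_nonneg_of_ae ?_
    filter_upwards [hell] with z hz
    rw [← Finset.sum_mul]
    exact mul_nonneg hz (mul_nonneg (hβ.b'_nonneg _) (fullCut_nonneg _ _ _))
  have hN₁ := volume_incomingLayer_le (d := d) hR.le hs0
  have hN₂ := volume_grazingLayer_le (d := d) hR.le hs0
  have hm₁ := (isClosed_incomingLayer (d := d) R s).measurableSet
  have hm₂ := (isClosed_grazingLayer (d := d) R s).measurableSet
  have j₁ := integrable_indicator_one hm₁ hN₁
  have j₂ := integrable_indicator_one hm₂ hN₂
  have hu2 : Integrable fun z => u z ^ 2 := hs.memLp_u.integrable_sq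
  have hH2 : Integrable fun z => H (Fin.last d) z ^ 2 := (hs.memLp_H _).integrable_sq
  have htr : ∫ z, β (u z) * fderiv ℝ ζ z (z.2, 0)
      ≤ 2 * C * Cχ / R * (∫ z, u z ^ 2) + s * (C * C₁ * ((∫ z, u z ^ 2) + V)) := by
    have hint : Integrable fun z => s * u z ^ 2
        + (s ^ 13)⁻¹ * (incomingLayer d R s).indicator (fun _ => (1 : ℝ)) z :=
      (hu2.const_mul s).add (j₁.const_mul _)
    calc _ ≤ ∫ z, (2 * C * Cχ / R * u z ^ 2 + C * C₁ * (s * u z ^ 2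
          + (s ^ 13)⁻¹ * (incomingLayer d R s).indicator (fun _ => (1 : ℝ)) z)) :=
          integral_mono i3 ((hu2.const_mul _).add (hint.const_mul _)) fun z =>
            transport_fullCut_le hβ hC₁ (hCχ R hR) hCχ0 hR hs0 (hsupp z)
      _ = 2 * C * Cχ / R * (∫ z, u z ^ 2) + C * C₁ * (s * (∫ z, u z ^ 2)
          + (s ^ 13)⁻¹ * ∫ z, (incomingLayer d R s).indicator (fun _ => (1 : ℝ)) z) := by
          rw [integral_add (hu2.const_mul _) (hint.const_mul _), integral_const_mul,
            integral_const_mul, integral_add (hu2.const_mul s) (j₁.const_mul _),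
            integral_const_mul, integral_const_mul]
      _ ≤ 2 * C * Cχ / R * (∫ z, u z ^ 2) + C * C₁ * (s * (∫ z, u z ^ 2)
          + (s ^ 13)⁻¹ * (V * s ^ 14)) := by
          gcongr
          exact integral_indicator_one_le (by positivity) hm₁ hN₁
      _ = _ := by field_simp
  have hfl : -∑ i, ∫ z, (H i z * fderiv ℝ ζ z (velDir i)) * b (u z)
      ≤ s * (C * C₁ * ((∫ z, H (Fin.last d) z ^ 2) + V)) := by
    have hint : Integrable fun z => s * H (Fin.last d) z ^ 2
        + (s ^ 9)⁻¹ * (grazingLayer d R s).indicator (fun _ => (1 : ℝ)) z :=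
      (hH2.const_mul s).add (j₂.const_mul _)
    rw [← integral_finsetSum _ fun i _ => i2 i, ← integral_neg]
    calc _ ≤ ∫ z, C * C₁ * (s * H (Fin.last d) z ^ 2
          + (s ^ 9)⁻¹ * (grazingLayer d R s).indicator (fun _ => (1 : ℝ)) z) := by
          refine integral_mono_ae (integrable_finsetSum _ fun i _ => i2 i).neg
            (hint.const_mul _) ?_
          filter_upwards [htan] with z hz
          exact sum_flux_fullCut_le hβ hC₁ hR hs0 hz
      _ = C * C₁ * (s * (∫ z, H (Fin.last d) z ^ 2)
          + (s ^ 9)⁻¹ * ∫ z, (grazingLayer d R s).indicator (fun _ => (1 : ℝ)) z) := by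
          rw [integral_const_mul, integral_add (hH2.const_mul s) (j₂.const_mul _),
            integral_const_mul, integral_const_mul]
      _ ≤ C * C₁ * (s * (∫ z, H (Fin.last d) z ^ 2) + (s ^ 9)⁻¹ * (V * s ^ 10)) := by
          gcongr
          exact integral_indicator_one_le (by positivity) hm₂ hN₂
      _ = _ := by field_simp
  rw [Finset.sum_add_distrib] at hren
  linarith

/-- A comparison principle for kinetic systems with absorbing incoming boundary. -/
theorem IsKineticSystem.le_of_level (hs : IsKineticSystem (incomingRegion d) u h G H)
    (hsupp : ∀ z, ¬ 0 < z.1 (Fin.last d) → u z = 0) (htan : ∀ᵐ z, ∑ i, H i z * z.2 i = 0)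
    (hell : ∀ᵐ z, 0 ≤ ∑ i, H i z * G i z) {M : ℝ} (hM : 0 ≤ M)
    (hlev : ∀ᵐ z, M < u z → 0 < h z) : ∀ᵐ z, velCut z.2 ≠ 0 → u z ≤ M := by
  obtain ⟨β, b, b', C, hβ⟩ := exists_isLevelRenormalizer hM
  obtain ⟨Cχ, hest⟩ := IsKineticSystem.exists_cutoff_estimate d
  have hbu : MemLp (fun z => b (u z)) 2 := by
    refine (hs.memLp_u.const_mul C).mono
      (hβ.continuous_b.comp_aestronglyMeasurable hs.memLp_u.1) (.of_forall fun z => ?_)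
    rw [norm_mul]
    exact (hβ.b_le _).trans (mul_le_mul_of_nonneg_right (le_abs_self C) (abs_nonneg _))
  have hF : Integrable fun z => h z * b (u z) := hs.memLp_h.integrable_mul hbu
  have hb0 : ∀ z : E d × E d, ¬ 0 < z.1 (Fin.last d) → b (u z) = 0 := fun z hz => by
    rw [hsupp z hz]; exact hβ.b_eq_zero 0 hM
  have hR : ∀ R : ℝ, 0 < R → ∫ z, (h z * (velCut z.2 * posCut R z.1)) * b (u z)
      ≤ 2 * C * Cχ / R * (∫ z, u z ^ 2) := by
    intro R hR
    obtain ⟨K, hK⟩ := hest hs hsupp htan hell hβ R hR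
    -- The grazing cutoff tends to 1 where `xₙ > 0`; elsewhere `u = 0`, so `b(u) = 0` as `M ≥ 0`.
    have hlim : Tendsto (fun s => ∫ z, (h z * fullCut R s z) * b (u z)) (𝓝[>] 0)
        (𝓝 (∫ z, (h z * (velCut z.2 * posCut R z.1)) * b (u z))) := by
      refine tendsto_integral_filter_of_dominated_convergence (fun z => |h z * b (u z)|)
        (.of_forall fun s => ?_) (.of_forall fun s => .of_forall fun z => ?_) hF.abs
        (.of_forall fun z => ?_)
      · exact (hs.memLp_h.1.mul (contDiff_fullCut R s).continuous.aestronglyMeasurable).mul hbu.1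
      · have h1 : |fullCut R s z| ≤ 1 := by
          rw [abs_of_nonneg (fullCut_nonneg _ _ _)]
          exact mul_le_one₀ (mul_le_one₀ (velCut_le_one _) (posCut_nonneg _ _) (posCut_le_one _ _))
            (grazingCut_nonneg _ _) (grazingCut_le_one _ _)
        rw [mul_right_comm, norm_mul]
        exact mul_le_of_le_one_right (abs_nonneg _) h1
      · by_cases hz : 0 < z.1 (Fin.last d)
        · have := ((tendsto_grazingCut hz).const_mul (h z * (velCut z.2 * posCut R z.1))).mul_const
            (b (u z))
          rw [mul_one] at this
          refine this.congr fun s => ?_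
          rw [fullCut]; ring
        · simp [hb0 z hz]
    have hlim2 : Tendsto (fun s : ℝ => 2 * C * Cχ / R * (∫ z, u z ^ 2) + s * K) (𝓝[>] 0)
        (𝓝 (2 * C * Cχ / R * (∫ z, u z ^ 2) + 0 * K)) := by
      refine Tendsto.mono_left (Continuous.tendsto ?_ 0) nhdsWithin_le_nhds
      fun_prop
    rw [zero_mul, add_zero] at hlim2
    refine le_of_tendsto_of_tendsto hlim hlim2 ?_
    filter_upwards [self_mem_nhdsWithin] with s hs0 using hK s hs0
  have hle : ∫ z, (h z * velCut z.2) * b (u z) ≤ 0 := by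
    have hlim : Tendsto (fun R => ∫ z, (h z * (velCut z.2 * posCut R z.1)) * b (u z)) atTop
        (𝓝 (∫ z, (h z * velCut z.2) * b (u z))) := by
      refine tendsto_integral_filter_of_dominated_convergence (fun z => |h z * b (u z)|)
        (.of_forall fun R => ?_) (.of_forall fun R => .of_forall fun z => ?_) hF.abs
        (.of_forall fun z => ?_)
      · exact (hs.memLp_h.1.mul ((contDiff_velCut.continuous.comp continuous_snd).mul
          ((contDiff_posCut R).continuous.comp continuous_fst)).aestronglyMeasurable).mul hbu.1
      · have h1 : |velCut z.2 * posCut R z.1| ≤ 1 := by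
          rw [abs_of_nonneg (mul_nonneg (velCut_nonneg _) (posCut_nonneg _ _))]
          exact mul_le_one₀ (velCut_le_one _) (posCut_nonneg _ _) (posCut_le_one _ _)
        rw [mul_right_comm, norm_mul]
        exact mul_le_of_le_one_right (abs_nonneg _) h1
      · refine tendsto_const_nhds.congr' ?_
        filter_upwards [eventually_ge_atTop (‖z.1‖ + 1)] with R hR1
        rw [posCut_eq_one (by linarith [norm_nonneg z.1]) (by linarith), mul_one]
    have hlim2 : Tendsto (fun R : ℝ => 2 * C * Cχ / R * (∫ z, u z ^ 2)) atTop
        (𝓝 (0 * (∫ z, u z ^ 2))) :=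
      (tendsto_const_nhds.div_atTop tendsto_id).mul_const _
    rw [zero_mul] at hlim2
    refine le_of_tendsto_of_tendsto hlim hlim2 ?_
    filter_upwards [eventually_gt_atTop 0] with R hR0 using hR R hR0
  have hnn : 0 ≤ᵐ[volume] fun z => (h z * velCut z.2) * b (u z) := by
    filter_upwards [hlev] with z hz
    rcases le_or_gt (u z) M with hu | hu
    · simp [hβ.b_eq_zero _ hu]
    · exact mul_nonneg (mul_nonneg (hz hu).le (velCut_nonneg _)) (hβ.b_nonneg _)
  have hint : Integrable fun z => (h z * velCut z.2) * b (u z) := by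
    have := hF.mul_bdd (c := 1) (g := fun z : E d × E d => velCut z.2)
      (contDiff_velCut.continuous.comp continuous_snd).aestronglyMeasurable (.of_forall fun z => by
        change ‖velCut z.2‖ ≤ 1
        rw [Real.norm_of_nonneg (velCut_nonneg _)]; exact velCut_le_one _)
    refine this.congr (.of_forall fun z => ?_)
    simp only; ring
  -- The integrand is nonnegative because `h > 0` above the level and `b = 0` below it, while its
  -- integral is nonpositive; hence it vanishes almost everywhere.
  have hzero := (integral_eq_zero_iff_of_nonneg_ae hnn hint).1
    (le_antisymm hle (integral_nonneg_of_ae hnn))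
  filter_upwards [hzero, hlev] with z hz hl hv
  by_contra hu
  rw [not_le] at hu
  exact (mul_pos (mul_pos (hl hu) ((velCut_nonneg _).lt_of_ne' hv)) (hβ.b_pos _ hu)).ne' hz

end Comparison

end FokkerPlanck

namespace FokkerPlanck

variable {d : ℕ}

/-! ### Polar coordinates in velocity -/

section Polar

/-- The radial measure `rᵈ dr` on the positive half line, as a measure on the line. -/
noncomputable def radialMeasure (d : ℕ) : Measure ℝ :=
  (volume.restrict (Ioi 0)).withDensity fun r => ENNReal.ofReal (r ^ d)

instance : SFinite (radialMeasure d) := by unfold radialMeasure; infer_instance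

instance : IsFiniteMeasure (sphereMeasure d) := by unfold sphereMeasure; infer_instance

instance : SFinite (measureQ d) := by unfold measureQ; infer_instance

theorem measurableSet_halfSpace : MeasurableSet (halfSpace d) := by
  have h : Continuous fun x : E d => x (Fin.last d) := by fun_prop
  exact (isOpen_lt continuous_const h).measurableSet

theorem ae_radialMeasure_pos : ∀ᵐ r ∂(radialMeasure d), 0 < r :=
  (withDensity_absolutelyContinuous _ _).ae_le (ae_restrict_mem measurableSet_Ioi)

theorem integral_radialMeasure (g : ℝ → ℝ) :
    ∫ r, g r ∂(radialMeasure d) = ∫ r in Ioi (0 : ℝ), r ^ d * g r := by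
  unfold radialMeasure
  rw [integral_withDensity_eq_integral_toReal_smul (by fun_prop)
    (.of_forall fun _ => ENNReal.ofReal_lt_top)]
  refine setIntegral_congr_fun measurableSet_Ioi fun r hr => ?_
  have hr0 : 0 < r := hr
  simp only [smul_eq_mul]
  rw [ENNReal.toReal_ofReal (by positivity)]

theorem measurePreserving_val_volumeIoiPow :
    MeasurePreserving (Subtype.val : Ioi (0 : ℝ) → ℝ) (Measure.volumeIoiPow d)
      (radialMeasure d) := by
  refine ⟨measurable_subtype_coe, ?_⟩
  ext s hs
  rw [Measure.map_apply measurable_subtype_coe hs, Measure.volumeIoiPow, radialMeasure,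
    withDensity_apply _ (measurable_subtype_coe hs), withDensity_apply _ hs,
    Measure.restrict_restrict hs]
  rw [setLIntegral_subtype measurableSet_Ioi _ fun a : ℝ => ENNReal.ofReal (a ^ d)]
  congr 2
  rw [Subtype.image_preimage_coe, inter_comm]

theorem measurePreserving_smul_sphere :
    MeasurePreserving (fun q : Sph d × ℝ => q.2 • (q.1 : E d))
      ((sphereMeasure d).prod (radialMeasure d)) volume := by
  have hm : Measurable fun q : Sph d × ℝ => q.2 • (q.1 : E d) := by fun_prop
  have h1 := (volume : Measure (E d)).measurePreserving_homeomorphUnitSphereProd.symm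
    (homeomorphUnitSphereProd (E d)).toMeasurableEquiv
  have hdim : Module.finrank ℝ (E d) - 1 = d := by simp
  rw [hdim] at h1
  have h2 : MeasurePreserving (Subtype.val : ({0}ᶜ : Set (E d)) → E d)
      ((volume : Measure (E d)).comap (↑)) volume := by
    have := measurePreserving_subtype_coe (μa := (volume : Measure (E d)))
      (measurableSet_singleton (0 : E d)).compl
    rwa [restrict_compl_singleton] at this
  have h3 := h2.comp h1
  have h4 : MeasurePreserving (Prod.map id Subtype.val : Sph d × Ioi (0 : ℝ) → Sph d × ℝ)
      ((sphereMeasure d).prod (Measure.volumeIoiPow d))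
      ((sphereMeasure d).prod (radialMeasure d)) :=
    (MeasurePreserving.id _).prod measurePreserving_val_volumeIoiPow
  refine ⟨hm, ?_⟩
  rw [← h4.map_eq, Measure.map_map hm h4.measurable]
  have e : (fun q : Sph d × ℝ => q.2 • (q.1 : E d)) ∘ Prod.map id Subtype.val
      = Subtype.val ∘ (homeomorphUnitSphereProd (E d)).toMeasurableEquiv.symm := by
    funext q
    exact (homeomorphUnitSphereProd_symm_apply_coe (E d) q).symm
  rw [e]
  exact h3.map_eq

/-- The point `(x, r θ)`. -/
def polarPoint (q : (E d × Sph d) × ℝ) : E d × E d := (q.1.1, q.2 • (q.1.2 : E d))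

theorem measurePreserving_polarPoint :
    MeasurePreserving (polarPoint : (E d × Sph d) × ℝ → E d × E d)
      ((measureQ d).prod (radialMeasure d))
      ((volume : Measure (E d × E d)).restrict (halfSpace d ×ˢ univ)) := by
  have h1 : MeasurePreserving (MeasurableEquiv.prodAssoc : (E d × Sph d) × ℝ ≃ᵐ E d × Sph d × ℝ)
      ((measureQ d).prod (radialMeasure d))
      ((volume.restrict (halfSpace d)).prod ((sphereMeasure d).prod (radialMeasure d))) :=
    measurePreserving_prodAssoc _ _ _
  have h2 := (MeasurePreserving.id ((volume : Measure (E d)).restrict (halfSpace d))).prod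
    (measurePreserving_smul_sphere (d := d))
  have h3 := h2.comp h1
  rw [Measure.volume_eq_prod, ← Measure.prod_restrict, Measure.restrict_univ]
  exact h3

theorem norm_polar (θ : Sph d) {r : ℝ} (hr : 0 < r) : ‖r • (θ : E d)‖ = r := by
  rw [norm_smul, norm_eq_of_mem_sphere, mul_one, Real.norm_of_nonneg hr.le]

/-- The radial projection to the sphere. -/
noncomputable def sphereProj (v : E d) : Sph d :=
  ⟨if v = 0 then EuclideanSpace.single 0 1 else ‖v‖⁻¹ • v, by
    rw [mem_sphere_zero_iff_norm]
    split_ifs with h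
    · simp
    · rw [norm_smul, norm_inv, norm_norm, inv_mul_cancel₀ (norm_ne_zero_iff.2 h)]⟩

theorem measurable_sphereProj : Measurable (sphereProj : E d → Sph d) :=
  Measurable.subtype_mk (Measurable.ite (measurableSet_singleton 0) measurable_const
    (by fun_prop))

theorem sphereProj_smul (θ : Sph d) {r : ℝ} (hr : 0 < r) : sphereProj (r • (θ : E d)) = θ := by
  ext1
  have h : r • (θ : E d) ≠ 0 := by
    rw [← norm_pos_iff, norm_polar θ hr]; exact hr
  simp only [sphereProj, if_neg h, norm_polar θ hr]
  rw [smul_smul, inv_mul_cancel₀ hr.ne', one_smul]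

/-- The map `(x, v) ↦ (x, v / |v|)`. -/
noncomputable def toQ (z : E d × E d) : E d × Sph d := (z.1, sphereProj z.2)

theorem measurable_toQ : Measurable (toQ : E d × E d → E d × Sph d) :=
  measurable_fst.prodMk (measurable_sphereProj.comp measurable_snd)

/-- The points of the half space with velocity in the shell `{a < |v|² < b}`. -/
def halfShell (d : ℕ) (a b : ℝ) : Set (E d × E d) :=
  halfSpace d ×ˢ {v | a < ‖v‖ ^ 2 ∧ ‖v‖ ^ 2 < b}

theorem measurableSet_halfShell (a b : ℝ) : MeasurableSet (halfShell d a b) := by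
  have h : Continuous fun v : E d => ‖v‖ ^ 2 := by fun_prop
  exact measurableSet_halfSpace.prod
    ((isOpen_lt continuous_const h).inter (isOpen_lt h continuous_const)).measurableSet

/-- In polar coordinates the shell is a product with a radial factor that `toQ` forgets. The image
of Lebesgue measure is a constant multiple of `measureQ`; finiteness of the constant transfers `L²`
bounds to the shell, and its positivity brings almost everywhere statements back. -/
theorem map_toQ_restrict_halfShell (a b : ℝ) :
    (volume.restrict (halfShell d a b)).map toQ
      = radialMeasure d {r | a < r ^ 2 ∧ r ^ 2 < b} • measureQ d := by
  have hI : MeasurableSet {r : ℝ | a < r ^ 2 ∧ r ^ 2 < b} := by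
    have h : Continuous fun r : ℝ => r ^ 2 := by fun_prop
    exact ((isOpen_lt continuous_const h).inter (isOpen_lt h continuous_const)).measurableSet
  have hsub : halfShell d a b ⊆ halfSpace d ×ˢ univ := fun z hz => ⟨hz.1, trivial⟩
  rw [← Measure.restrict_restrict_of_subset hsub, ← measurePreserving_polarPoint.map_eq,
    Measure.restrict_map measurePreserving_polarPoint.measurable (measurableSet_halfShell a b),
    Measure.map_map measurable_toQ measurePreserving_polarPoint.measurable]
  have hpos : ∀ᵐ q ∂(measureQ d).prod (radialMeasure d), 0 < q.2 :=
    Measure.quasiMeasurePreserving_snd.ae ae_radialMeasure_pos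
  have hQ : ∀ᵐ q ∂(measureQ d).prod (radialMeasure d), q.1.1 ∈ halfSpace d := by
    have h1 : ∀ᵐ p ∂measureQ d, p.1 ∈ halfSpace d :=
      Measure.quasiMeasurePreserving_fst.ae (ae_restrict_mem measurableSet_halfSpace)
    exact Measure.quasiMeasurePreserving_fst.ae h1
  have hset : (polarPoint ⁻¹' halfShell d a b : Set ((E d × Sph d) × ℝ))
      =ᵐ[(measureQ d).prod (radialMeasure d)] univ ×ˢ {r : ℝ | a < r ^ 2 ∧ r ^ 2 < b} := by
    filter_upwards [hpos, hQ] with q hq1 hq2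
    have : q ∈ (polarPoint ⁻¹' halfShell d a b : Set ((E d × Sph d) × ℝ))
        ↔ q ∈ (univ ×ˢ {r : ℝ | a < r ^ 2 ∧ r ^ 2 < b} : Set ((E d × Sph d) × ℝ)) := by
      simp only [halfShell, polarPoint, mem_preimage, mem_prod, mem_ofPred_eq, norm_polar _ hq1]
      simp [hq2]
    exact propext this
  rw [Measure.restrict_congr_set hset, ← Measure.prod_restrict, Measure.restrict_univ]
  have hcongr : (toQ ∘ polarPoint : (E d × Sph d) × ℝ → E d × Sph d)
      =ᵐ[(measureQ d).prod ((radialMeasure d).restrict {r : ℝ | a < r ^ 2 ∧ r ^ 2 < b})]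
      Prod.fst := by
    have hpos' : ∀ᵐ q ∂(measureQ d).prod
        ((radialMeasure d).restrict {r : ℝ | a < r ^ 2 ∧ r ^ 2 < b}), 0 < q.2 :=
      Measure.quasiMeasurePreserving_snd.ae (ae_restrict_of_ae ae_radialMeasure_pos)
    filter_upwards [hpos'] with q hq
    simp [toQ, polarPoint, sphereProj_smul _ hq]
  rw [Measure.map_congr hcongr, Measure.map_fst_prod, Measure.restrict_apply_univ]

theorem radialMeasure_shell_ne_top {a b : ℝ} :
    radialMeasure d {r | a < r ^ 2 ∧ r ^ 2 < b} ≠ ⊤ := by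
  have hsub : {r : ℝ | a < r ^ 2 ∧ r ^ 2 < b} ⊆ Icc (-(1 + |b|)) (1 + |b|) := by
    intro r hr
    have h1 : r ^ 2 < b := hr.2
    have h2 : b ≤ |b| := le_abs_self b
    exact ⟨by nlinarith [abs_nonneg b], by nlinarith [abs_nonneg b]⟩
  refine ((measure_mono hsub).trans_lt ?_).ne
  rw [radialMeasure, withDensity_apply _ measurableSet_Icc, Measure.restrict_restrict
    measurableSet_Icc]
  have hb : ∀ r ∈ Icc (-(1 + |b|)) (1 + |b|) ∩ Ioi 0,
      ENNReal.ofReal (r ^ d) ≤ ENNReal.ofReal ((1 + |b|) ^ d) := fun r hr =>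
    ENNReal.ofReal_le_ofReal (pow_le_pow_left₀ (le_of_lt hr.2) hr.1.2 d)
  refine (setLIntegral_mono (measurable_const) hb).trans_lt ?_
  rw [setLIntegral_const]
  refine ENNReal.mul_lt_top ENNReal.ofReal_lt_top ?_
  exact (measure_mono inter_subset_left).trans_lt measure_Icc_lt_top

theorem radialMeasure_shell_ne_zero {a b : ℝ} (ha : a < 1) (hb : 1 < b) :
    radialMeasure d {r | a < r ^ 2 ∧ r ^ 2 < b} ≠ 0 := by
  have hopen : IsOpen ({r : ℝ | a < r ^ 2 ∧ r ^ 2 < b} ∩ Ioi 0) := by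
    have h : Continuous fun r : ℝ => r ^ 2 := by fun_prop
    exact ((isOpen_lt continuous_const h).inter (isOpen_lt h continuous_const)).inter isOpen_Ioi
  have hne : ({r : ℝ | a < r ^ 2 ∧ r ^ 2 < b} ∩ Ioi 0).Nonempty :=
    ⟨1, ⟨by simpa using ha, by simpa using hb⟩, one_pos (α := ℝ)⟩
  intro h0
  have hI : MeasurableSet {r : ℝ | a < r ^ 2 ∧ r ^ 2 < b} := by
    have h : Continuous fun r : ℝ => r ^ 2 := by fun_prop
    exact ((isOpen_lt continuous_const h).inter (isOpen_lt h continuous_const)).measurableSet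
  have h1 := (withDensity_apply_eq_zero' (by fun_prop)).1 h0
  rw [Measure.restrict_apply' measurableSet_Ioi] at h1
  refine (hopen.measure_pos volume hne).ne' (measure_mono_null ?_ h1)
  rintro r ⟨hr, hr0⟩
  have hr0' : 0 < r := hr0
  refine ⟨⟨?_, hr⟩, hr0⟩
  have : 0 < ENNReal.ofReal (r ^ d) := ENNReal.ofReal_pos.2 (by positivity)
  exact this.ne'

theorem ae_toQ_of_ae {P : E d × Sph d → Prop} (hP : ∀ᵐ p ∂measureQ d, P p) {a b : ℝ} :
    ∀ᵐ z, z ∈ halfShell d a b → P (toQ z) := by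
  rw [← ae_restrict_iff' (measurableSet_halfShell a b)]
  refine ae_of_ae_map measurable_toQ.aemeasurable ?_
  rw [map_toQ_restrict_halfShell]
  exact Measure.ae_smul_measure hP _

/-- The conditions `a < 1 < b` make the radial mass of the shell positive. A measurable
representative of `u` is used so that the sublevel set is measurable and the push-forward criterion
applies. -/
theorem ae_le_of_ae_toQ {u : E d × Sph d → ℝ} (hu : AEStronglyMeasurable u (measureQ d)) {M : ℝ}
    {a b : ℝ} (ha : a < 1) (hb : 1 < b) (h : ∀ᵐ z, z ∈ halfShell d a b → u (toQ z) ≤ M) :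
    ∀ᵐ p ∂measureQ d, u p ≤ M := by
  have h2 : ∀ᵐ z, z ∈ halfShell d a b → hu.mk u (toQ z) ≤ M := by
    filter_upwards [h, ae_toQ_of_ae hu.ae_eq_mk (a := a) (b := b)] with z h1 h2 hz
    rw [← h2 hz]
    exact h1 hz
  rw [← ae_restrict_iff' (measurableSet_halfShell a b)] at h2
  have hmeas : MeasurableSet {p | hu.mk u p ≤ M} :=
    measurableSet_le hu.stronglyMeasurable_mk.measurable measurable_const
  have h3 := (ae_map_iff measurable_toQ.aemeasurable hmeas).2 h2
  rw [map_toQ_restrict_halfShell, ae_iff, Measure.smul_apply, smul_eq_mul, mul_eq_zero] at h3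
  have h3' : ∀ᵐ p ∂measureQ d, hu.mk u p ≤ M :=
    h3.resolve_left (radialMeasure_shell_ne_zero ha hb)
  filter_upwards [h3', hu.ae_eq_mk] with p h4 h5
  rw [h5]; exact h4

end Polar

end FokkerPlanck

namespace FokkerPlanck

variable {d : ℕ}

/-! ### Radial extension of functions on `Q` -/

section RadialExtension

/-- The function `c(|v|) w(x, v / |v|)` on the half space with velocities in the shell, extended by
zero. -/
noncomputable def radialExt (c : ℝ → ℝ) (w : E d × Sph d → ℝ) (z : E d × E d) : ℝ :=
  (halfShell d (1 / 4) 4).indicator (fun z => c ‖z.2‖ * w (toQ z)) z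

theorem radialExt_of_mem (c : ℝ → ℝ) (w : E d × Sph d → ℝ) {z : E d × E d}
    (hz : z ∈ halfShell d (1 / 4) 4) : radialExt c w z = c ‖z.2‖ * w (toQ z) :=
  indicator_of_mem hz _

theorem radialExt_of_notMem (c : ℝ → ℝ) (w : E d × Sph d → ℝ) {z : E d × E d}
    (hz : z ∉ halfShell d (1 / 4) 4) : radialExt c w z = 0 :=
  indicator_of_notMem hz _

theorem radialExt_eq_zero (c : ℝ → ℝ) (w : E d × Sph d → ℝ) {z : E d × E d}
    (hz : ¬ 0 < z.1 (Fin.last d)) : radialExt c w z = 0 :=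
  radialExt_of_notMem c w fun h => hz h.1

theorem radialExt_sub (c : ℝ → ℝ) (w w' : E d × Sph d → ℝ) (z : E d × E d) :
    radialExt c (fun p => w p - w' p) z = radialExt c w z - radialExt c w' z := by
  by_cases hz : z ∈ halfShell d (1 / 4) 4
  · rw [radialExt_of_mem _ _ hz, radialExt_of_mem _ _ hz, radialExt_of_mem _ _ hz, mul_sub]
  · rw [radialExt_of_notMem _ _ hz, radialExt_of_notMem _ _ hz, radialExt_of_notMem _ _ hz,
      sub_zero]

theorem polarPoint_mem_halfShell {p : E d × Sph d} {r a b : ℝ} (hr : 0 < r) :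
    polarPoint (p, r) ∈ halfShell d a b ↔ p.1 ∈ halfSpace d ∧ a < r ^ 2 ∧ r ^ 2 < b := by
  simp only [halfShell, polarPoint, mem_prod, mem_ofPred_eq, norm_polar _ hr]

theorem radialExt_polarPoint (c : ℝ → ℝ) (w : E d × Sph d → ℝ) {p : E d × Sph d} {r : ℝ}
    (hr : 0 < r) (hp : p.1 ∈ halfSpace d) (hr2 : 1 / 4 < r ^ 2 ∧ r ^ 2 < 4) :
    radialExt c w (polarPoint (p, r)) = c r * w p := by
  rw [radialExt_of_mem _ _ ((polarPoint_mem_halfShell hr).2 ⟨hp, hr2⟩)]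
  simp only [polarPoint, toQ, norm_polar _ hr, sphereProj_smul _ hr]

theorem radialExt_polarPoint_eq_zero (c : ℝ → ℝ) (w : E d × Sph d → ℝ) (p : E d × Sph d) {r : ℝ}
    (hr : 0 < r) (hr2 : ¬ (1 / 4 < r ^ 2 ∧ r ^ 2 < 4)) :
    radialExt c w (polarPoint (p, r)) = 0 :=
  radialExt_of_notMem _ _ fun h => hr2 ((polarPoint_mem_halfShell hr).1 h).2

theorem memLp_radialExt {c : ℝ → ℝ} (hc : Measurable c)
    (hcb : ∀ r, 1 / 2 ≤ r → r ≤ 2 → |c r| ≤ 4) {w : E d × Sph d → ℝ}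
    (hw : MemLp w 2 (measureQ d)) : MemLp (radialExt c w) 2 := by
  have hm := measurableSet_halfShell (d := d) (1 / 4) 4
  have h1 : MemLp w 2 ((volume.restrict (halfShell d (1 / 4) 4)).map toQ) := by
    rw [map_toQ_restrict_halfShell]
    exact hw.smul_measure radialMeasure_shell_ne_top
  have h2 := (memLp_map_measure_iff h1.1 measurable_toQ.aemeasurable).1 h1
  refine (memLp_indicator_iff_restrict hm).2 ?_
  refine (h2.const_mul 4).mono
    ((hc.comp measurable_snd.norm).aestronglyMeasurable.mul h2.1) ?_
  filter_upwards [ae_restrict_mem hm] with z hz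
  rw [norm_mul, norm_mul, Real.norm_of_nonneg (zero_le_four (α := ℝ))]
  refine mul_le_mul_of_nonneg_right (hcb _ ?_ ?_) (norm_nonneg _)
  · nlinarith [hz.2.1, norm_nonneg z.2]
  · nlinarith [hz.2.2, norm_nonneg z.2]

theorem integral_eq_integral_polarPoint {F : E d × E d → ℝ} (hF : Integrable F)
    (hF0 : ∀ z, z.1 ∉ halfSpace d → F z = 0) :
    ∫ z, F z = ∫ q, F (polarPoint q) ∂((measureQ d).prod (radialMeasure d)) := by
  rw [← setIntegral_eq_integral_of_forall_compl_eq_zero (s := halfSpace d ×ˢ univ)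
    (fun z hz => hF0 z fun h => hz ⟨h, trivial⟩), ← measurePreserving_polarPoint.map_eq,
    integral_map measurePreserving_polarPoint.aemeasurable]
  rw [measurePreserving_polarPoint.map_eq]
  exact hF.1.restrict

theorem integrable_polarPoint {F : E d × E d → ℝ} (hF : Integrable F) :
    Integrable (fun q => F (polarPoint q)) ((measureQ d).prod (radialMeasure d)) :=
  measurePreserving_polarPoint.integrable_comp_of_integrable hF.restrict

/-- Fubini with the radius outside: identities on `Q`, one for each sphere of radius `r`, integrate
to an identity on `ℝⁿ × ℝⁿ`. -/
theorem integral_eq_of_integral_slices_eq {F F' : E d × E d → ℝ} (hF : Integrable F)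
    (hF' : Integrable F') (hF0 : ∀ z, z.1 ∉ halfSpace d → F z = 0)
    (hF0' : ∀ z, z.1 ∉ halfSpace d → F' z = 0)
    (h : ∀ r : ℝ, 0 < r → ∫ p, F (polarPoint (p, r)) ∂measureQ d
      = ∫ p, F' (polarPoint (p, r)) ∂measureQ d) : ∫ z, F z = ∫ z, F' z := by
  rw [integral_eq_integral_polarPoint hF hF0, integral_eq_integral_polarPoint hF' hF0',
    integral_prod_symm _ (integrable_polarPoint hF), integral_prod_symm _
    (integrable_polarPoint hF')]
  refine integral_congr_ae ?_
  filter_upwards [ae_radialMeasure_pos] with r hr using h r hr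

theorem integral_eq_zero_of_integral_rays_eq_zero {F : E d × E d → ℝ} (hF : Integrable F)
    (hF0 : ∀ z, z.1 ∉ halfSpace d → F z = 0)
    (h : ∀ p : E d × Sph d, ∫ r, F (polarPoint (p, r)) ∂radialMeasure d = 0) :
    ∫ z, F z = 0 := by
  rw [integral_eq_integral_polarPoint hF hF0, integral_prod _ (integrable_polarPoint hF)]
  simp [h]

theorem ae_mem_halfSpace : ∀ᵐ p ∂measureQ d, p.1 ∈ halfSpace d :=
  Measure.quasiMeasurePreserving_fst.ae (ae_restrict_mem measurableSet_halfSpace)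

end RadialExtension

/-! ### Test functions restricted to spheres of radius `r` -/

section Dilation

variable {φ : E d × E d → ℝ}

theorem contDiff_dilate {F : Type} [NormedAddCommGroup F] [NormedSpace ℝ F] {φ : E d × E d → F}
    (hφ : ContDiff ℝ ∞ φ) (r : ℝ) : ContDiff ℝ ∞ fun q : E d × E d => φ (q.1, r • q.2) :=
  hφ.comp (contDiff_fst.prodMk (contDiff_snd.const_smul r))

theorem hasCompactSupport_dilate {F : Type} [NormedAddCommGroup F] {φ : E d × E d → F}
    (hφ : HasCompactSupport φ) {r : ℝ} (hr : r ≠ 0) :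
    HasCompactSupport fun q : E d × E d => φ (q.1, r • q.2) :=
  hφ.comp_homeomorph ((Homeomorph.refl (E d)).prodCongr (Homeomorph.smulOfNeZero r hr))

theorem hasFDerivAt_dilate_vel (hφ : ContDiff ℝ ∞ φ) (x θ : E d) (r : ℝ) :
    HasFDerivAt (fun w : E d => φ (x, r • w))
      ((fderiv ℝ φ (x, r • θ)).comp (r • ContinuousLinearMap.inr ℝ (E d) (E d))) θ := by
  have h1 : HasFDerivAt (fun w : E d => ((x, r • w) : E d × E d))
      (r • ContinuousLinearMap.inr ℝ (E d) (E d)) θ := by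
    have h2 : HasFDerivAt (fun w : E d => r • w) (r • ContinuousLinearMap.id ℝ (E d)) θ :=
      (hasFDerivAt_id θ).const_smul r
    have h3 := (hasFDerivAt_const x θ).prodMk h2
    have e : r • ContinuousLinearMap.inr ℝ (E d) (E d)
        = ContinuousLinearMap.prod 0 (r • ContinuousLinearMap.id ℝ (E d)) := by
      ext y <;> simp
    rw [e]
    exact h3
  exact ((hφ.differentiable (by simp) _).hasFDerivAt).comp θ h1

theorem transport_dilate (hφ : ContDiff ℝ ∞ φ) (r : ℝ) (p : E d × Sph d) :
    r * transport (fun q : E d × E d => φ (q.1, r • q.2)) p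
      = fderiv ℝ φ (polarPoint (p, r)) ((polarPoint (p, r)).2, 0) := by
  have h1 : HasFDerivAt (fun x : E d => φ (x, r • (p.2 : E d)))
      ((fderiv ℝ φ (p.1, r • (p.2 : E d))).comp (ContinuousLinearMap.inl ℝ (E d) (E d))) p.1 :=
    ((hφ.differentiable (by simp) _).hasFDerivAt).comp p.1 (hasFDerivAt_prodMk_left _ _)
  have e : ((r • (p.2 : E d), 0) : E d × E d) = r • ((p.2 : E d), 0) := by simp
  rw [transport, h1.fderiv]
  simp only [polarPoint]
  rw [e, map_smul]
  simp

theorem sum_velDir (y : E d) : ∑ i, y i • (velDir i : E d × E d) = (0, y) := by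
  have h : ∑ i, y i • (EuclideanSpace.single i 1 : E d) = y := by
    ext j
    simp [Finset.sum_apply, Pi.single_apply]
  refine Prod.ext ?_ ?_
  · simp [velDir, Prod.fst_sum]
  · simpa [velDir, Prod.snd_sum] using h

/-- A tangent vector `g` annihilates the normal part subtracted in `angularGrad`; the factor `r`
comes from the chain rule. -/
theorem inner_angularGrad_dilate (hφ : ContDiff ℝ ∞ φ) (r : ℝ) (p : E d × Sph d) {g : E d}
    (hg : ⟪g, (p.2 : E d)⟫ = 0) :
    ⟪g, angularGrad (fun q : E d × E d => φ (q.1, r • q.2)) p⟫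
      = r * ∑ i, fderiv ℝ φ (polarPoint (p, r)) (velDir i) * g i := by
  have h := hasFDerivAt_dilate_vel hφ p.1 (p.2 : E d) r
  rw [angularGrad, inner_sub_right, inner_smul_right, hg, mul_zero, sub_zero, real_inner_comm,
    inner_gradient_left, h.fderiv]
  have : ∑ i, fderiv ℝ φ (polarPoint (p, r)) (velDir i) * g i
      = fderiv ℝ φ (polarPoint (p, r)) (0, g) := by
    rw [← sum_velDir g, map_sum]
    refine Finset.sum_congr rfl fun i _ => ?_
    rw [map_smul, smul_eq_mul, mul_comm]
  rw [this]
  simp [polarPoint]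

end Dilation

end FokkerPlanck

/-! ### The equation satisfied by the radial extension -/

namespace FokkerPlanck

variable {d : ℕ}

theorem abs_pow_le_four {r : ℝ} (h1 : 1 / 2 ≤ r) (h2 : r ≤ 2) {k : ℕ} (hk : k ≤ 2) :
    |r ^ k| ≤ 4 := by
  rw [abs_of_nonneg (by positivity)]
  interval_cases k <;> nlinarith

theorem abs_inv_pow_le_four {r : ℝ} (h1 : 1 / 2 ≤ r) {k : ℕ} (hk : k ≤ 2) :
    |(r ^ k)⁻¹| ≤ 4 := by
  rw [abs_of_nonneg (by positivity), inv_le_comm₀ (by positivity) (by norm_num)]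
  interval_cases k <;> nlinarith

theorem memLp_radialExt_pow {w : E d × Sph d → ℝ} (hw : MemLp w 2 (measureQ d)) {k : ℕ}
    (hk : k ≤ 2) : MemLp (radialExt (fun r => r ^ k) w) 2 :=
  memLp_radialExt (by fun_prop) (fun _ h1 h2 => abs_pow_le_four h1 h2 hk) hw

theorem memLp_radialExt_inv_pow {w : E d × Sph d → ℝ} (hw : MemLp w 2 (measureQ d)) {k : ℕ}
    (hk : k ≤ 2) : MemLp (radialExt (fun r => (r ^ k)⁻¹) w) 2 :=
  memLp_radialExt (by fun_prop) (fun _ h1 _ => abs_inv_pow_le_four h1 hk) hw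

section TestFunctions

variable {φ : E d × E d → ℝ}

theorem memLp_test (hφ : ContDiff ℝ ∞ φ) (hc : HasCompactSupport φ) : MemLp φ 2 :=
  hφ.continuous.memLp_of_hasCompactSupport hc

theorem memLp_fderiv_test (hφ : ContDiff ℝ ∞ φ) (hc : HasCompactSupport φ)
    {a : E d × E d → E d × E d} (ha : Continuous a) : MemLp (fun z => fderiv ℝ φ z (a z)) 2 := by
  refine ((hφ.continuous_fderiv (by simp)).clm_apply ha).memLp_of_hasCompactSupport ?_
  refine (hc.fderiv ℝ).mono fun s hs' => ?_
  contrapose! hs'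
  simp [Function.notMem_support.1 hs']

/-- On `Γ₊` one has `xₙ = 0` and `rθₙ < 0`, so the point is outside the incoming region. Nothing is
required on `Γ₋`, and this is what lets the equation extend across the incoming boundary. -/
theorem isTest_dilate (hφ : ContDiff ℝ ∞ φ) (hc : HasCompactSupport φ)
    (hO : tsupport φ ⊆ incomingRegion d) {r : ℝ} (hr : 0 < r) :
    IsTest fun q : E d × E d => φ (q.1, r • q.2) where
  smooth := contDiff_dilate hφ r
  compact := hasCompactSupport_dilate hc hr.ne'
  vanish x' θ hθ := by
    by_contra h
    have := (hO (subset_tsupport _ h)).1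
    simp only [bdryPoint, Fin.snoc_last, PiLp.smul_apply, smul_eq_mul, lt_self_iff_false,
      false_or] at this
    exact absurd this (not_lt.2 (mul_neg_of_pos_of_neg hr hθ).le)

end TestFunctions

/-- The radially extended equation. -/
theorem radialExt_eqn {ε : ℝ} {σ lam : E d → ℝ} {f u : E d × Sph d → ℝ} {G : E d × Sph d → E d}
    (hu : MemLp u 2 (measureQ d)) (hf : MemLp f 2 (measureQ d))
    (hlu : MemLp (fun p => lam p.1 * u p) 2 (measureQ d))
    (hG : ∀ i, MemLp (fun p => ε ^ 2 * σ p.1 * G p i) 2 (measureQ d))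
    (htan : ∀ᵐ p ∂measureQ d, ⟪G p, (p.2 : E d)⟫ = 0)
    (hweak : ∀ φ : E d × E d → ℝ, IsTest φ →
      ∫ p, (ε ^ 2 * σ p.1 * ⟪G p, angularGrad φ p⟫ - u p * transport φ p
          + lam p.1 * u p * φ (emb p)) ∂(measureQ d) = ∫ p, f p * φ (emb p) ∂(measureQ d))
    {φ : E d × E d → ℝ} (hφ : ContDiff ℝ ∞ φ) (hc : HasCompactSupport φ)
    (hO : tsupport φ ⊆ incomingRegion d) :
    ∑ i, (∫ z, fderiv ℝ φ z (velDir i) * radialExt (fun r => r ^ 2)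
        (fun p => ε ^ 2 * σ p.1 * G p i) z)
      - (∫ z, fderiv ℝ φ z (z.2, 0) * radialExt (fun r => r ^ 0) u z)
      + (∫ z, φ z * radialExt (fun r => r ^ 1) (fun p => lam p.1 * u p - f p) z) = 0 := by
  have i1 : ∀ i, Integrable fun z => fderiv ℝ φ z (velDir i) * radialExt (fun r => r ^ 2)
      (fun p => ε ^ 2 * σ p.1 * G p i) z := fun i =>
    (memLp_fderiv_test hφ hc continuous_const).integrable_mul (memLp_radialExt_pow (hG i) le_rfl)
  have i2 : Integrable fun z => fderiv ℝ φ z (z.2, 0) * radialExt (fun r => r ^ 0) u z :=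
    (memLp_fderiv_test hφ hc (a := fun z => (z.2, 0)) (by fun_prop)).integrable_mul
      (memLp_radialExt_pow hu (by norm_num))
  have i3 : Integrable fun z => φ z * radialExt (fun r => r ^ 1) (fun p => lam p.1 * u p) z :=
    (memLp_test hφ hc).integrable_mul (memLp_radialExt_pow hlu (by norm_num))
  have i4 : Integrable fun z => φ z * radialExt (fun r => r ^ 1) f z :=
    (memLp_test hφ hc).integrable_mul (memLp_radialExt_pow hf (by norm_num))
  have i1s : Integrable fun z => ∑ i, fderiv ℝ φ z (velDir i) * radialExt (fun r => r ^ 2)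
      (fun p => ε ^ 2 * σ p.1 * G p i) z := integrable_finsetSum _ fun i _ => i1 i
  have i12 : Integrable fun z => ∑ i, fderiv ℝ φ z (velDir i) * radialExt (fun r => r ^ 2)
      (fun p => ε ^ 2 * σ p.1 * G p i) z
      - fderiv ℝ φ z (z.2, 0) * radialExt (fun r => r ^ 0) u z := i1s.sub i2
  have i123 : Integrable fun z => ∑ i, fderiv ℝ φ z (velDir i) * radialExt (fun r => r ^ 2)
      (fun p => ε ^ 2 * σ p.1 * G p i) z
      - fderiv ℝ φ z (z.2, 0) * radialExt (fun r => r ^ 0) u z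
      + φ z * radialExt (fun r => r ^ 1) (fun p => lam p.1 * u p) z := i12.add i3
  -- On the sphere of radius `r`, the weak formulation for `φ(x, rθ)` is multiplied by `r`. One
  -- factor `r` turns `θ·∇ₓ` into `v·∇ₓ`, and the angular gradient brings another; this explains the
  -- weights `r²`, `r⁰`, `r¹` of flux, solution and source.
  have key := integral_eq_of_integral_slices_eq i123 i4
    (fun z hz => by simp [radialExt_eq_zero _ _ hz])
    (fun z hz => by simp [radialExt_eq_zero _ _ hz]) (fun r hr => by
      by_cases hr2 : 1 / 4 < r ^ 2 ∧ r ^ 2 < 4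
      · have hw := hweak _ (isTest_dilate hφ hc hO hr)
        have e1 : ∫ p, (∑ i, fderiv ℝ φ (polarPoint (p, r)) (velDir i) * radialExt (fun r => r ^ 2)
            (fun p => ε ^ 2 * σ p.1 * G p i) (polarPoint (p, r))
            - fderiv ℝ φ (polarPoint (p, r)) ((polarPoint (p, r)).2, 0)
              * radialExt (fun r => r ^ 0) u (polarPoint (p, r))
            + φ (polarPoint (p, r)) * radialExt (fun r => r ^ 1) (fun p => lam p.1 * u p)
              (polarPoint (p, r))) ∂measureQ d
          = r * ∫ p, (ε ^ 2 * σ p.1 * ⟪G p, angularGrad (fun q => φ (q.1, r • q.2)) p⟫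
            - u p * transport (fun q => φ (q.1, r • q.2)) p
            + lam p.1 * u p * φ ((emb p).1, r • (emb p).2)) ∂measureQ d := by
          rw [← integral_const_mul]
          refine integral_congr_ae ?_
          filter_upwards [ae_mem_halfSpace, htan] with p hp ht
          simp only [radialExt_polarPoint _ _ hr hp hr2, inner_angularGrad_dilate hφ r p ht,
            ← transport_dilate hφ r p]
          have e2 : ∑ i, fderiv ℝ φ (polarPoint (p, r)) (velDir i)
              * (r ^ 2 * (ε ^ 2 * σ p.1 * G p i))
              = r ^ 2 * (ε ^ 2 * σ p.1)
                * ∑ i, fderiv ℝ φ (polarPoint (p, r)) (velDir i) * G p i := by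
            rw [Finset.mul_sum]
            exact Finset.sum_congr rfl fun i _ => by ring
          rw [e2]
          simp only [emb, polarPoint]
          ring
        rw [e1, hw, ← integral_const_mul]
        refine integral_congr_ae ?_
        filter_upwards [ae_mem_halfSpace] with p hp
        rw [radialExt_polarPoint _ _ hr hp hr2]
        simp only [emb, polarPoint]
        ring
      · simp only [radialExt_polarPoint_eq_zero _ _ _ hr hr2]
        simp)
  rw [integral_add i12 i3, integral_sub i1s i2, integral_finsetSum _ fun i _ => i1 i] at key
  have e3 : ∫ z, φ z * radialExt (fun r => r ^ 1) (fun p => lam p.1 * u p - f p) z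
      = (∫ z, φ z * radialExt (fun r => r ^ 1) (fun p => lam p.1 * u p) z)
        - ∫ z, φ z * radialExt (fun r => r ^ 1) f z := by
    rw [← integral_sub i3 i4]
    refine integral_congr_ae (.of_forall fun z => ?_)
    simp only [radialExt_sub, mul_sub]
  rw [e3]
  linarith

end FokkerPlanck

namespace FokkerPlanck

variable {d : ℕ}

/-! ### Tangent test fields and their divergence -/

section TangentField

/-- The field `φ(x, r w) (e - ⟨e, w⟩ w)`, tangent to the unit sphere. -/
noncomputable def tangentField (φ : E d × E d → ℝ) (r : ℝ) (e : E d) (q : E d × E d) : E d :=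
  φ (q.1, r • q.2) • (e - ⟪e, q.2⟫ • q.2)

variable {φ : E d × E d → ℝ}

theorem isInteriorTest_tangentField (hφ : ContDiff ℝ ∞ φ) (hc : HasCompactSupport φ)
    (hI : tsupport φ ⊆ {z | z.1 ∈ halfSpace d}) {r : ℝ} (hr : r ≠ 0) (e : E d) :
    IsInteriorTest (tangentField φ r e) where
  smooth := by
    have h := contDiff_dilate hφ r
    have h2 : ContDiff ℝ ∞ fun q : E d × E d => ⟪e, q.2⟫ := contDiff_const.inner ℝ contDiff_snd
    exact h.smul (contDiff_const.sub (h2.smul contDiff_snd))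
  compact := (hasCompactSupport_dilate hc hr).smul_right
  interior := by
    have h1 : Continuous fun q : E d × E d => ((q.1, r • q.2) : E d × E d) := by fun_prop
    have h2 : tsupport (tangentField φ r e)
        ⊆ (fun q : E d × E d => ((q.1, r • q.2) : E d × E d)) ⁻¹' tsupport φ := by
      refine closure_minimal (fun q hq => subset_tsupport _ ?_)
        ((isClosed_tsupport φ).preimage h1)
      exact left_ne_zero_of_smul (Function.mem_support.1 hq)
    intro q hq
    have h3 : ((q.1, r • q.2) : E d × E d) ∈ {z : E d × E d | z.1 ∈ halfSpace d} := hI (h2 hq)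
    exact h3

theorem inner_tangentField (r : ℝ) (e x : E d) (θ : Sph d) :
    ⟪tangentField φ r e (x, (θ : E d)), (θ : E d)⟫ = 0 := by
  simp only [tangentField]
  rw [real_inner_smul_left, inner_sub_left, real_inner_smul_left, real_inner_self_eq_norm_sq,
    norm_eq_of_mem_sphere]
  ring

theorem inner_tangentField_of_tangent {g : E d} {p : E d × Sph d} (hg : ⟪g, (p.2 : E d)⟫ = 0)
    (r : ℝ) (i : Fin (d + 1)) :
    ⟪g, tangentField φ r (EuclideanSpace.single i 1) (emb p)⟫ = φ (polarPoint (p, r)) * g i := by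
  simp only [tangentField, emb, polarPoint]
  rw [inner_smul_right, inner_sub_right, inner_smul_right, hg, mul_zero, sub_zero]
  simp [EuclideanSpace.inner_single_right]

/-- The projection `e - ⟨e, θ⟩θ` has spherical divergence `-d θᵢ`, the sphere having dimension `d`,
and its pairing with the derivative of `φ` gives a Cartesian derivative minus a radial one. The
bracket gathers the terms that will integrate to zero along rays. -/
theorem angularDiv_tangentField (hφ : ContDiff ℝ ∞ φ) (r : ℝ) (i : Fin (d + 1))
    (p : E d × Sph d) :
    angularDiv (tangentField φ r (EuclideanSpace.single i 1)) p
      = r * fderiv ℝ φ (polarPoint (p, r)) (velDir i)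
        - (p.2 : E d) i * (d * φ (polarPoint (p, r))
          + fderiv ℝ φ (polarPoint (p, r)) (0, (polarPoint (p, r)).2)) := by
  set e : E d := EuclideanSpace.single i 1 with he
  set θ : E d := (p.2 : E d) with hθ
  have hei : ⟪e, θ⟫ = θ i := by simp [he, EuclideanSpace.inner_single_left]
  have h1 := hasFDerivAt_dilate_vel hφ p.1 θ r
  have h2 : HasFDerivAt (fun w : E d => e - ⟪e, w⟫ • w)
      (-(⟪e, θ⟫ • ContinuousLinearMap.id ℝ (E d) + (innerSL ℝ e).smulRight θ)) θ := by
    have h3 : HasFDerivAt (fun w : E d => ⟪e, w⟫) (innerSL ℝ e) θ := (innerSL ℝ e).hasFDerivAt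
    exact (h3.smul (hasFDerivAt_id θ)).const_sub e
  have h4 := h1.smul h2
  have h5 : fderiv ℝ (fun w : E d => tangentField φ r e (p.1, w)) θ = _ := h4.fderiv
  have hn : ⟪θ, θ⟫ = 1 := by
    rw [real_inner_self_eq_norm_sq, hθ, norm_eq_of_mem_sphere, one_pow]
  have hD : ∀ y : E d, fderiv ℝ φ (p.1, r • θ) (0, r • y) = r * fderiv ℝ φ (p.1, r • θ) (0, y) := by
    intro y
    rw [← smul_eq_mul, ← map_smul]
    simp
  have hDe : fderiv ℝ φ (p.1, r • θ) (0, e - θ i • θ) = fderiv ℝ φ (p.1, r • θ) (velDir i)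
      - θ i * fderiv ℝ φ (p.1, r • θ) (0, θ) := by
    rw [← smul_eq_mul, ← map_smul, ← map_sub]
    simp [velDir, he]
  rw [angularDiv, h5]
  simp only [polarPoint]
  rw [← hθ]
  have hT : LinearMap.trace ℝ (E d) ((φ (p.1, r • θ) •
      -(⟪e, θ⟫ • ContinuousLinearMap.id ℝ (E d) + (innerSL ℝ e).smulRight θ)
      + ((fderiv ℝ φ (p.1, r • θ)).comp
        (r • ContinuousLinearMap.inr ℝ (E d) (E d))).smulRight (e - ⟪e, θ⟫ • θ)
      : E d →L[ℝ] E d)).toLinearMap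
      = φ (p.1, r • θ) * -(θ i * (d + 1) + θ i)
        + r * fderiv ℝ φ (p.1, r • θ) (0, e - θ i • θ) := by
    have e1 : ((φ (p.1, r • θ) •
      -(⟪e, θ⟫ • ContinuousLinearMap.id ℝ (E d) + (innerSL ℝ e).smulRight θ)
      + ((fderiv ℝ φ (p.1, r • θ)).comp
        (r • ContinuousLinearMap.inr ℝ (E d) (E d))).smulRight (e - ⟪e, θ⟫ • θ)
      : E d →L[ℝ] E d)).toLinearMap
      = φ (p.1, r • θ) • -(⟪e, θ⟫ • LinearMap.id
          + ((innerSL ℝ e : E d →L[ℝ] ℝ) : E d →ₗ[ℝ] ℝ).smulRight θ)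
        + (((fderiv ℝ φ (p.1, r • θ)).comp (r • ContinuousLinearMap.inr ℝ (E d) (E d))
            : E d →L[ℝ] ℝ) : E d →ₗ[ℝ] ℝ).smulRight (e - ⟪e, θ⟫ • θ) := rfl
    rw [e1]
    simp only [map_add, map_smul, map_neg, LinearMap.trace_id, LinearMap.trace_smulRight,
      smul_eq_mul]
    simp [hei]
  rw [hT, hDe]
  simp only [add_apply, smul_apply,
    neg_apply, ContinuousLinearMap.smulRight_apply, inner_add_left,
    inner_neg_left, inner_sub_left, real_inner_smul_left, innerSL_apply_apply,
    ContinuousLinearMap.id_apply, hei, hn]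
  rw [hD]
  have : ⟪e, θ⟫ = θ i := hei
  ring

end TangentField

/-! ### From the angular gradient to the velocity gradient -/

section WeakGradient

variable {φ : E d × E d → ℝ}

/-- With the weight `r⁻²` and the density `rᵈ`, the integrand is `u θᵢ` times the derivative of `rᵈ
φ(x, rθ)` in `r`, and `φ` vanishes along the ray outside the shell. -/
theorem integral_ray_eq_zero (hφ : ContDiff ℝ ∞ φ) (hO : tsupport φ ⊆ incomingRegion d)
    (u : E d × Sph d → ℝ) (i : Fin (d + 1)) (p : E d × Sph d) :
    ∫ r, radialExt (fun r => (r ^ 2)⁻¹) u (polarPoint (p, r)) * ((polarPoint (p, r)).2 i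
      * (d * φ (polarPoint (p, r)) + fderiv ℝ φ (polarPoint (p, r)) (0, (polarPoint (p, r)).2)))
      ∂radialMeasure d = 0 := by
  by_cases hp : p.1 ∈ halfSpace d
  swap
  · have h : ∀ r, radialExt (fun r => (r ^ 2)⁻¹) u (polarPoint (p, r)) = 0 := fun r =>
      radialExt_eq_zero _ _ (z := polarPoint (p, r)) hp
    simp [h]
  set θ : E d := (p.2 : E d) with hθ
  have hout : ∀ r : ℝ, ¬ (1 / 4 < r ^ 2 ∧ r ^ 2 < 4) → ((p.1, r • θ) : E d × E d) ∉ tsupport φ := by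
    intro r hr h
    have := (hO h).2
    simp only [shell, mem_ofPred_eq, norm_smul, hθ, norm_eq_of_mem_sphere, mul_one,
      Real.norm_eq_abs, sq_abs] at this
    exact hr this
  set F : ℝ → ℝ := fun r => r ^ d * φ (p.1, r • θ) with hF
  have hpath : ∀ r, HasDerivAt (fun r : ℝ => φ (p.1, r • θ))
      (fderiv ℝ φ (p.1, r • θ) (0, θ)) r := by
    intro r
    have h1 : HasDerivAt (fun r : ℝ => ((p.1, r • θ) : E d × E d)) (0, θ) r := by
      simpa using (hasDerivAt_const r p.1).prodMk ((hasDerivAt_id r).smul_const θ)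
    exact ((hφ.differentiable (by simp) _).hasFDerivAt).comp_hasDerivAt r h1
  have hFd : ContDiff ℝ 1 F := by
    refine (contDiff_id.pow d).mul ((hφ.of_le (by simp)).comp ?_)
    exact contDiff_const.prodMk (contDiff_id.smul contDiff_const)
  have hFc : HasCompactSupport F := by
    refine HasCompactSupport.intro (isCompact_Icc (a := (-2 : ℝ)) (b := 2)) fun r hr => ?_
    have : φ (p.1, r • θ) = 0 := image_eq_zero_of_notMem_tsupport (hout r fun h => hr
      ⟨by nlinarith [h.2], by nlinarith [h.2]⟩)
    simp [hF, this]
  have hF0 : F 0 = 0 := by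
    have : φ (p.1, (0 : ℝ) • θ) = 0 := image_eq_zero_of_notMem_tsupport (hout 0 (by norm_num))
    simp only [hF, this, mul_zero]
  have hFderiv : ∀ r, deriv F r = d * r ^ (d - 1) * φ (p.1, r • θ)
      + r ^ d * fderiv ℝ φ (p.1, r • θ) (0, θ) := fun r => ((hasDerivAt_pow d r).mul (hpath r)).deriv
  have key := hFc.integral_Ioi_deriv_eq hFd 0
  rw [hF0, neg_zero] at key
  rw [integral_radialMeasure]
  have : ∫ r in Ioi (0 : ℝ), u p * θ i * deriv F r = 0 := by
    rw [integral_const_mul, key, mul_zero]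
  refine Eq.trans ?_ this
  refine setIntegral_congr_fun measurableSet_Ioi fun r hr => ?_
  have hr0 : (0 : ℝ) < r := hr
  simp only [hFderiv]
  by_cases hr2 : 1 / 4 < r ^ 2 ∧ r ^ 2 < 4
  · rw [radialExt_polarPoint _ _ hr0 hp hr2]
    simp only [polarPoint, PiLp.smul_apply, smul_eq_mul]
    rw [← hθ]
    have e1 : fderiv ℝ φ (p.1, r • θ) (0, r • θ) = r * fderiv ℝ φ (p.1, r • θ) (0, θ) := by
      rw [← smul_eq_mul, ← map_smul]
      simp
    -- For `d = 0` the exponent is truncated, but the prefactor vanishes.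
    have e2 : (d : ℝ) * r ^ (d - 1) = d * (r ^ d * r⁻¹) := by
      rcases Nat.eq_zero_or_pos d with h | h
      · simp [h]
      · rw [pow_sub₀ _ hr0.ne' h, pow_one]
    rw [e1, e2]
    field_simp
  · rw [radialExt_polarPoint_eq_zero _ _ _ hr0 hr2]
    have h1 : φ (p.1, r • θ) = 0 := image_eq_zero_of_notMem_tsupport (hout r hr2)
    have h2 : fderiv ℝ φ (p.1, r • θ) = 0 :=
      image_eq_zero_of_notMem_tsupport fun h => hout r hr2 (tsupport_fderiv_subset ℝ h)
    simp [h1, h2]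

theorem memLp_component {G : E d × Sph d → E d} (hG : MemLp G 2 (measureQ d)) (i : Fin (d + 1)) :
    MemLp (fun p => G p i) 2 (measureQ d) :=
  (EuclideanSpace.proj (𝕜 := ℝ) i : E d →L[ℝ] ℝ).comp_memLp' hG

theorem memLp_radial_test (hφ : ContDiff ℝ ∞ φ) (hc : HasCompactSupport φ) (i : Fin (d + 1)) :
    MemLp (fun z : E d × E d => z.2 i * (d * φ z + fderiv ℝ φ z (0, z.2))) 2 := by
  have h1 := hφ.continuous
  have h2 : Continuous fun z : E d × E d => fderiv ℝ φ z (0, z.2) :=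
    (hφ.continuous_fderiv (by simp)).clm_apply (by fun_prop)
  have h3 : Continuous fun z : E d × E d => z.2 i := by fun_prop
  refine (h3.mul ((continuous_const.mul h1).add h2)).memLp_of_hasCompactSupport ?_
  refine hc.mono' fun z hz => ?_
  contrapose! hz
  have e1 := image_eq_zero_of_notMem_tsupport hz
  have e2 : fderiv ℝ φ z = 0 :=
    image_eq_zero_of_notMem_tsupport fun h => hz (tsupport_fderiv_subset ℝ h)
  simp [e1, e2]

/-- A function homogeneous of degree 0 in `v` has velocity gradient `|v|⁻¹∇_θ u`, hence the weight
`r⁻¹`. Weakly, the tangent projection of `φ eᵢ` is used as test field on each sphere, and the radial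
remainder of its divergence is removed by `integral_ray_eq_zero`. -/
theorem HasAngularGradient.radialExt_grad_of_interior {u : E d × Sph d → ℝ}
    {G : E d × Sph d → E d} (hG : HasAngularGradient u G) (hu : MemLp u 2 (measureQ d))
    (hφ : ContDiff ℝ ∞ φ) (hc : HasCompactSupport φ) (hO : tsupport φ ⊆ incomingRegion d)
    (hI : tsupport φ ⊆ {z | z.1 ∈ halfSpace d}) (i : Fin (d + 1)) :
    ∫ z, φ z * radialExt (fun r => (r ^ 1)⁻¹) (fun p => G p i) z
      = - ∫ z, fderiv ℝ φ z (velDir i) * radialExt (fun r => r ^ 0) u z := by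
  have i1 : Integrable fun z => φ z * radialExt (fun r => (r ^ 1)⁻¹) (fun p => G p i) z :=
    (memLp_test hφ hc).integrable_mul
      (memLp_radialExt_inv_pow (memLp_component hG.memLp i) (by norm_num))
  have i2 : Integrable fun z => fderiv ℝ φ z (velDir i) * radialExt (fun r => r ^ 0) u z :=
    (memLp_fderiv_test hφ hc continuous_const).integrable_mul
      (memLp_radialExt_pow hu (by norm_num))
  have i3 : Integrable fun z : E d × E d => radialExt (fun r => (r ^ 2)⁻¹) u z
      * (z.2 i * (d * φ z + fderiv ℝ φ z (0, z.2))) :=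
    (memLp_radialExt_inv_pow hu le_rfl).integrable_mul (memLp_radial_test hφ hc i)
  have i23 : Integrable fun z : E d × E d => radialExt (fun r => (r ^ 2)⁻¹) u z
      * (z.2 i * (d * φ z + fderiv ℝ φ z (0, z.2)))
      - fderiv ℝ φ z (velDir i) * radialExt (fun r => r ^ 0) u z := i3.sub i2
  have hz3 := integral_eq_zero_of_integral_rays_eq_zero i3
    (fun z hz => by simp [radialExt_eq_zero _ _ hz]) (integral_ray_eq_zero hφ hO u i)
  have key := integral_eq_of_integral_slices_eq i1 i23
    (fun z hz => by simp [radialExt_eq_zero _ _ hz])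
    (fun z hz => by simp [radialExt_eq_zero _ _ hz]) (fun r hr => by
      by_cases hr2 : 1 / 4 < r ^ 2 ∧ r ^ 2 < 4
      · have hw := hG.weak _ (isInteriorTest_tangentField hφ hc hI hr.ne'
          (EuclideanSpace.single i 1)) (inner_tangentField r _)
        have e1 : ∫ p, φ (polarPoint (p, r)) * radialExt (fun r => (r ^ 1)⁻¹) (fun p => G p i)
            (polarPoint (p, r)) ∂measureQ d
            = r⁻¹ * ∫ p, ⟪G p, tangentField φ r (EuclideanSpace.single i 1) (emb p)⟫
              ∂measureQ d := by
          rw [← integral_const_mul]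
          refine integral_congr_ae ?_
          filter_upwards [ae_mem_halfSpace, hG.tangent] with p hp ht
          rw [radialExt_polarPoint _ _ hr hp hr2, inner_tangentField_of_tangent ht]
          ring
        rw [e1, hw, ← integral_neg, ← integral_const_mul]
        refine integral_congr_ae ?_
        filter_upwards [ae_mem_halfSpace] with p hp
        rw [radialExt_polarPoint _ _ hr hp hr2, radialExt_polarPoint _ _ hr hp hr2,
          angularDiv_tangentField hφ]
        have : (polarPoint (p, r)).2 i = r * (p.2 : E d) i := rfl
        rw [this]
        field_simp
        ring
      · simp only [radialExt_polarPoint_eq_zero _ _ _ hr hr2]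
        simp)
  rw [key, integral_sub i3 i2, hz3, zero_sub]

/-- The function `1` for `xₙ ≥ 2 s` and `0` for `xₙ ≤ s`. -/
noncomputable def wallCut (s : ℝ) (x : E d) : ℝ := Real.smoothTransition (x (Fin.last d) / s - 1)

theorem contDiff_wallCut (s : ℝ) : ContDiff ℝ ∞ (wallCut s : E d → ℝ) := by
  have h : ContDiff ℝ ∞ fun x : E d => x (Fin.last d) / s - 1 := by fun_prop
  exact Real.smoothTransition.contDiff.comp h

theorem tsupport_wallCut_mul_subset (φ : E d × E d → ℝ) {s : ℝ} (hs : 0 < s) :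
    tsupport (fun z : E d × E d => wallCut s z.1 * φ z) ⊆ {z | z.1 ∈ halfSpace d} := by
  have h : Continuous fun z : E d × E d => z.1 (Fin.last d) := by fun_prop
  have h1 : tsupport (fun z : E d × E d => wallCut s z.1 * φ z) ⊆ {z | s ≤ z.1 (Fin.last d)} := by
    refine closure_minimal (fun z hz => ?_) (isClosed_le continuous_const h)
    by_contra h'
    have h2 : z.1 (Fin.last d) / s - 1 ≤ 0 := by
      rw [sub_nonpos, div_le_one hs]
      exact (not_le.1 h').le
    exact hz (by simp [wallCut, Real.smoothTransition.zero_of_nonpos h2])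
  exact fun z hz => hs.trans_le (h1 hz)

theorem fderiv_wallCut_mul (hφ : ContDiff ℝ ∞ φ) (s : ℝ) (z : E d × E d) (i : Fin (d + 1)) :
    fderiv ℝ (fun z : E d × E d => wallCut s z.1 * φ z) z (velDir i)
      = wallCut s z.1 * fderiv ℝ φ z (velDir i) := by
  have h1 : HasFDerivAt (fun z : E d × E d => wallCut s z.1)
      ((fderiv ℝ (wallCut s) z.1).comp (ContinuousLinearMap.fst ℝ (E d) (E d))) z :=
    (((contDiff_wallCut s).differentiable (by simp) _).hasFDerivAt).comp z hasFDerivAt_fst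
  have h2 : fderiv ℝ (fun z : E d × E d => wallCut s z.1 * φ z) z = _ :=
    (h1.mul (hφ.differentiable (by simp) z).hasFDerivAt).fderiv
  rw [h2]
  simp [velDir]

theorem tendsto_wallCut {s : ℕ → ℝ} (hs : ∀ n, 0 < s n) (hs0 : Tendsto s atTop (𝓝 0)) {x : E d}
    (hx : x ∈ halfSpace d) : Tendsto (fun n => wallCut (s n) x) atTop (𝓝 1) := by
  have hx' : 0 < x (Fin.last d) / 2 := half_pos hx
  refine tendsto_const_nhds.congr' ?_
  filter_upwards [hs0.eventually (gt_mem_nhds hx')] with n hn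
  have : 1 ≤ x (Fin.last d) / s n - 1 := by
    rw [le_sub_iff_add_le, le_div_iff₀ (hs n)]
    linarith
  exact (Real.smoothTransition.one_of_one_le this).symm

theorem tendsto_integral_wallCut_mul {F : E d × E d → ℝ} (hF : Integrable F)
    (hF0 : ∀ z, z.1 ∉ halfSpace d → F z = 0) {s : ℕ → ℝ} (hs : ∀ n, 0 < s n)
    (hs0 : Tendsto s atTop (𝓝 0)) :
    Tendsto (fun n => ∫ z, wallCut (s n) z.1 * F z) atTop (𝓝 (∫ z, F z)) := by
  refine tendsto_integral_of_dominated_convergence (fun z => ‖F z‖) (fun n => ?_) hF.norm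
    (fun n => .of_forall fun z => ?_) (.of_forall fun z => ?_)
  · exact ((contDiff_wallCut (s n)).continuous.comp
      continuous_fst).aestronglyMeasurable.mul hF.1
  · rw [norm_mul, wallCut, Real.norm_of_nonneg (Real.smoothTransition.nonneg _)]
    exact mul_le_of_le_one_left (norm_nonneg _) (Real.smoothTransition.le_one _)
  · by_cases hz : z.1 ∈ halfSpace d
    · simpa using (tendsto_wallCut hs hs0 hz).mul_const (F z)
    · simp [hF0 z hz]

/-- The weak angular gradient gives the velocity gradient of the radial extension. -/
theorem HasAngularGradient.radialExt_grad {u : E d × Sph d → ℝ}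
    {G : E d × Sph d → E d} (hG : HasAngularGradient u G) (hu : MemLp u 2 (measureQ d))
    (hφ : ContDiff ℝ ∞ φ) (hc : HasCompactSupport φ) (hO : tsupport φ ⊆ incomingRegion d)
    (i : Fin (d + 1)) :
    ∫ z, φ z * radialExt (fun r => (r ^ 1)⁻¹) (fun p => G p i) z
      = - ∫ z, fderiv ℝ φ z (velDir i) * radialExt (fun r => r ^ 0) u z := by
  have i1 : Integrable fun z => φ z * radialExt (fun r => (r ^ 1)⁻¹) (fun p => G p i) z :=
    (memLp_test hφ hc).integrable_mul
      (memLp_radialExt_inv_pow (memLp_component hG.memLp i) (by norm_num))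
  have i2 : Integrable fun z => fderiv ℝ φ z (velDir i) * radialExt (fun r => r ^ 0) u z :=
    (memLp_fderiv_test hφ hc continuous_const).integrable_mul
      (memLp_radialExt_pow hu (by norm_num))
  have hs : ∀ n : ℕ, 0 < 1 / ((n : ℝ) + 1) := fun n => by positivity
  have hs0 := tendsto_one_div_add_atTop_nhds_zero_nat (𝕜 := ℝ)
  have l1 := tendsto_integral_wallCut_mul i1
    (fun z hz => by simp [radialExt_eq_zero _ _ hz]) hs hs0
  have l2 := (tendsto_integral_wallCut_mul i2
    (fun z hz => by simp [radialExt_eq_zero _ _ hz]) hs hs0).neg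
  refine tendsto_nhds_unique l1 (l2.congr fun n => ?_)
  -- The wall cutoff depends on `x` only, so velocity derivatives pass through it and the limit
  -- produces no boundary term.
  have hcut : ContDiff ℝ ∞ fun z : E d × E d => wallCut (1 / ((n : ℝ) + 1)) z.1 * φ z :=
    ((contDiff_wallCut _).comp contDiff_fst).mul hφ
  have h := hG.radialExt_grad_of_interior hu hcut hc.mul_left
    ((tsupport_mul_subset_right).trans hO) (tsupport_wallCut_mul_subset φ (hs n)) i
  simp only [fderiv_wallCut_mul hφ, mul_assoc] at h
  exact h.symm

end WeakGradient

end FokkerPlanck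

/-! ### The maximum principle on `Q` -/

namespace FokkerPlanck

variable {d : ℕ}

theorem velCut_ne_zero_of_mem {v : E d} (hv : 3 / 4 < ‖v‖ ^ 2 ∧ ‖v‖ ^ 2 < 5 / 4) :
    velCut v ≠ 0 := by
  have : velCut v = 1 := by
    unfold velCut
    apply ContDiffBump.one_of_mem_closedBall
    rw [Metric.mem_closedBall, Real.dist_eq, abs_le]
    constructor <;> linarith [hv.1, hv.2]
  rw [this]
  exact one_ne_zero

theorem ae_norm_le_toReal_eLpNorm_top {X : Type*} [MeasurableSpace X] {μ : Measure X} {c : X → ℝ}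
    (hc : MemLp c ⊤ μ) : ∀ᵐ x ∂μ, ‖c x‖ ≤ (eLpNorm c ⊤ μ).toReal := by
  rw [eLpNorm_exponent_top]
  filter_upwards [enorm_ae_le_eLpNormEssSup c μ] with x hx
  rw [← toReal_enorm]
  refine ENNReal.toReal_mono ?_ hx
  rw [← eLpNorm_exponent_top]
  exact hc.2.ne

theorem memLp_top_comp_fst {c : E d → ℝ} (hc : MemLp c ⊤ (volume.restrict (halfSpace d))) :
    MemLp (fun p : E d × Sph d => c p.1) ⊤ (measureQ d) := by
  refine memLp_top_of_bound (hc.1.comp_quasiMeasurePreserving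
    Measure.quasiMeasurePreserving_fst) (eLpNorm c ⊤ (volume.restrict (halfSpace d))).toReal ?_
  have h := ae_norm_le_toReal_eLpNorm_top hc
  exact Measure.quasiMeasurePreserving_fst.ae h

/-- Compact support enters the maximum principle through this fact: the source of the kinetic system
has to be square integrable. -/
theorem memLp_two_of_bounded_of_compact {f : E d × Sph d → ℝ} (hf : MemLp f ⊤ (measureQ d))
    (hK : ∃ K : Set (E d × Sph d), IsCompact K ∧ ∀ᵐ p ∂(measureQ d), p ∉ K → f p = 0) :
    MemLp f 2 (measureQ d) := by
  obtain ⟨K, hK, hfK⟩ := hK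
  have hμ : measureQ d K < ⊤ := by
    have : IsFiniteMeasureOnCompacts (measureQ d) := by unfold measureQ; infer_instance
    exact hK.measure_lt_top
  have h1 : MemLp f 2 ((measureQ d).restrict K) := by
    have : IsFiniteMeasure ((measureQ d).restrict K) := ⟨by simpa using hμ⟩
    exact (hf.restrict K).mono_exponent le_top
  have h2 : MemLp (K.indicator f) 2 (measureQ d) :=
    (memLp_indicator_iff_restrict hK.measurableSet).2 h1
  refine h2.ae_eq ?_
  filter_upwards [hfK] with p hp
  by_cases h : p ∈ K
  · rw [indicator_of_mem h]
  · rw [indicator_of_notMem h, hp h]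

/-- The one-sided maximum principle. -/
theorem le_of_hasAngularGradient {ε σ₀ lam₀ : ℝ} (hσ₀ : 0 < σ₀)
    (hlam₀ : 0 < lam₀) {σ lam : E d → ℝ}
    (hσ : MemLp σ ⊤ (volume.restrict (halfSpace d)))
    (hlam : MemLp lam ⊤ (volume.restrict (halfSpace d)))
    (hσ_lower : ∀ᵐ x ∂(volume.restrict (halfSpace d)), σ₀ ≤ σ x)
    (hlam_lower : ∀ᵐ x ∂(volume.restrict (halfSpace d)), lam₀ ≤ lam x)
    {f u : E d × Sph d → ℝ} {G : E d × Sph d → E d} (hf : MemLp f 2 (measureQ d))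
    (hu : MemLp u 2 (measureQ d)) (hG : HasAngularGradient u G)
    (hweak : ∀ φ : E d × E d → ℝ, IsTest φ →
      ∫ p, (ε ^ 2 * σ p.1 * ⟪G p, angularGrad φ p⟫ - u p * transport φ p
          + lam p.1 * u p * φ (emb p)) ∂(measureQ d) = ∫ p, f p * φ (emb p) ∂(measureQ d))
    {C : ℝ} (hC : 0 ≤ C) (hfC : ∀ᵐ p ∂measureQ d, f p ≤ C) :
    ∀ᵐ p ∂measureQ d, u p ≤ lam₀⁻¹ * C := by
  have hσQ : ∀ᵐ p ∂measureQ d, σ₀ ≤ σ p.1 := Measure.quasiMeasurePreserving_fst.ae hσ_lower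
  have hlamQ : ∀ᵐ p ∂measureQ d, lam₀ ≤ lam p.1 := Measure.quasiMeasurePreserving_fst.ae hlam_lower
  have hlu : MemLp (fun p => lam p.1 * u p) 2 (measureQ d) := hu.mul (memLp_top_comp_fst hlam)
  have hσG : ∀ i, MemLp (fun p => ε ^ 2 * σ p.1 * G p i) 2 (measureQ d) := fun i =>
    (memLp_component hG.memLp i).mul ((memLp_top_comp_fst hσ).const_mul (ε ^ 2))
  have hs : IsKineticSystem (incomingRegion d) (radialExt (fun r => r ^ 0) u)
      (radialExt (fun r => r ^ 1) (fun p => lam p.1 * u p - f p))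
      (fun i => radialExt (fun r => (r ^ 1)⁻¹) (fun p => G p i))
      (fun i => radialExt (fun r => r ^ 2) (fun p => ε ^ 2 * σ p.1 * G p i)) :=
    { isOpen := isOpen_incomingRegion
      memLp_u := memLp_radialExt_pow hu (by norm_num)
      memLp_h := memLp_radialExt_pow (hlu.sub hf) (by norm_num)
      memLp_G := fun i => memLp_radialExt_inv_pow (memLp_component hG.memLp i) (by norm_num)
      memLp_H := fun i => memLp_radialExt_pow (hσG i) le_rfl
      grad := fun φ hφ hc hO i => hG.radialExt_grad hu hφ hc hO i
      eqn := fun φ hφ hc hO => radialExt_eqn hu hf hlu hσG hG.tangent hweak hφ hc hO }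
  have hM : 0 ≤ lam₀⁻¹ * C := by positivity
  have hle := hs.le_of_level (fun z hz => radialExt_eq_zero _ _ hz) ?_ ?_ hM ?_
  · refine ae_le_of_ae_toQ hu.1 (a := 3 / 4) (b := 5 / 4) (by norm_num) (by norm_num) ?_
    filter_upwards [hle] with z hz hzs
    have h1 := hz (velCut_ne_zero_of_mem hzs.2)
    rwa [radialExt_of_mem _ _ ⟨hzs.1, by linarith [hzs.2.1], by linarith [hzs.2.2]⟩,
      pow_zero, one_mul] at h1
  · filter_upwards [ae_toQ_of_ae hG.tangent (a := 1 / 4) (b := 4)] with z hz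
    by_cases hzs : z ∈ halfShell d (1 / 4) 4
    · have hv : z.2 = ‖z.2‖ • ((toQ z).2 : E d) := by
        have h0 : z.2 ≠ 0 := fun h => by
          have := hzs.2.1
          norm_num [h] at this
        simp only [toQ, sphereProj, if_neg h0]
        rw [smul_smul, mul_inv_cancel₀ (norm_ne_zero_iff.2 h0), one_smul]
      have h2 : ∑ i, G (toQ z) i * ((toQ z).2 : E d) i = 0 := by
        rw [← hz hzs, PiLp.inner_apply]
        exact Finset.sum_congr rfl fun i _ => by simp [mul_comm]
      have h3 : ∀ i, radialExt (fun r => r ^ 2) (fun p => ε ^ 2 * σ p.1 * G p i) z * z.2 i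
          = ‖z.2‖ ^ 3 * (ε ^ 2 * σ (toQ z).1) * (G (toQ z) i * ((toQ z).2 : E d) i) := fun i => by
        have h4 : z.2 i = ‖z.2‖ * ((toQ z).2 : E d) i := congrArg (fun v : E d => v i) hv
        rw [radialExt_of_mem _ _ hzs, h4]
        ring
      simp only [h3]
      rw [← Finset.mul_sum, h2, mul_zero]
    · exact Finset.sum_eq_zero fun i _ => by rw [radialExt_of_notMem _ _ hzs, zero_mul]
  · filter_upwards [ae_toQ_of_ae hσQ (a := 1 / 4) (b := 4)] with z hz
    refine Finset.sum_nonneg fun i _ => ?_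
    by_cases hzs : z ∈ halfShell d (1 / 4) 4
    · rw [radialExt_of_mem _ _ hzs, radialExt_of_mem _ _ hzs]
      have h0 : 0 ≤ σ (toQ z).1 := hσ₀.le.trans (hz hzs)
      have e : ‖z.2‖ ^ 2 * (ε ^ 2 * σ (toQ z).1 * G (toQ z) i)
          * ((‖z.2‖ ^ 1)⁻¹ * G (toQ z) i)
          = ‖z.2‖ ^ 2 * ε ^ 2 * (‖z.2‖ ^ 1)⁻¹ * σ (toQ z).1 * G (toQ z) i ^ 2 := by ring
      rw [e]
      positivity
    · rw [radialExt_of_notMem _ _ hzs, zero_mul]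
  · filter_upwards [ae_toQ_of_ae hlamQ (a := 1 / 4) (b := 4),
      ae_toQ_of_ae hfC (a := 1 / 4) (b := 4)] with z h1 h2 hz
    by_cases hzs : z ∈ halfShell d (1 / 4) 4
    · rw [radialExt_of_mem _ _ hzs] at hz ⊢
      rw [pow_zero, one_mul] at hz
      have hv : 0 < ‖z.2‖ := by
        by_contra h
        have := hzs.2.1
        have h' : ‖z.2‖ = 0 := le_antisymm (not_lt.1 h) (norm_nonneg _)
        norm_num [h'] at this
      have hu0 : 0 < u (toQ z) := hM.trans_lt hz
      have h3 : C < lam₀ * u (toQ z) := by rwa [inv_mul_lt_iff₀ hlam₀] at hz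
      have h4 := mul_le_mul_of_nonneg_right (h1 hzs) hu0.le
      have h5 := h2 hzs
      exact mul_pos (by positivity) (by linarith)
    · rw [radialExt_of_notMem _ _ hzs] at hz
      exact absurd hz (not_lt.2 hM)

theorem HasAngularGradient.neg {u : E d × Sph d → ℝ} {G : E d × Sph d → E d}
    (hG : HasAngularGradient u G) : HasAngularGradient (fun p => -u p) (fun p => -G p) where
  memLp := hG.memLp.neg
  tangent := by
    filter_upwards [hG.tangent] with p hp
    rw [inner_neg_left, hp, neg_zero]
  weak X hX ht := by
    simp only [inner_neg_left, neg_mul, integral_neg, hG.weak X hX ht]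

end FokkerPlanck

theorem lemma2p3 (d : ℕ) (hd : 1 ≤ d) (ε σ₀ lam₀ : ℝ)
    (hε : 0 < ε) (hσ₀ : 0 < σ₀) (hlam₀ : 0 < lam₀)
    (σ lam : FokkerPlanck.E d → ℝ)
    (hσ : MemLp σ ⊤ (volume.restrict (FokkerPlanck.halfSpace d)))
    (hlam : MemLp lam ⊤ (volume.restrict (FokkerPlanck.halfSpace d)))
    (hσ_lower : ∀ᵐ x ∂(volume.restrict (FokkerPlanck.halfSpace d)), σ₀ ≤ σ x)
    (hlam_lower : ∀ᵐ x ∂(volume.restrict (FokkerPlanck.halfSpace d)), lam₀ ≤ lam x)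
    (f : FokkerPlanck.E d × FokkerPlanck.Sph d → ℝ)
    (hf : MemLp f ⊤ (FokkerPlanck.measureQ d))
    (hf_supp : ∃ K : Set (FokkerPlanck.E d × FokkerPlanck.Sph d), IsCompact K ∧
      ∀ᵐ p ∂(FokkerPlanck.measureQ d), p ∉ K → f p = 0)
    (u : FokkerPlanck.E d × FokkerPlanck.Sph d → ℝ)
    (hu : FokkerPlanck.IsWeakSolution ε σ lam f (fun _ => 0) u) :
    eLpNorm u ⊤ (FokkerPlanck.measureQ d)
      ≤ ENNReal.ofReal lam₀⁻¹ * eLpNorm f ⊤ (FokkerPlanck.measureQ d) := by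
  obtain ⟨hY, G, hG, hweak⟩ := hu
  simp only [zero_mul, integral_zero, add_zero] at hweak
  have hf2 := FokkerPlanck.memLp_two_of_bounded_of_compact hf hf_supp
  set C : ℝ := (eLpNorm f ⊤ (FokkerPlanck.measureQ d)).toReal with hC
  have hC0 : 0 ≤ C := ENNReal.toReal_nonneg
  have hfC : ∀ᵐ p ∂FokkerPlanck.measureQ d, ‖f p‖ ≤ C :=
    FokkerPlanck.ae_norm_le_toReal_eLpNorm_top hf
  have h1 := FokkerPlanck.le_of_hasAngularGradient hσ₀ hlam₀ hσ hlam hσ_lower hlam_lower hf2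
    hY.memLp hG hweak hC0 (hfC.mono fun p hp => (le_abs_self _).trans hp)
  -- By linearity `-u` solves the problem with data `-f`, which gives the lower bound.
  have h2 := FokkerPlanck.le_of_hasAngularGradient (ε := ε) (f := fun p => -f p)
    (u := fun p => -u p) hσ₀ hlam₀ hσ hlam hσ_lower hlam_lower hf2.neg hY.memLp.neg hG.neg (fun φ hφ => by
      simp only [neg_mul, integral_neg, ← hweak φ hφ]
      rw [← integral_neg]
      refine integral_congr_ae (.of_forall fun p => ?_)
      simp only [inner_neg_left]
      ring) hC0 (hfC.mono fun p hp => (neg_le_abs _).trans hp)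
  have h3 : ∀ᵐ p ∂FokkerPlanck.measureQ d, ‖u p‖ ≤ lam₀⁻¹ * C := by
    filter_upwards [h1, h2] with p hp hp'
    exact abs_le.2 ⟨by linarith, hp⟩
  have h4 := eLpNorm_le_of_ae_bound (p := ⊤) h3
  -- At exponent `⊤` the measure of the whole space enters with power 0, hence as the factor 1, even
  -- though it is infinite.
  rwa [ENNReal.toReal_top, inv_zero, ENNReal.rpow_zero, one_mul,
    ENNReal.ofReal_mul (inv_nonneg.2 hlam₀.le), hC, ENNReal.ofReal_toReal hf.2.ne] at h4
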